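/- Let $\mathbb B$ be the open unit ball of the quaternions $\mathbb H$, let $\mathbb S=\{I\in\mathbb H: I^2=-1\}$, and for $I\in\mathbb S$ put $L_I=\mathbb R+\mathbb R I$, $\mathbb B_I=\mathbb B\cap L_I$. A function $f:\mathbb B\to\mathbb H$ is regular if for every $I\in\mathbb S$ its restriction to $\mathbb B_I$ has continuous partial derivatives and satisfies $\frac12\left(\frac{\partial}{\partial x}+I\frac{\partial}{\partial y}\right)f(x+yI)=0$. For $0<p<\infty$ put $\|f\|_p=\sup_{I\in\mathbb S}\lim_{r\to1^-}\left(\frac1{2\pi}\int_0^{2\pi}|f(re^{I\theta})|^p\,d\theta\right)^{1/p}$, and $\|f\|_\infty=\sup_{\mathbb B}|f|$; $H^p(\mathbb B)$ is the set of regular $f$ with $\|f\|_p<\infty$. The symbol $*$ denotes the regular product (for power series, $\left(\sum q^na_n\right)*\left(\sum q^nb_n\right)=\sum_n q^n\sum_{k=0}^n a_kb_{n-k}$), and $f^{-*}$ the regular reciprocal. The Blaschke factor of $a\in\mathbb B$ is $M_a(q)=(1-q\bar a)^{-*}*(a-q)\,\frac{\bar a}{|a|}$ if $a\ne0$, and $M_0(q)=q$.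 The Blaschke product of a finite (possibly empty) or infinite sequence $(a_n)$ in $\mathbb B$ with $\sum_n(1-|a_n|)<\infty$ is the function $M_{a_0}*M_{a_1}*M_{a_2}*\cdots$, where the partial regular products converge uniformly on compact subsets of $\mathbb B$. If $y\neq0$ and $f(q)=\left((q-x)^2+y^2\right)^m(q-p_1)*\dots*(q-p_n)*k(q)$ with $p_i\in x+y\mathbb S\subset\mathbb B$, $p_i\ne\overline{p_{i+1}}$, and $k$ regular without zeros on $x+y\mathbb S$, then $f$ has spherical multiplicity $2m$ and isolated multiplicity $n$ on $x+y\mathbb S$; if $y=0$ and $f(q)=(q-x)^nk(q)$ with $k$ regular and $k(x)\neq0$, then $f$ has isolated multiplicity $n$ at $x$, and we put $m=0$. **Theorem.** Let $0<p\le\infty$ and let $f\in H^p(\mathbb B)$ be not identically zero. Then there are regular functions $h,g$ on $\mathbb B$ such that $$f=h*g,$$ $h(q)\ne0$ for every $q\in\mathbb B$, and $g$ is a Blaschke product. Moreover $h$ and $g$ can be chosen so that $g=B_s*B_i$, where $B_s$ is the Blaschke product of a sequence $\alpha_0,\overline{\alpha_0},\alpha_1,\overline{\alpha_1},\dots$ of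 non-real points, $B_i$ is the Blaschke product of a sequence $c_0,c_1,\dots$, and for every $x+y\mathbb S\subset\mathbb B$ ($x,y\in\mathbb R$) the multiplicities $2m$ and $n$ of $f$ on $x+y\mathbb S$ exist, exactly $m$ indices $j$ satisfy $\alpha_j\in x+y\mathbb S$, and exactly $n$ indices $j$ satisfy $c_j\in x+y\mathbb S$. (So $B_s$ is built from the spherical zeros of $f$, and $B_i$ from points conjugate to the isolated zeros of $f$, with multiplicities.) -/

import Mathlib

open scoped Quaternion ENNReal Topology

noncomputable section

namespace QuatHardy

/-- The open unit ball of the quaternions. -/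
def unitBall : Set ℍ[ℝ] := {q | ‖q‖ < 1}

/-- The sphere of imaginary units. -/
def imagUnits : Set ℍ[ℝ] := {I | I * I = -1}

/-- The point `x + y I`. -/
def slicePoint (I : ℍ[ℝ]) (x y : ℝ) : ℍ[ℝ] := (x : ℍ[ℝ]) + y • I

/-- The sphere `x + y 𝕊` (the single point `x` if `y = 0`). -/
def sphereAt (x y : ℝ) : Set ℍ[ℝ] := {q | ∃ I ∈ imagUnits, q = slicePoint I x y}

/-- Slice regularity on the unit ball: for every imaginary unit `I`, the restriction of `f` to the
disc of the plane `ℝ + ℝ I` is continuously differentiable and satisfies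
`(1/2) (∂/∂x + I ∂/∂y) f (x + y I) = 0`. Values of `f` outside the ball play no role. -/
def IsSliceRegular (f : ℍ[ℝ] → ℍ[ℝ]) : Prop :=
  ∀ I ∈ imagUnits,
    ContDiffOn ℝ 1 (fun p : ℝ × ℝ => f (slicePoint I p.1 p.2)) {p | p.1 ^ 2 + p.2 ^ 2 < 1} ∧
    ∀ p : ℝ × ℝ, p.1 ^ 2 + p.2 ^ 2 < 1 →
      (1 / 2 : ℝ) • (fderiv ℝ (fun p : ℝ × ℝ => f (slicePoint I p.1 p.2)) p (1, 0)
        + I * fderiv ℝ (fun p : ℝ × ℝ => f (slicePoint I p.1 p.2)) p (0, 1)) = 0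

/-! ### Hardy spaces -/

/-- The integral mean `M_p(f_I, r)` for `0 < p < ∞`, with values in `[0, ∞]`. -/
def integralMean (p : ℝ) (f : ℍ[ℝ] → ℍ[ℝ]) (I : ℍ[ℝ]) (r : ℝ) : ℝ≥0∞ :=
  (ENNReal.ofReal (1 / (2 * Real.pi)) *
    ∫⁻ θ in Set.Ioc 0 (2 * Real.pi),
      ‖f (slicePoint I (r * Real.cos θ) (r * Real.sin θ))‖ₑ ^ p) ^ (1 / p)

/-- The Hardy norm, with values in `[0, ∞]`. For regular `f` the mean is increasing in `r`, so the
`limsup` as `r → 1⁻` is the limit. -/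
def hardyNorm (p : ℝ≥0∞) (f : ℍ[ℝ] → ℍ[ℝ]) : ℝ≥0∞ :=
  if p = ⊤ then ⨆ q ∈ unitBall, ‖f q‖ₑ
  else ⨆ I ∈ imagUnits, Filter.limsup (fun r : ℝ => integralMean p.toReal f I r) (𝓝[<] 1)

/-- Membership in the quaternionic Hardy space `H^p` of the unit ball. -/
def MemHardy (p : ℝ≥0∞) (f : ℍ[ℝ] → ℍ[ℝ]) : Prop :=
  IsSliceRegular f ∧ hardyNorm p f < ⊤

/-! ### Splitting, extension and the regular product

The plane `L_I` is identified with `ℂ` for `I = i`, and `J = j` is the orthogonal unit; for regular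
functions the operations below do not depend on this choice. -/

/-- The unit `i`. -/
def unitI : ℍ[ℝ] := ⟨0, 1, 0, 0⟩

/-- The unit `j`. -/
def unitJ : ℍ[ℝ] := ⟨0, 0, 1, 0⟩

/-- The component `F` of the splitting `f (z) = F (z) + G (z) j` on the slice of `i`. -/
def splitF (f : ℍ[ℝ] → ℍ[ℝ]) (z : ℂ) : ℂ := ⟨(f (z : ℍ[ℝ])).re, (f (z : ℍ[ℝ])).imI⟩

/-- The component `G` of the splitting `f (z) = F (z) + G (z) j` on the slice of `i`. -/
def splitG (f : ℍ[ℝ] → ℍ[ℝ]) (z : ℂ) : ℂ := ⟨(f (z : ℍ[ℝ])).imJ, (f (z : ℍ[ℝ])).imK⟩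

/-- Extension of a function on the slice of `i`: the value at `x + y J` is
`(1/2) (φ (x + y i) + φ (x - y i)) + J (i/2) (φ (x - y i) - φ (x + y i))`,
where `y = ‖im q‖` and `J = im q / ‖im q‖` (the second summand is zero for real `q`). -/
def sliceExt (φ : ℂ → ℍ[ℝ]) (q : ℍ[ℝ]) : ℍ[ℝ] :=
  (1 / 2 : ℝ) • (φ ⟨q.re, ‖q.im‖⟩ + φ ⟨q.re, -‖q.im‖⟩)
    + (‖q.im‖⁻¹ • q.im) * ((1 / 2 : ℝ) • unitI) * (φ ⟨q.re, -‖q.im‖⟩ - φ ⟨q.re, ‖q.im‖⟩)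

/-- The regular product `f * g`. -/
def starMul (f g : ℍ[ℝ] → ℍ[ℝ]) : ℍ[ℝ] → ℍ[ℝ] :=
  sliceExt fun z =>
    ((splitF f z * splitF g z
        - splitG f z * starRingEnd ℂ (splitG g (starRingEnd ℂ z)) : ℂ) : ℍ[ℝ])
    + ((splitF f z * splitG g z
        + splitG f z * starRingEnd ℂ (splitF g (starRingEnd ℂ z)) : ℂ) : ℍ[ℝ]) * unitJ

/-- The regular conjugate `f^c`. -/
def regConj (f : ℍ[ℝ] → ℍ[ℝ]) : ℍ[ℝ] → ℍ[ℝ] :=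
  sliceExt fun z =>
    ((starRingEnd ℂ (splitF f (starRingEnd ℂ z)) : ℂ) : ℍ[ℝ])
    - ((splitG f z : ℂ) : ℍ[ℝ]) * unitJ

/-- The symmetrization `f^s = f * f^c`. -/
def symmetrization (f : ℍ[ℝ] → ℍ[ℝ]) : ℍ[ℝ] → ℍ[ℝ] := starMul f (regConj f)

/-- The regular reciprocal `f^{-*} = (f^s)⁻¹ f^c`, meaningful where `f^s` does not vanish. -/
def regRecip (f : ℍ[ℝ] → ℍ[ℝ]) (q : ℍ[ℝ]) : ℍ[ℝ] := (symmetrization f q)⁻¹ * regConj f q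

/-! ### Blaschke products -/

open Classical in
/-- The Blaschke factor `M_a (q) = (1 - q ā)^{-*} * (a - q) ā / |a|`, and `M_0 (q) = q`. -/
def blaschkeFactor (a : ℍ[ℝ]) (q : ℍ[ℝ]) : ℍ[ℝ] :=
  if a = 0 then q
  else starMul (regRecip fun w => 1 - w * star a) (fun w => a - w) q * (‖a‖⁻¹ • star a)

open Classical in
/-- The regular product of the factors `M_{a_i}` over all `i < k` with `i < N`. -/
def partialProduct (N : ℕ∞) (a : ℕ → ℍ[ℝ]) : ℕ → ℍ[ℝ] → ℍ[ℝ]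
  | 0 => fun _ => 1
  | k + 1 =>
    if (k : ℕ∞) < N then starMul (partialProduct N a k) (blaschkeFactor (a k))
    else partialProduct N a k

/-- `B` is the Blaschke product of the finite or infinite sequence `(a_n)` with `n < N` of points of
the ball: the partial regular products converge to `B` uniformly on compact subsets of the ball.
As for every infinite product, convergence excludes a product that diverges to zero; here this is
the Blaschke condition `∑ (1 - |a_n|) < ∞`. -/
def IsBlaschkeProductOf (N : ℕ∞) (a : ℕ → ℍ[ℝ]) (B : ℍ[ℝ] → ℍ[ℝ]) : Prop :=
  (∀ n : ℕ, (n : ℕ∞) < N → a n ∈ unitBall) ∧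
  Summable (fun n : {n : ℕ // (n : ℕ∞) < N} => 1 - ‖a n‖) ∧
  ∀ K ⊆ unitBall, IsCompact K → TendstoUniformlyOn (partialProduct N a) B Filter.atTop K

/-- A Blaschke product, with finitely many (possibly no) or infinitely many factors. -/
def IsBlaschkeProduct (B : ℍ[ℝ] → ℍ[ℝ]) : Prop :=
  ∃ (N : ℕ∞) (a : ℕ → ℍ[ℝ]), IsBlaschkeProductOf N a B

/-! ### Multiplicities of zeros -/

/-- The regular product `(q - p₁) * ⋯ * (q - pₙ)`. -/
def linearProduct : List ℍ[ℝ] → ℍ[ℝ] → ℍ[ℝ]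
  | [] => fun _ => 1
  | p :: ps => starMul (fun q => q - p) (linearProduct ps)

/-- On the sphere `x + y 𝕊`, `f` has spherical multiplicity `2 m` and isolated multiplicity `n`
(both `0` if `f` has no zero there). If `y ≠ 0` this means
`f (q) = ((q - x)² + y²)^m (q - p₁) * ⋯ * (q - pₙ) * g (q)` with `pᵢ ∈ x + y 𝕊`, `pᵢ ≠ p̄ᵢ₊₁` and
`g` regular without zeros on the sphere; if `y = 0` it means `m = 0` and `f (q) = (q - x)^n g (q)`
with `g` regular and `g (x) ≠ 0`. -/
def HasMultiplicities (f : ℍ[ℝ] → ℍ[ℝ]) (x y : ℝ) (m n : ℕ) : Prop :=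
  (y ≠ 0 ∧ ∃ (ps : List ℍ[ℝ]) (g : ℍ[ℝ] → ℍ[ℝ]),
    ps.length = n ∧ (∀ p ∈ ps, p ∈ sphereAt x y) ∧ ps.IsChain (fun p p' => p ≠ star p') ∧
    IsSliceRegular g ∧ (∀ q ∈ sphereAt x y, g q ≠ 0) ∧
    ∀ q ∈ unitBall, f q = ((q - (x : ℍ[ℝ])) ^ 2 + ((y ^ 2 : ℝ) : ℍ[ℝ])) ^ m
      * starMul (linearProduct ps) g q) ∨
  (y = 0 ∧ m = 0 ∧ ∃ g : ℍ[ℝ] → ℍ[ℝ],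
    IsSliceRegular g ∧ g (x : ℍ[ℝ]) ≠ 0 ∧ ∀ q ∈ unitBall, f q = (q - (x : ℍ[ℝ])) ^ n * g q)

/-- The sequence `α₀, ᾱ₀, α₁, ᾱ₁, …`. -/
def conjPairs (α : ℕ → ℍ[ℝ]) (k : ℕ) : ℍ[ℝ] :=
  if k % 2 = 0 then α (k / 2) else star (α (k / 2))

end QuatHardy

end

open QuatHardy

/-! On the slice of `i` write f = F + G j, and let A(z) be the matrix with rows (F(z), G(z)) and
(-conj G(z̄), conj F(z̄)). In this dictionary the regular product is the pointwise matrix product,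
the regular conjugate is the adjugate and the symmetrization is the determinant (`starMul_eq`,
`regConj_eq`, `symmetrization_coe`). Regular functions become holomorphic matrix functions on the
disc with the symmetry `IsSymm` (`isSliceRegular_ofMat`, `IsSliceRegular.isHol`,
`IsSliceRegular.eq_ofMat`), and one has to factor such a matrix function along the zeros of d = det
A.

Blaschke condition: |d(z)| is at most |f(z)|² + |f(z̄)|², so a Hardy bound keeps the means of log
|d| bounded, and Jensen's formula makes the zeros of d summable (`summable_of_circleAverage_le`).

Multiplicities: at a nonreal z, m is the common order of vanishing of the entries of A, and d has
order 2m + n. At a real z, A(z) is the matrix of a quaternion, so det A(z) = 0 forces A(z) = 0; here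
n is the common order and d has order 2n.

Factorization: the Blaschke product over conjugate pairs is a scalar function, so the spherical part
is divided out entrywise. Where the determinant of the quotient vanishes at w, its rows are
dependent, which gives a point c of the sphere of w whose linear factor splits off on the right
(`exists_linear_factor`). Finitely many factors can thus be extracted, but the points found depend
on how many are taken. They lie on prescribed compact spheres, so a subsequence converges, and
divisibility passes to the limit because orders of vanishing do not drop (the `exists_factorization`
on matrix functions). Comparing orders, the determinant of the cofactor has no zeros, so h has none.
Since the pairs are scalar they can be interleaved with the other factors, and g is one Blaschke
product (`exists_merge`). -/

noncomputable section

/-! ### Slice functions as matrix functions. -/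

namespace QuatHardy

/-- Complex `2 × 2` matrices. -/
abbrev M2 := Matrix (Fin 2) (Fin 2) ℂ

local notation "conj" => starRingEnd ℂ

/-- The matrix of a quaternion, acting on `ℍ = ℂ + ℂ j` from the right. -/
def quatMat (q : ℍ[ℝ]) : M2 :=
  !![⟨q.re, q.imI⟩, ⟨q.imJ, q.imK⟩; -conj ⟨q.imJ, q.imK⟩, conj ⟨q.re, q.imI⟩]

/-- The matrix function of `f`, encoding the values of `f` on the slice of `i`. -/
def toMat (f : ℍ[ℝ] → ℍ[ℝ]) (z : ℂ) : M2 :=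
  !![splitF f z, splitG f z; -conj (splitG f (conj z)), conj (splitF f (conj z))]

/-- The quaternion whose complex coordinates form the first row of `A`. -/
def rowQuat (A : M2) : ℍ[ℝ] := ((A 0 0 : ℂ) : ℍ[ℝ]) + ((A 0 1 : ℂ) : ℍ[ℝ]) * unitJ

/-- The slice function with matrix function `A`. -/
def ofMat (A : ℂ → M2) : ℍ[ℝ] → ℍ[ℝ] := sliceExt fun z => rowQuat (A z)

/-- The real structure on `M2` whose fixed points are the matrices of quaternions. -/
def quatConj (A : M2) : M2 := !![conj (A 1 1), -conj (A 1 0); -conj (A 0 1), conj (A 0 0)]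

/-- Matrix functions of slice functions. -/
def IsSymm (A : ℂ → M2) : Prop := ∀ z, A (conj z) = quatConj (A z)

@[simp] lemma re_unitI : unitI.re = 0 := rfl
@[simp] lemma imI_unitI : unitI.imI = 1 := rfl
@[simp] lemma imJ_unitI : unitI.imJ = 0 := rfl
@[simp] lemma imK_unitI : unitI.imK = 0 := rfl
@[simp] lemma re_unitJ : unitJ.re = 0 := rfl
@[simp] lemma imI_unitJ : unitJ.imI = 0 := rfl
@[simp] lemma imJ_unitJ : unitJ.imJ = 1 := rfl
@[simp] lemma imK_unitJ : unitJ.imK = 0 := rfl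

@[simp] lemma re_rowQuat (A : M2) : (rowQuat A).re = (A 0 0).re := by simp [rowQuat]
@[simp] lemma imI_rowQuat (A : M2) : (rowQuat A).imI = (A 0 0).im := by simp [rowQuat]
@[simp] lemma imJ_rowQuat (A : M2) : (rowQuat A).imJ = (A 0 1).re := by simp [rowQuat]
@[simp] lemma imK_rowQuat (A : M2) : (rowQuat A).imK = (A 0 1).im := by simp [rowQuat]

lemma norm_im_coeComplex (z : ℂ) : ‖(z : ℍ[ℝ]).im‖ = |z.im| := by
  rw [← Real.sqrt_mul_self (norm_nonneg _), ← Quaternion.normSq_eq_norm_mul_self,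
    Quaternion.normSq_def', ← Real.sqrt_sq_eq_abs]
  simp

/-- For negative imaginary part the two sample points are exchanged and the unit changes to -i; the
two effects cancel. -/
lemma sliceExt_coe (φ : ℂ → ℍ[ℝ]) (z : ℂ) : sliceExt φ (z : ℍ[ℝ]) = φ z := by
  unfold sliceExt
  rw [norm_im_coeComplex]
  rcases lt_trichotomy z.im 0 with h | h | h
  · have e : (⟨z.re, - -z.im⟩ : ℂ) = z := by simp
    simp only [abs_of_neg h, Quaternion.re_coeComplex, e]
    have hne := h.ne
    have : ((-z.im)⁻¹ • (z : ℍ[ℝ]).im) * ((1/2:ℝ) • unitI) = (1/2 : ℝ) • 1 := by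
      ext <;> simp [hne]
    rw [this]
    ext <;> simp <;> ring
  · have e : (⟨z.re, 0⟩ : ℂ) = z := by apply Complex.ext <;> simp [h]
    simp only [h, abs_zero, neg_zero, Quaternion.re_coeComplex, e]
    ext <;> simp <;> ring
  · have e : (⟨z.re, z.im⟩ : ℂ) = z := by simp
    simp only [abs_of_pos h, Quaternion.re_coeComplex, e]
    have : ((z.im)⁻¹ • (z : ℍ[ℝ]).im) * ((1/2:ℝ) • unitI) = (-(1/2) : ℝ) • 1 := by
      ext <;> simp [h.ne']
    rw [this]
    ext <;> simp <;> ring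

lemma ofMat_coe (A : ℂ → M2) (z : ℂ) : ofMat A (z : ℍ[ℝ]) = rowQuat (A z) := sliceExt_coe _ _

lemma rowQuat_quatMat (q : ℍ[ℝ]) : rowQuat (quatMat q) = q := by
  ext <;> simp [quatMat]

/-- The symmetry says exactly that the second row at z is read off from the first row at z̄, so
nothing is lost in passing to the slice function. -/
lemma toMat_ofMat {A : ℂ → M2} (hA : IsSymm A) : toMat (ofMat A) = A := by
  funext z
  have := hA z
  simp only [quatConj] at this
  ext i j
  fin_cases i <;> fin_cases j <;>
    simp [toMat, splitF, splitG, ofMat_coe, this, Complex.ext_iff]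

lemma isSymm_toMat (f : ℍ[ℝ] → ℍ[ℝ]) : IsSymm (toMat f) := by
  intro z
  simp [toMat, quatConj]

lemma quatConj_mul (A B : M2) : quatConj (A * B) = quatConj A * quatConj B := by
  ext i j
  fin_cases i <;> fin_cases j <;> simp [quatConj, Matrix.mul_apply, Fin.sum_univ_two] <;> ring

lemma IsSymm.mul {A B : ℂ → M2} (hA : IsSymm A) (hB : IsSymm B) : IsSymm (fun z => A z * B z) := by
  intro z
  simp [hA z, hB z, quatConj_mul]

lemma IsSymm.adjugate {A : ℂ → M2} (hA : IsSymm A) : IsSymm (fun z => (A z).adjugate) := by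
  intro z
  simp only [hA z]
  ext i j
  fin_cases i <;> fin_cases j <;> simp [quatConj, Matrix.adjugate_fin_two]

lemma IsSymm.smul {A : ℂ → M2} {s : ℂ → ℂ} (hs : ∀ z, s (conj z) = conj (s z)) (hA : IsSymm A) :
    IsSymm (fun z => s z • A z) := by
  intro z
  simp only [hA z, hs z]
  ext i j
  fin_cases i <;> fin_cases j <;> simp [quatConj]

lemma quatConj_add (A B : M2) : quatConj (A + B) = quatConj A + quatConj B := by
  ext i j
  fin_cases i <;> fin_cases j <;> simp [quatConj] <;> ring

lemma quatConj_quatConj (A : M2) : quatConj (quatConj A) = A := by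
  ext i j
  fin_cases i <;> fin_cases j <;> simp [quatConj]

lemma quatConj_smul (s : ℂ) (A : M2) : quatConj (s • A) = conj s • quatConj A := by
  ext i j
  fin_cases i <;> fin_cases j <;> simp [quatConj]

lemma quatConj_one : quatConj 1 = 1 := by
  ext i j
  fin_cases i <;> fin_cases j <;> simp [quatConj]

lemma quatConj_quatMat (q : ℍ[ℝ]) : quatConj (quatMat q) = quatMat q := by
  ext i j
  fin_cases i <;> fin_cases j <;> simp [quatConj, quatMat]

lemma IsSymm.add {A B : ℂ → M2} (hA : IsSymm A) (hB : IsSymm B) : IsSymm (fun z => A z + B z) := by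
  intro z
  simp [hA z, hB z, quatConj_add]

lemma isSymm_const (q : ℍ[ℝ]) : IsSymm (fun _ => quatMat q) := fun _ => (quatConj_quatMat q).symm

lemma isSymm_one : IsSymm (fun _ => 1) := fun _ => quatConj_one.symm

lemma det_conj {A : ℂ → M2} (hA : IsSymm A) (z : ℂ) : (A (conj z)).det = conj (A z).det := by
  simp [hA z, quatConj, Matrix.det_fin_two]
  ring

/-- The splitting formula that defines the regular product is the first row of a matrix product.
This removes noncommutative convolution from the proof. -/
lemma starMul_eq (f g : ℍ[ℝ] → ℍ[ℝ]) : starMul f g = ofMat fun z => toMat f z * toMat g z := by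
  unfold starMul ofMat rowQuat
  congr 1
  funext z
  simp [toMat, Matrix.mul_apply, Fin.sum_univ_two, sub_eq_add_neg]

lemma toMat_starMul (f g : ℍ[ℝ] → ℍ[ℝ]) : toMat (starMul f g) = fun z => toMat f z * toMat g z := by
  rw [starMul_eq, toMat_ofMat ((isSymm_toMat f).mul (isSymm_toMat g))]

lemma regConj_eq (f : ℍ[ℝ] → ℍ[ℝ]) : regConj f = ofMat fun z => (toMat f z).adjugate := by
  unfold regConj ofMat rowQuat
  congr 1
  funext z
  ext <;> simp [toMat, Matrix.adjugate_fin_two, sub_eq_add_neg]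

lemma toMat_regConj (f : ℍ[ℝ] → ℍ[ℝ]) : toMat (regConj f) = fun z => (toMat f z).adjugate := by
  rw [regConj_eq, toMat_ofMat (isSymm_toMat f).adjugate]

lemma symmetrization_coe (f : ℍ[ℝ] → ℍ[ℝ]) (z : ℂ) :
    symmetrization f (z : ℍ[ℝ]) = ((toMat f z).det : ℂ) := by
  rw [symmetrization, starMul_eq, ofMat_coe, toMat_regConj, Matrix.mul_adjugate]
  ext <;> simp

lemma coeComplex_inv (z : ℂ) : (z : ℍ[ℝ])⁻¹ = ((z⁻¹ : ℂ) : ℍ[ℝ]) := by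
  by_cases hz : z = 0
  · subst hz; simp
  · apply inv_eq_of_mul_eq_one_right
    rw [← Quaternion.coeComplex_mul, mul_inv_cancel₀ hz]; simp

/-- Computes matrix functions of explicit f: only the values on the slice of `i` have to be
compared. -/
lemma toMat_apply_of_row {f : ℍ[ℝ] → ℍ[ℝ]} {A : ℂ → M2} (hA : IsSymm A)
    (h : ∀ z : ℂ, f z = rowQuat (A z)) : toMat f = A := by
  rw [← toMat_ofMat hA]
  funext z
  simp [toMat, splitF, splitG, h, ofMat_coe]

lemma toMat_regRecip (f : ℍ[ℝ] → ℍ[ℝ]) :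
    toMat (regRecip f) = fun z => (toMat f z).det⁻¹ • (toMat f z).adjugate := by
  apply toMat_apply_of_row
  · apply IsSymm.smul _ (isSymm_toMat f).adjugate
    intro z
    rw [det_conj (isSymm_toMat f)]; simp
  · intro z
    rw [regRecip, symmetrization_coe, regConj_eq, ofMat_coe, coeComplex_inv]
    ext <;> simp [-Complex.inv_re, -Complex.inv_im]

lemma quatMat_mul (p q : ℍ[ℝ]) : quatMat (p * q) = quatMat p * quatMat q := by
  ext i j
  fin_cases i <;> fin_cases j <;> apply Complex.ext <;>
    simp [quatMat, Matrix.mul_apply, Fin.sum_univ_two] <;> ring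

lemma quatMat_smul (r : ℝ) (q : ℍ[ℝ]) : quatMat (r • q) = (r : ℂ) • quatMat q := by
  ext i j
  fin_cases i <;> fin_cases j <;> apply Complex.ext <;> simp [quatMat]

lemma rowQuat_mul_quatMat (A : M2) (q : ℍ[ℝ]) : rowQuat (A * quatMat q) = rowQuat A * q := by
  ext <;> simp [quatMat, Matrix.mul_apply, Fin.sum_univ_two] <;> ring

end QuatHardy

end

/-! ### Values on an arbitrary slice. -/

noncomputable section

namespace QuatHardy

local notation "conj" => starRingEnd ℂ

lemma norm_of_mem_imagUnits {J : ℍ[ℝ]} (hJ : J ∈ imagUnits) : ‖J‖ = 1 := by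
  have h : ‖J‖ * ‖J‖ = 1 := by
    have : J * J = -1 := hJ
    rw [← norm_mul, this]; simp
  nlinarith [norm_nonneg J]

lemma re_of_mem_imagUnits {J : ℍ[ℝ]} (hJ : J ∈ imagUnits) : J.re = 0 := by
  have h1 : J * J = -1 := hJ
  have h := congrArg QuaternionAlgebra.re h1
  have hI := congrArg QuaternionAlgebra.imI h1
  have hj := congrArg QuaternionAlgebra.imJ h1
  have hK := congrArg QuaternionAlgebra.imK h1
  simp at h hI hj hK
  by_contra h0
  have e1 : J.imI = 0 := by
    have : J.re * J.imI = 0 := by linarith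
    simpa [h0] using this
  have e2 : J.imJ = 0 := by
    have : J.re * J.imJ = 0 := by linarith
    simpa [h0] using this
  have e3 : J.imK = 0 := by
    have : J.re * J.imK = 0 := by linarith
    simpa [h0] using this
  rw [e1, e2, e3] at h
  nlinarith [sq_nonneg J.re]

lemma unitI_mem : unitI ∈ imagUnits := by
  change unitI * unitI = -1
  ext <;> simp

lemma re_slicePoint {J : ℍ[ℝ]} (hJ : J ∈ imagUnits) (x y : ℝ) : (slicePoint J x y).re = x := by
  simp [slicePoint, re_of_mem_imagUnits hJ]

lemma im_slicePoint {J : ℍ[ℝ]} (hJ : J ∈ imagUnits) (x y : ℝ) :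
    (slicePoint J x y).im = y • J := by
  ext <;> simp [slicePoint, re_of_mem_imagUnits hJ]

/-- The right-hand side is unchanged under (J, y) ↦ (-J, -y), so the sign of y plays no role. -/
lemma sliceExt_slicePoint {φ : ℂ → ℍ[ℝ]} {J : ℍ[ℝ]} (hJ : J ∈ imagUnits) (x y : ℝ) :
    sliceExt φ (slicePoint J x y) = (1 / 2 : ℝ) • (φ ⟨x, y⟩ + φ ⟨x, -y⟩)
      + (1 / 2 : ℝ) • (J * unitI * (φ ⟨x, -y⟩ - φ ⟨x, y⟩)) := by
  unfold sliceExt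
  rw [re_slicePoint hJ, im_slicePoint hJ, norm_smul, norm_of_mem_imagUnits hJ, mul_one,
    Real.norm_eq_abs, smul_smul]
  rcases lt_trichotomy y 0 with h | h | h
  · have e : (-y)⁻¹ * y = -1 := by field_simp [h.ne]
    rw [abs_of_neg h, e, neg_neg, add_comm (φ _)]
    rw [neg_one_smul, ← neg_sub (φ ⟨x, -y⟩)]
    simp only [mul_smul_comm, smul_mul_assoc, neg_mul, neg_neg, mul_neg, smul_neg]
  · simp [h]
  · have e : y⁻¹ * y = 1 := by field_simp
    rw [abs_of_pos h, e]
    simp only [mul_smul_comm, smul_mul_assoc, one_smul]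

/-- The choice u = i + J works, as (i + J)J = iJ - 1 = i(J + i). It degenerates only for J = -i,
where j anticommutes with i. -/
lemma exists_rotation {J : ℍ[ℝ]} (hJ : J ∈ imagUnits) : ∃ u : ℍ[ℝ], u ≠ 0 ∧ u * J = unitI * u := by
  have h1 : J * J = -1 := hJ
  have h2 : unitI * unitI = -1 := unitI_mem
  by_cases h : J = -unitI
  · refine ⟨unitJ, fun h0 => ?_, ?_⟩
    · simpa using congrArg QuaternionAlgebra.imJ h0
    · rw [h]; ext <;> simp
  · refine ⟨unitI + J, fun h0 => h (by rw [add_comm] at h0; exact eq_neg_of_add_eq_zero_left h0), ?_⟩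
    rw [add_mul, mul_add, h1, h2, add_comm]

/-- With u = u₁ + u₂ j, moving u past J turns the extension formula into u₁ φ(z) + u₂ j φ(z̄), and j
φ(z̄) is the second row of A(z). So a value on the slice of J is, up to u, a combination of the rows
of A at one point. -/
lemma mul_ofMat {A : ℂ → M2} (hA : IsSymm A) {J u : ℍ[ℝ]} (hJ : J ∈ imagUnits)
    (hu : u * J = unitI * u) (x y : ℝ) :
    u * ofMat A (slicePoint J x y) = rowQuat (quatMat u * A ⟨x, y⟩) := by
  have e : (⟨x, -y⟩ : ℂ) = conj ⟨x, y⟩ := rfl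
  have h0 : rowQuat (A ⟨x, -y⟩) = rowQuat (quatConj (A ⟨x, y⟩)) := by rw [e, hA]
  rw [ofMat, sliceExt_slicePoint hJ, mul_add, mul_smul_comm, mul_smul_comm, ← mul_assoc, ← mul_assoc,
    hu, h0]
  generalize A ⟨x, y⟩ = B
  ext <;> simp [quatConj, quatMat, Matrix.vecMul, dotProduct, Fin.sum_univ_two] <;> ring

/-- The representative in the closed upper half plane of the sphere of `q`. -/
def slicePt (q : ℍ[ℝ]) : ℂ := ⟨q.re, ‖q.im‖⟩

lemma exists_slicePoint (q : ℍ[ℝ]) :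
    ∃ J ∈ imagUnits, q = slicePoint J (slicePt q).re (slicePt q).im := by
  by_cases h : q.im = 0
  · refine ⟨unitI, unitI_mem, ?_⟩
    simp only [slicePoint, slicePt, h, norm_zero, zero_smul, add_zero]
    have h1 := congrArg QuaternionAlgebra.imI h
    have h2 := congrArg QuaternionAlgebra.imJ h
    have h3 := congrArg QuaternionAlgebra.imK h
    simp at h1 h2 h3
    ext <;> simp [h1, h2, h3]
  · have hn : ‖q.im‖ ≠ 0 := by simpa using h
    refine ⟨‖q.im‖⁻¹ • q.im, ?_, ?_⟩
    · change _ * _ = _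
      rw [smul_mul_smul_comm, ← pow_two q.im, Quaternion.im_sq, Quaternion.normSq_eq_norm_mul_self]
      ext <;> simp <;> field_simp
    · simp only [slicePoint, slicePt]
      rw [smul_smul, mul_inv_cancel₀ hn, one_smul]
      ext <;> simp

lemma slicePoint_mem_unitBall {J : ℍ[ℝ]} (hJ : J ∈ imagUnits) (z : ℂ) :
    ‖slicePoint J z.re z.im‖ = ‖z‖ := by
  have h1 := re_of_mem_imagUnits hJ
  have h2 := norm_of_mem_imagUnits hJ
  rw [← Real.sqrt_mul_self (norm_nonneg _), ← Quaternion.normSq_eq_norm_mul_self,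
    Quaternion.normSq_def', Complex.norm_eq_sqrt_sq_add_sq]
  have h3 : ‖J‖ * ‖J‖ = 1 := by rw [h2, mul_one]
  rw [← Quaternion.normSq_eq_norm_mul_self, Quaternion.normSq_def', h1] at h3
  congr 1
  simp [slicePoint, h1]
  linear_combination z.im ^ 2 * h3

lemma norm_slicePt (q : ℍ[ℝ]) : ‖slicePt q‖ = ‖q‖ := by
  obtain ⟨J, hJ, h⟩ := exists_slicePoint q
  rw [h, slicePoint_mem_unitBall hJ, ← h]

lemma sphereAt_iff {q : ℍ[ℝ]} {x y : ℝ} : q ∈ sphereAt x y ↔ slicePt q = ⟨x, |y|⟩ := by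
  constructor
  · rintro ⟨J, hJ, rfl⟩
    apply Complex.ext
    · simp [slicePt, re_slicePoint hJ]
    · simp [slicePt, im_slicePoint hJ, norm_smul, norm_of_mem_imagUnits hJ]
  · intro h
    obtain ⟨J, hJ, h'⟩ := exists_slicePoint q
    rw [h] at h'
    rcases abs_cases y with ⟨hy, _⟩ | ⟨hy, _⟩
    · exact ⟨J, hJ, by rw [h', hy]⟩
    · refine ⟨-J, ?_, ?_⟩
      · change -J * -J = -1
        rw [neg_mul_neg]; exact hJ
      · rw [h', hy]; simp [slicePoint]

lemma det_eq_zero_of_rowQuat {u : ℍ[ℝ]} (hu : u ≠ 0) {B : M2} (h : rowQuat (quatMat u * B) = 0) :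
    B.det = 0 := by
  have h1 := congrArg QuaternionAlgebra.re h
  have h2 := congrArg QuaternionAlgebra.imI h
  have h3 := congrArg QuaternionAlgebra.imJ h
  have h4 := congrArg QuaternionAlgebra.imK h
  simp only [re_rowQuat, imI_rowQuat, imJ_rowQuat, imK_rowQuat] at h1 h2 h3 h4
  have e0 : (quatMat u * B) 0 0 = 0 := Complex.ext h1 h2
  have e1 : (quatMat u * B) 0 1 = 0 := Complex.ext h3 h4
  by_contra hB
  have hv : Matrix.vecMul (quatMat u 0) B = 0 := by
    funext j
    fin_cases j
    · simpa [Matrix.mul_apply, Matrix.vecMul, dotProduct] using e0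
    · simpa [Matrix.mul_apply, Matrix.vecMul, dotProduct] using e1
  have := Matrix.eq_zero_of_vecMul_eq_zero hB hv
  apply hu
  have a0 := congrFun this 0
  have a1 := congrFun this 1
  simp [quatMat, Complex.ext_iff] at a0 a1
  ext <;> simp [a0, a1]

/-- A zero at q would make the nonzero row vector of u annihilate A at the representative of q. -/
lemma ofMat_ne_zero {A : ℂ → M2} (hA : IsSymm A) {q : ℍ[ℝ]} (h : (A (slicePt q)).det ≠ 0) :
    ofMat A q ≠ 0 := by
  obtain ⟨J, hJ, hq⟩ := exists_slicePoint q
  obtain ⟨u, hu, huJ⟩ := exists_rotation hJ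
  intro h0
  rw [hq] at h0
  have := mul_ofMat hA hJ huJ (slicePt q).re (slicePt q).im
  rw [h0, mul_zero] at this
  exact h (det_eq_zero_of_rowQuat hu this.symm)

lemma rowQuat_smul_mul (s : ℂ) (A : M2) : rowQuat (s • A) = (s : ℍ[ℝ]) * rowQuat A := by
  ext <;> simp

lemma quatMat_mul_smul (u : ℍ[ℝ]) (s : ℂ) (A : M2) : quatMat u * s • A = s • (quatMat u * A) :=
  mul_smul_comm _ _ _

/-- Here r plays the value at q of the slice function of s. The intertwining form of `hr` lets
polynomials with real coefficients be checked by `SemiconjBy`. -/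
lemma ofMat_smul {A : ℂ → M2} (hA : IsSymm A) {s : ℂ → ℂ} (hs : ∀ z, s (conj z) = conj (s z))
    {q r : ℍ[ℝ]}
    (hr : ∀ J ∈ imagUnits, ∀ u : ℍ[ℝ], u * J = unitI * u → q = slicePoint J (slicePt q).re (slicePt q).im →
      u * r = (s (slicePt q) : ℍ[ℝ]) * u) :
    ofMat (fun z => s z • A z) q = r * ofMat A q := by
  obtain ⟨J, hJ, hq⟩ := exists_slicePoint q
  obtain ⟨u, hu, huJ⟩ := exists_rotation hJ
  apply mul_left_cancel₀ hu
  have h1 := mul_ofMat (IsSymm.smul hs hA) hJ huJ (slicePt q).re (slicePt q).im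
  have h2 := mul_ofMat hA hJ huJ (slicePt q).re (slicePt q).im
  rw [← hq] at h1 h2
  rw [h1, quatMat_mul_smul, rowQuat_smul_mul, ← mul_assoc, hr J hJ u huJ hq, mul_assoc, h2]

lemma semiconj_slicePt {J u : ℍ[ℝ]} (huJ : u * J = unitI * u) (x y : ℝ) :
    SemiconjBy u (slicePoint J x y) ((⟨x, y⟩ : ℂ) : ℍ[ℝ]) := by
  have : ((⟨x, y⟩ : ℂ) : ℍ[ℝ]) = slicePoint unitI x y := by ext <;> simp [slicePoint]
  rw [this, slicePoint, slicePoint]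
  apply SemiconjBy.add_right
  · exact (Quaternion.coe_commutes x u).symm
  · change _ = _
    rw [mul_smul_comm, huJ, smul_mul_assoc]

lemma ofMat_poly_smul {A : ℂ → M2} (hA : IsSymm A) (x y : ℝ) (m : ℕ) (q : ℍ[ℝ]) :
    ofMat (fun z => ((z - x) ^ 2 + (y ^ 2 : ℝ)) ^ m • A z) q
      = ((q - (x : ℍ[ℝ])) ^ 2 + ((y ^ 2 : ℝ) : ℍ[ℝ])) ^ m * ofMat A q := by
  apply ofMat_smul hA (s := fun z => ((z - x) ^ 2 + (y ^ 2 : ℝ)) ^ m)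
  · intro z; simp
  · intro J hJ u huJ hq
    have h := semiconj_slicePt huJ (slicePt q).re (slicePt q).im
    rw [← hq] at h
    have hc : ∀ t : ℝ, SemiconjBy u (t : ℍ[ℝ]) (t : ℍ[ℝ]) := fun t =>
      (Quaternion.coe_commutes t u).symm
    have := (((h.sub_right (hc x)).pow_right 2).add_right (hc (y ^ 2))).pow_right m
    rw [this.eq]
    congr 1
    have e : ∀ w : ℂ, (w : ℍ[ℝ]) = Quaternion.ofComplex w := fun _ => rfl
    have e' : ∀ t : ℝ, (t : ℍ[ℝ]) = Quaternion.ofComplex (t : ℂ) := fun t => by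
      rw [← e]; ext <;> simp
    simp only [e, e', map_pow, map_add, map_sub]

lemma ofMat_linear_smul {A : ℂ → M2} (hA : IsSymm A) (x : ℝ) (m : ℕ) (q : ℍ[ℝ]) :
    ofMat (fun z => (z - x) ^ m • A z) q = (q - (x : ℍ[ℝ])) ^ m * ofMat A q := by
  apply ofMat_smul hA (s := fun z => (z - x) ^ m)
  · intro z; simp
  · intro J hJ u huJ hq
    have h := semiconj_slicePt huJ (slicePt q).re (slicePt q).im
    rw [← hq] at h
    have hc : ∀ t : ℝ, SemiconjBy u (t : ℍ[ℝ]) (t : ℍ[ℝ]) := fun t =>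
      (Quaternion.coe_commutes t u).symm
    have := (h.sub_right (hc x)).pow_right m
    rw [this.eq]
    congr 1
    have e : ∀ w : ℂ, (w : ℍ[ℝ]) = Quaternion.ofComplex w := fun _ => rfl
    have e' : ∀ t : ℝ, (t : ℍ[ℝ]) = Quaternion.ofComplex (t : ℂ) := fun t => by
      rw [← e]; ext <;> simp
    simp only [e, e', map_pow, map_sub]

/-- By `mul_ofMat` the value at q depends on the matrix at a single point. Identities on the disc
therefore give identities on the ball. -/
lemma ofMat_congr {A B : ℂ → M2} (hA : IsSymm A) (hB : IsSymm B) {q : ℍ[ℝ]}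
    (h : A (slicePt q) = B (slicePt q)) : ofMat A q = ofMat B q := by
  obtain ⟨J, hJ, hq⟩ := exists_slicePoint q
  obtain ⟨u, hu, huJ⟩ := exists_rotation hJ
  apply mul_left_cancel₀ hu
  rw [hq, mul_ofMat hA hJ huJ, mul_ofMat hB hJ huJ]
  exact congrArg (fun B => rowQuat (quatMat u * B)) h

lemma ofMat_mul_quatMat (A : ℂ → M2) (c q : ℍ[ℝ]) :
    ofMat (fun z => A z * quatMat c) q = ofMat A q * c := by
  simp only [ofMat, sliceExt, rowQuat_mul_quatMat]
  simp only [add_mul, sub_mul, mul_sub, smul_mul_assoc, mul_assoc]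

lemma ofMat_one (q : ℍ[ℝ]) : ofMat (fun _ => 1) q = 1 := by
  have : rowQuat 1 = 1 := by ext <;> simp
  simp only [ofMat, sliceExt, this, sub_self, mul_zero, add_zero]
  ext <;> simp <;> norm_num

end QuatHardy

end

/-! ### Regular functions and holomorphic matrix functions. -/

noncomputable section

namespace QuatHardy

local notation "conj" => starRingEnd ℂ
local notation "𝔻" => Metric.ball (0 : ℂ) 1

/-- Holomorphic matrix functions on the unit disc. -/
def IsHol (A : ℂ → M2) : Prop := ∀ i j, DifferentiableOn ℂ (fun z => A z i j) 𝔻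

lemma IsHol.mul {A B : ℂ → M2} (hA : IsHol A) (hB : IsHol B) : IsHol fun z => A z * B z := by
  intro i j
  simp only [Matrix.mul_apply, Fin.sum_univ_two]
  exact ((hA i 0).mul (hB 0 j)).add ((hA i 1).mul (hB 1 j))

lemma isHol_const (M : M2) : IsHol fun _ => M := fun _ _ => differentiableOn_const _

lemma IsHol.smul {A : ℂ → M2} {s : ℂ → ℂ} (hs : DifferentiableOn ℂ s 𝔻) (hA : IsHol A) :
    IsHol fun z => s z • A z := fun i j => hs.mul (hA i j)

lemma IsHol.adjugate {A : ℂ → M2} (hA : IsHol A) : IsHol fun z => (A z).adjugate := by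
  intro i j
  simp only [Matrix.adjugate_fin_two]
  fin_cases i <;> fin_cases j
  · exact hA 1 1
  · exact (hA 0 1).neg
  · exact (hA 1 0).neg
  · exact hA 0 0

lemma IsHol.det {A : ℂ → M2} (hA : IsHol A) : DifferentiableOn ℂ (fun z => (A z).det) 𝔻 := by
  simp only [Matrix.det_fin_two]
  exact ((hA 0 0).mul (hA 1 1)).sub ((hA 0 1).mul (hA 1 0))

/-- The real linear identification of `ℂ × ℂ` with `ℍ = ℂ + ℂ j`. -/
def pairQuat : ℂ × ℂ →L[ℝ] ℍ[ℝ] :=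
  LinearMap.toContinuousLinearMap
    { toFun := fun p => (p.1 : ℍ[ℝ]) + (p.2 : ℍ[ℝ]) * unitJ
      map_add' := fun p q => by simp [add_mul]; abel
      map_smul' := fun r p => by ext <;> simp }

lemma pairQuat_apply (p : ℂ × ℂ) : pairQuat p = (p.1 : ℍ[ℝ]) + (p.2 : ℍ[ℝ]) * unitJ := rfl

lemma pairQuat_I_smul (p : ℂ × ℂ) : pairQuat (Complex.I • p) = unitI * pairQuat p := by
  ext <;> simp [pairQuat_apply]

/-- The first complex coordinate of a quaternion. -/
def fstQuat : ℍ[ℝ] →L[ℝ] ℂ :=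
  LinearMap.toContinuousLinearMap
    { toFun := fun q => ⟨q.re, q.imI⟩
      map_add' := fun p q => by apply Complex.ext <;> simp
      map_smul' := fun r p => by apply Complex.ext <;> simp }

/-- The second complex coordinate of a quaternion. -/
def sndQuat : ℍ[ℝ] →L[ℝ] ℂ :=
  LinearMap.toContinuousLinearMap
    { toFun := fun q => ⟨q.imJ, q.imK⟩
      map_add' := fun p q => by apply Complex.ext <;> simp
      map_smul' := fun r p => by apply Complex.ext <;> simp }

lemma fstQuat_apply (q : ℍ[ℝ]) : fstQuat q = ⟨q.re, q.imI⟩ := rfl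
lemma sndQuat_apply (q : ℍ[ℝ]) : sndQuat q = ⟨q.imJ, q.imK⟩ := rfl

lemma fstQuat_unitI_mul (q : ℍ[ℝ]) : fstQuat (unitI * q) = Complex.I * fstQuat q := by
  apply Complex.ext <;> simp [fstQuat_apply]

lemma sndQuat_unitI_mul (q : ℍ[ℝ]) : sndQuat (unitI * q) = Complex.I * sndQuat q := by
  apply Complex.ext <;> simp [sndQuat_apply]

lemma mem_disc_iff (p : ℝ × ℝ) : Complex.equivRealProdCLM.symm p ∈ 𝔻 ↔ p.1 ^ 2 + p.2 ^ 2 < 1 := by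
  rw [mem_ball_zero_iff, Complex.norm_eq_sqrt_sq_add_sq, Real.sqrt_lt' one_pos]
  simp

lemma symm_eq (p : ℝ × ℝ) : Complex.equivRealProdCLM.symm p = ⟨p.1, p.2⟩ := by
  apply Complex.ext <;> simp

/-- On the slice of J the function is u⁻¹ times a holomorphic pair, and J u⁻¹ = u⁻¹ i turns the
Cauchy–Riemann equation for i into the one for J. -/
theorem isSliceRegular_ofMat {A : ℂ → M2} (hA : IsSymm A) (hd : IsHol A) :
    IsSliceRegular (ofMat A) := by
  intro J hJ
  obtain ⟨u, hu, huJ⟩ := exists_rotation hJ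
  set B : ℂ → M2 := fun z => quatMat u * A z with hB
  have hBd : IsHol B := (isHol_const _).mul hd
  set g : ℂ → ℂ × ℂ := fun z => (B z 0 0, B z 0 1) with hg
  have hgd : DifferentiableOn ℂ g 𝔻 := (hBd 0 0).prodMk (hBd 0 1)
  have hJu : J * u⁻¹ = u⁻¹ * unitI := by
    have h : u⁻¹ * (u * J) * u⁻¹ = u⁻¹ * (unitI * u) * u⁻¹ := by rw [huJ]
    rw [← mul_assoc, inv_mul_cancel₀ hu, one_mul, ← mul_assoc, mul_assoc, mul_inv_cancel₀ hu,
      mul_one] at h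
    exact h
  have hφ : (fun p : ℝ × ℝ => ofMat A (slicePoint J p.1 p.2)) =
      fun p => ContinuousLinearMap.mul ℝ ℍ[ℝ] u⁻¹
        (pairQuat (g (Complex.equivRealProdCLM.symm p))) := by
    funext p
    rw [symm_eq]
    change _ = u⁻¹ * rowQuat (quatMat u * A ⟨p.1, p.2⟩)
    rw [← mul_ofMat hA hJ huJ, ← mul_assoc, inv_mul_cancel₀ hu, one_mul]
  rw [hφ]
  constructor
  · apply (ContinuousLinearMap.contDiff _).comp_contDiffOn
    apply (ContinuousLinearMap.contDiff _).comp_contDiffOn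
    apply ContDiffOn.comp (t := 𝔻)
      ((hgd.contDiffOn Metric.isOpen_ball).restrict_scalars ℝ)
      (ContinuousLinearEquiv.contDiff _).contDiffOn
    intro p hp
    exact (mem_disc_iff p).2 hp
  · intro p hp
    have hz := (mem_disc_iff p).2 hp
    have h1 := (hgd.differentiableAt (Metric.isOpen_ball.mem_nhds hz)).hasDerivAt.hasFDerivAt.restrictScalars ℝ
    have h2 := (ContinuousLinearMap.mul ℝ ℍ[ℝ] u⁻¹).hasFDerivAt.comp p
      (pairQuat.hasFDerivAt.comp p (h1.comp p Complex.equivRealProdCLM.symm.hasFDerivAt))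
    have h3 := h2.fderiv
    simp only [Function.comp_def] at h3
    rw [h3]
    have e1 : Complex.equivRealProdCLM.symm ((1, 0) : ℝ × ℝ) = 1 := by
      apply Complex.ext <;> simp
    have e2 : Complex.equivRealProdCLM.symm ((0, 1) : ℝ × ℝ) = Complex.I := by
      apply Complex.ext <;> simp
    simp only [ContinuousLinearMap.comp_apply, ContinuousLinearMap.mul_apply',
      ContinuousLinearEquiv.coe_coe, e1, e2, ContinuousLinearMap.coe_restrictScalars',
      ContinuousLinearMap.toSpanSingleton_apply, one_smul, pairQuat_I_smul]
    generalize pairQuat _ = w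
    have hi : unitI * unitI = -1 := unitI_mem
    rw [← mul_assoc, hJu, mul_assoc, ← mul_assoc unitI, hi]
    simp

/-- Left multiplication by u converts the equation for J into the one for i, and L reads off a
coordinate that is complex linear for left multiplication by i. -/
lemma hol_of_cauchyRiemann {φ : ℝ × ℝ → ℍ[ℝ]} {J u : ℍ[ℝ]} (hJ : J ∈ imagUnits)
    (huJ : u * J = unitI * u) (L : ℍ[ℝ] →L[ℝ] ℂ) (hL : ∀ q, L (unitI * q) = Complex.I * L q)
    (hd : ∀ p : ℝ × ℝ, p.1 ^ 2 + p.2 ^ 2 < 1 → DifferentiableAt ℝ φ p)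
    (hcr : ∀ p : ℝ × ℝ, p.1 ^ 2 + p.2 ^ 2 < 1 → fderiv ℝ φ p (1, 0) + J * fderiv ℝ φ p (0, 1) = 0) :
    DifferentiableOn ℂ (fun z : ℂ => L (u * φ (z.re, z.im))) 𝔻 := by
  intro z hz
  apply DifferentiableAt.differentiableWithinAt
  have hz' : (Complex.equivRealProdCLM z).1 ^ 2 + (Complex.equivRealProdCLM z).2 ^ 2 < 1 := by
    rw [← mem_disc_iff, ContinuousLinearEquiv.symm_apply_apply]; exact hz
  have h1 := L.hasFDerivAt.comp z ((ContinuousLinearMap.mul ℝ ℍ[ℝ] u).hasFDerivAt.comp z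
    ((hd _ hz').hasFDerivAt.comp z Complex.equivRealProdCLM.hasFDerivAt))
  rw [differentiableAt_complex_iff_differentiableAt_real]
  refine ⟨h1.differentiableAt, ?_⟩
  have h2 := h1.fderiv
  simp only [Function.comp_def] at h2
  have h3 := hcr _ hz'
  have e : (fun x : ℂ => L ((ContinuousLinearMap.mul ℝ ℍ[ℝ] u) (φ (Complex.equivRealProdCLM x))))
    = fun z : ℂ => L (u * φ (z.re, z.im)) := rfl
  rw [e] at h2
  rw [h2]
  simp only [ContinuousLinearMap.comp_apply, ContinuousLinearMap.mul_apply',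
      ContinuousLinearEquiv.coe_coe]
  have e1 : Complex.equivRealProdCLM 1 = ((1, 0) : ℝ × ℝ) := rfl
  have e2 : Complex.equivRealProdCLM Complex.I = ((0, 1) : ℝ × ℝ) := by
    ext <;> simp
  rw [e1, e2]
  have hJ2 : J * J = -1 := hJ
  have h4 : fderiv ℝ φ (Complex.equivRealProdCLM z) (0, 1)
      = J * fderiv ℝ φ (Complex.equivRealProdCLM z) (1, 0) := by
    rw [eq_neg_of_add_eq_zero_left h3, mul_neg, ← mul_assoc, hJ2, neg_one_mul, neg_neg]
  rw [h4, ← mul_assoc, huJ, mul_assoc, hL, smul_eq_mul]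

lemma IsSliceRegular.differentiableAt {f : ℍ[ℝ] → ℍ[ℝ]} (hf : IsSliceRegular f) {J : ℍ[ℝ]}
    (hJ : J ∈ imagUnits) {p : ℝ × ℝ} (hp : p.1 ^ 2 + p.2 ^ 2 < 1) :
    DifferentiableAt ℝ (fun p : ℝ × ℝ => f (slicePoint J p.1 p.2)) p := by
  have ho : IsOpen {p : ℝ × ℝ | p.1 ^ 2 + p.2 ^ 2 < 1} :=
    isOpen_lt (by fun_prop) continuous_const
  exact ((hf J hJ).1.differentiableOn one_ne_zero).differentiableAt (ho.mem_nhds hp)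

lemma IsSliceRegular.cauchyRiemann {f : ℍ[ℝ] → ℍ[ℝ]} (hf : IsSliceRegular f) {J : ℍ[ℝ]}
    (hJ : J ∈ imagUnits) {p : ℝ × ℝ} (hp : p.1 ^ 2 + p.2 ^ 2 < 1) :
    fderiv ℝ (fun p : ℝ × ℝ => f (slicePoint J p.1 p.2)) p (1, 0)
      + J * fderiv ℝ (fun p : ℝ × ℝ => f (slicePoint J p.1 p.2)) p (0, 1) = 0 := by
  have := (hf J hJ).2 p hp
  exact (smul_eq_zero.1 this).resolve_left (by norm_num)

lemma slicePoint_unitI (z : ℂ) : slicePoint unitI z.re z.im = (z : ℍ[ℝ]) := by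
  ext <;> simp [slicePoint]

lemma differentiableOn_conj_conj {F : ℂ → ℂ} (hF : DifferentiableOn ℂ F 𝔻) :
    DifferentiableOn ℂ (fun z => conj (F (conj z))) 𝔻 := by
  intro z hz
  have hz' : conj z ∈ 𝔻 := by simpa using hz
  have := (hF.differentiableAt (Metric.isOpen_ball.mem_nhds hz')).conj_conj
  simpa [Function.comp_def] using this.differentiableWithinAt

lemma IsSliceRegular.isHol {f : ℍ[ℝ] → ℍ[ℝ]} (hf : IsSliceRegular f) : IsHol (toMat f) := by
  have h0 : ∀ L : ℍ[ℝ] →L[ℝ] ℂ, (∀ q, L (unitI * q) = Complex.I * L q) →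
      DifferentiableOn ℂ (fun z : ℂ => L (f z)) 𝔻 := by
    intro L hL
    have := hol_of_cauchyRiemann unitI_mem (u := 1) (by simp) L hL
      (fun p hp => hf.differentiableAt unitI_mem hp) (fun p hp => hf.cauchyRiemann unitI_mem hp)
    simpa only [one_mul, slicePoint_unitI] using this
  have hF : DifferentiableOn ℂ (splitF f) 𝔻 := h0 fstQuat fstQuat_unitI_mul
  have hG : DifferentiableOn ℂ (splitG f) 𝔻 := h0 sndQuat sndQuat_unitI_mul
  intro i j
  fin_cases i <;> fin_cases j
  · exact hF
  · exact hG
  · exact (differentiableOn_conj_conj hG).neg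
  · exact differentiableOn_conj_conj hF

lemma rowQuat_toMat (f : ℍ[ℝ] → ℍ[ℝ]) (z : ℂ) : rowQuat (toMat f z) = f z := by
  ext <;> simp [toMat, splitF, splitG]

/-- The real axis lies in every slice, so the identity theorem along it links different slices. -/
lemma eqOn_zero_of_real {F : ℂ → ℂ} (hF : DifferentiableOn ℂ F 𝔻)
    (h : ∀ x : ℝ, |x| < 1 → F x = 0) : Set.EqOn F 0 𝔻 := by
  apply (hF.analyticOnNhd Metric.isOpen_ball).eqOn_zero_of_preconnected_of_frequently_eq_zero
    (convex_ball _ _).isPreconnected (Metric.mem_ball_self one_pos)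
  have h1 : Filter.Tendsto (fun x : ℝ => (x : ℂ)) (𝓝[≠] 0) (𝓝[≠] 0) := by
    apply tendsto_nhdsWithin_iff.2 ⟨?_, ?_⟩
    · exact (Complex.continuous_ofReal.tendsto' 0 0 (by simp)).mono_left nhdsWithin_le_nhds
    · filter_upwards [self_mem_nhdsWithin] with x hx
      simpa using hx
  apply h1.frequently
  apply Filter.Eventually.frequently
  have : ∀ᶠ x : ℝ in 𝓝 0, |x| < 1 := by
    simpa using (continuous_abs.tendsto (0 : ℝ)).eventually (gt_mem_nhds (by simp))
  filter_upwards [nhdsWithin_le_nhds this] with x hx using h x hx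

/-- The representation formula. -/
theorem IsSliceRegular.eq_ofMat {f : ℍ[ℝ] → ℍ[ℝ]} (hf : IsSliceRegular f) {q : ℍ[ℝ]}
    (hq : q ∈ unitBall) : f q = ofMat (toMat f) q := by
  have hg := isSliceRegular_ofMat (isSymm_toMat f) hf.isHol
  obtain ⟨J, hJ, hqJ⟩ := exists_slicePoint q
  obtain ⟨u, hu, huJ⟩ := exists_rotation hJ
  have hz : slicePt q ∈ 𝔻 := by
    rw [mem_ball_zero_iff, norm_slicePt]; exact hq
  have key : ∀ L : ℍ[ℝ] →L[ℝ] ℂ, (∀ q, L (unitI * q) = Complex.I * L q) →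
      L (u * (f q - ofMat (toMat f) q)) = 0 := by
    intro L hL
    have h1 := hol_of_cauchyRiemann hJ huJ L hL
      (fun p hp => hf.differentiableAt hJ hp) (fun p hp => hf.cauchyRiemann hJ hp)
    have h2 := hol_of_cauchyRiemann hJ huJ L hL
      (fun p hp => hg.differentiableAt hJ hp) (fun p hp => hg.cauchyRiemann hJ hp)
    -- On the slice of J both sides are holomorphic after rotation, and they agree at real points
    -- because these also lie on the slice of `i`.
    have h3 := eqOn_zero_of_real (h1.sub h2) (fun x _ => by
      have e : slicePoint J (x : ℂ).re (x : ℂ).im = ((x : ℂ) : ℍ[ℝ]) := by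
        ext <;> simp [slicePoint]
      simp only [Pi.sub_apply]
      rw [e, ofMat_coe, rowQuat_toMat, sub_self])
    have h4 := h3 hz
    simp only [Pi.sub_apply, Pi.zero_apply] at h4
    rw [← hqJ, ← map_sub, ← mul_sub] at h4
    exact h4
  have k1 := key fstQuat fstQuat_unitI_mul
  have k2 := key sndQuat sndQuat_unitI_mul
  rw [fstQuat_apply] at k1
  rw [sndQuat_apply] at k2
  rw [Complex.ext_iff] at k1 k2
  have : u * (f q - ofMat (toMat f) q) = 0 := by
    ext
    · exact k1.1
    · exact k1.2
    · exact k2.1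
    · exact k2.2
  exact sub_eq_zero.1 ((mul_eq_zero.1 this).resolve_left hu)

end QuatHardy

end

/-! ### Matrices of Blaschke factors. -/

noncomputable section

namespace QuatHardy

local notation "conj" => starRingEnd ℂ
local notation "𝔻" => Metric.ball (0 : ℂ) 1

attribute [local instance] Matrix.linftyOpNormedRing Matrix.linftyOpNormedAlgebra

lemma norm_sq_eq (q : ℍ[ℝ]) : ‖q‖ ^ 2 = q.re ^ 2 + q.imI ^ 2 + q.imJ ^ 2 + q.imK ^ 2 := by
  rw [pow_two, ← Quaternion.normSq_eq_norm_mul_self, Quaternion.normSq_def']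

lemma isSymm_id : IsSymm fun z => z • (1 : M2) := IsSymm.smul (s := fun z => z) (fun _ => rfl) isSymm_one

lemma rowQuat_sub (A B : M2) : rowQuat (A - B) = rowQuat A - rowQuat B := by
  ext <;> simp

lemma rowQuat_one : rowQuat 1 = 1 := by ext <;> simp

lemma IsSymm.neg {A : ℂ → M2} (hA : IsSymm A) : IsSymm (fun z => - A z) := by
  simpa using IsSymm.smul (s := fun _ => -1) (by simp) hA

lemma IsSymm.sub {A B : ℂ → M2} (hA : IsSymm A) (hB : IsSymm B) : IsSymm (fun z => A z - B z) := by
  simpa [sub_eq_add_neg] using hA.add hB.neg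

lemma isSymm_smul_quatMat (a : ℍ[ℝ]) : IsSymm fun z => z • quatMat a :=
  IsSymm.smul (s := fun z => z) (fun _ => rfl) (isSymm_const a)

lemma toMat_sub_const (p : ℍ[ℝ]) : toMat (fun q => q - p) = fun z => z • 1 - quatMat p := by
  apply toMat_apply_of_row (isSymm_id.sub (isSymm_const p))
  intro z
  rw [rowQuat_sub, rowQuat_quatMat, rowQuat_smul_mul, rowQuat_one, mul_one]

lemma toMat_const_sub (p : ℍ[ℝ]) : toMat (fun q => p - q) = fun z => quatMat p - z • 1 := by
  apply toMat_apply_of_row ((isSymm_const p).sub isSymm_id)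
  intro z
  rw [rowQuat_sub, rowQuat_quatMat, rowQuat_smul_mul, rowQuat_one, mul_one]

lemma toMat_one_sub_mul (a : ℍ[ℝ]) : toMat (fun q => 1 - q * a) = fun z => 1 - z • quatMat a := by
  apply toMat_apply_of_row (isSymm_one.sub (isSymm_smul_quatMat a))
  intro z
  rw [rowQuat_sub, rowQuat_smul_mul, rowQuat_quatMat, rowQuat_one]

/-- The numerator of the determinant of a Blaschke factor. -/
def blaschkeNum (a : ℍ[ℝ]) (z : ℂ) : ℂ := (z - slicePt a) * (z - conj (slicePt a))

/-- The denominator of the determinant of a Blaschke factor. -/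
def blaschkeDen (a : ℍ[ℝ]) (z : ℂ) : ℂ := (1 - slicePt a * z) * (1 - conj (slicePt a) * z)

lemma norm_im_sq (a : ℍ[ℝ]) : ‖a.im‖ ^ 2 = a.imI ^ 2 + a.imJ ^ 2 + a.imK ^ 2 := by
  rw [norm_sq_eq]; simp

lemma slicePt_add_conj (a : ℍ[ℝ]) : slicePt a + conj (slicePt a) = 2 * a.re := by
  apply Complex.ext <;> simp [slicePt]; ring

lemma slicePt_mul_conj (a : ℍ[ℝ]) : slicePt a * conj (slicePt a) = ((‖a‖ ^ 2 : ℝ) : ℂ) := by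
  rw [Complex.mul_conj, Complex.normSq_eq_norm_sq, norm_slicePt]

lemma slicePt_star (a : ℍ[ℝ]) : slicePt (star a) = slicePt a := by
  simp [slicePt]

lemma blaschkeNum_star (a : ℍ[ℝ]) : blaschkeNum (star a) = blaschkeNum a := by
  unfold blaschkeNum; rw [slicePt_star]

lemma blaschkeDen_star (a : ℍ[ℝ]) : blaschkeDen (star a) = blaschkeDen a := by
  unfold blaschkeDen; rw [slicePt_star]

lemma quatMat_star (q : ℍ[ℝ]) : quatMat (star q) = (quatMat q).adjugate := by
  rw [Matrix.adjugate_fin_two]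
  ext i j
  fin_cases i <;> fin_cases j <;> apply Complex.ext <;> simp [quatMat]

lemma det_quatMat (q : ℍ[ℝ]) : (quatMat q).det = ((‖q‖ ^ 2 : ℝ) : ℂ) := by
  rw [norm_sq_eq, Matrix.det_fin_two]
  apply Complex.ext <;> simp [quatMat, pow_two] <;> ring

/-- The matrix of a has trace 2 Re a and determinant |a|², so its characteristic polynomial has the
representative of a and its conjugate as roots. -/
lemma det_smul_one_sub (a : ℍ[ℝ]) (z : ℂ) : (z • 1 - quatMat a).det = blaschkeNum a z := by
  have h : blaschkeNum a z = z ^ 2 - (slicePt a + conj (slicePt a)) * z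
    + slicePt a * conj (slicePt a) := by unfold blaschkeNum; ring
  have ht : (quatMat a) 0 0 + (quatMat a) 1 1 = 2 * a.re := by
    apply Complex.ext <;> simp [quatMat]; ring
  rw [h, slicePt_add_conj, slicePt_mul_conj, ← det_quatMat, ← ht]
  simp only [Matrix.det_fin_two]
  simp
  ring

lemma det_sub_smul_one (a : ℍ[ℝ]) (z : ℂ) : (quatMat a - z • 1).det = blaschkeNum a z := by
  rw [← det_smul_one_sub, ← neg_sub, Matrix.det_neg]
  simp

lemma det_one_sub_smul (a : ℍ[ℝ]) (z : ℂ) : (1 - z • quatMat a).det = blaschkeDen a z := by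
  have h : blaschkeDen a z = 1 - (slicePt a + conj (slicePt a)) * z
    + slicePt a * conj (slicePt a) * z ^ 2 := by unfold blaschkeDen; ring
  have ht : (quatMat a) 0 0 + (quatMat a) 1 1 = 2 * a.re := by
    apply Complex.ext <;> simp [quatMat]; ring
  rw [h, slicePt_add_conj, slicePt_mul_conj, ← det_quatMat, ← ht]
  simp only [Matrix.det_fin_two]
  simp
  ring

lemma adjugate_one_sub_smul (a : ℍ[ℝ]) (z : ℂ) :
    (1 - z • quatMat (star a)).adjugate = 1 - z • quatMat a := by
  rw [quatMat_star]
  simp only [Matrix.adjugate_fin_two]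
  ext i j
  fin_cases i <;> fin_cases j <;> simp

lemma adjugate_smul_one_sub (a : ℍ[ℝ]) (z : ℂ) :
    (z • 1 - quatMat a).adjugate = z • 1 - quatMat (star a) := by
  rw [quatMat_star]
  simp only [Matrix.adjugate_fin_two]
  ext i j
  fin_cases i <;> fin_cases j <;> simp

lemma quatMat_mul_star (a : ℍ[ℝ]) : quatMat a * quatMat (star a) = ((‖a‖ ^ 2 : ℝ) : ℂ) • 1 := by
  rw [quatMat_star, Matrix.mul_adjugate, det_quatMat]

lemma one_sub_smul_mul (a : ℍ[ℝ]) (z : ℂ) :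
    (1 - z • quatMat a) * (1 - z • quatMat (star a)) = blaschkeDen a z • 1 := by
  rw [← adjugate_one_sub_smul, Matrix.adjugate_mul, det_one_sub_smul, blaschkeDen_star]

open Classical in
/-- The matrix function of a Blaschke factor. -/
def blaschkeMat (a : ℍ[ℝ]) (z : ℂ) : M2 :=
  if a = 0 then z • 1
  else (blaschkeDen a z)⁻¹ • ((1 - z • quatMat a) * (quatMat a - z • 1))
    * quatMat (‖a‖⁻¹ • star a)

lemma conj_blaschkeDen (a : ℍ[ℝ]) (z : ℂ) :
    blaschkeDen a (conj z) = conj (blaschkeDen a z) := by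
  simp [blaschkeDen]; ring

lemma conj_blaschkeNum (a : ℍ[ℝ]) (z : ℂ) :
    blaschkeNum a (conj z) = conj (blaschkeNum a z) := by
  simp [blaschkeNum]; ring

lemma isSymm_blaschkeMat (a : ℍ[ℝ]) : IsSymm (blaschkeMat a) := by
  unfold blaschkeMat
  split_ifs
  · exact isSymm_id
  · refine IsSymm.mul (IsSymm.smul (s := fun z => (blaschkeDen a z)⁻¹) ?_
      ((isSymm_one.sub (isSymm_smul_quatMat a)).mul ((isSymm_const a).sub isSymm_id)))
      (isSymm_const _)
    intro z
    rw [conj_blaschkeDen, map_inv₀]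

/-- The regular reciprocal of 1 - q ā is the matrix inverse: adjugate 1 - q a over the determinant
`blaschkeDen`. -/
lemma blaschkeFactor_eq (a : ℍ[ℝ]) : blaschkeFactor a = ofMat (blaschkeMat a) := by
  funext q
  unfold blaschkeFactor blaschkeMat
  split_ifs with h
  · have := ofMat_linear_smul isSymm_one 0 1 q
    simp only [pow_one, Complex.ofReal_zero, sub_zero, ofMat_one, mul_one] at this
    rw [this]; simp
  · rw [starMul_eq, ← ofMat_mul_quatMat, toMat_regRecip, toMat_one_sub_mul, toMat_const_sub]
    simp only [adjugate_one_sub_smul, det_one_sub_smul, blaschkeDen_star, smul_mul_assoc]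

lemma one_sub_norm_le_norm_one_sub {w z : ℂ} (hw : ‖w‖ < 1) : 1 - ‖z‖ ≤ ‖1 - w * z‖ := by
  have h := norm_sub_norm_le (1 : ℂ) (w * z)
  rw [norm_one, norm_mul] at h
  nlinarith [norm_nonneg z, norm_nonneg w]

lemma sq_le_norm_blaschkeDen {a : ℍ[ℝ]} (ha : ‖a‖ < 1) {z : ℂ} (hz : ‖z‖ < 1) :
    (1 - ‖z‖) ^ 2 ≤ ‖blaschkeDen a z‖ := by
  have h1 : ‖slicePt a‖ < 1 := by rwa [norm_slicePt]
  have h2 : ‖conj (slicePt a)‖ < 1 := by rwa [RCLike.norm_conj]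
  rw [blaschkeDen, norm_mul, pow_two]
  exact mul_le_mul (one_sub_norm_le_norm_one_sub h1) (one_sub_norm_le_norm_one_sub h2)
    (by linarith) (norm_nonneg _)

lemma blaschkeDen_ne_zero {a : ℍ[ℝ]} (ha : ‖a‖ < 1) {z : ℂ} (hz : z ∈ 𝔻) :
    blaschkeDen a z ≠ 0 := by
  rw [mem_ball_zero_iff] at hz
  have h := sq_le_norm_blaschkeDen ha hz
  have : 0 < (1 - ‖z‖) ^ 2 := by have : 0 < 1 - ‖z‖ := by linarith
                                 positivity
  exact norm_pos_iff.1 (this.trans_le h)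

lemma IsHol.sub {A B : ℂ → M2} (hA : IsHol A) (hB : IsHol B) : IsHol fun z => A z - B z :=
  fun i j => (hA i j).sub (hB i j)

lemma isHol_smul_const (M : M2) : IsHol fun z => z • M :=
  IsHol.smul (s := fun z => z) differentiableOn_id (isHol_const M)

lemma differentiable_blaschkeDen (a : ℍ[ℝ]) : Differentiable ℂ (blaschkeDen a) := by
  unfold blaschkeDen; fun_prop

lemma differentiable_blaschkeNum (a : ℍ[ℝ]) : Differentiable ℂ (blaschkeNum a) := by
  unfold blaschkeNum; fun_prop

lemma isHol_blaschkeMat {a : ℍ[ℝ]} (ha : ‖a‖ < 1) : IsHol (blaschkeMat a) := by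
  unfold blaschkeMat
  split_ifs
  · exact isHol_smul_const 1
  · refine IsHol.mul (IsHol.smul (s := fun z => (blaschkeDen a z)⁻¹) ?_
      (((isHol_const 1).sub (isHol_smul_const _)).mul ((isHol_const _).sub (isHol_smul_const 1))))
      (isHol_const _)
    exact (differentiable_blaschkeDen a).differentiableOn.inv fun z hz => blaschkeDen_ne_zero ha hz

lemma blaschkeNum_zero (z : ℂ) : blaschkeNum 0 z = z ^ 2 := by
  have : slicePt 0 = 0 := by apply Complex.ext <;> simp [slicePt]
  simp [blaschkeNum, this, pow_two]

lemma blaschkeDen_zero (z : ℂ) : blaschkeDen 0 z = 1 := by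
  have : slicePt 0 = 0 := by apply Complex.ext <;> simp [slicePt]
  simp [blaschkeDen, this]

lemma det_blaschkeMat {a : ℍ[ℝ]} (ha : ‖a‖ < 1) {z : ℂ} (hz : z ∈ 𝔻) :
    (blaschkeMat a z).det = blaschkeNum a z / blaschkeDen a z := by
  unfold blaschkeMat
  have hd := blaschkeDen_ne_zero ha hz
  split_ifs with h
  · rw [h, blaschkeNum_zero, blaschkeDen_zero, div_one, Matrix.det_smul]; simp
  · have hn : ‖a‖ ≠ 0 := by simpa using h
    rw [Matrix.det_mul, Matrix.det_smul, Matrix.det_mul, det_one_sub_smul, det_sub_smul_one,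
      det_quatMat, norm_smul, norm_star, norm_inv, norm_norm, inv_mul_cancel₀ hn]
    simp
    field_simp

open Classical in
/-- The unit relating `a - q` to the Blaschke factor of `a`. -/
def blaschkeUnit (a : ℍ[ℝ]) (z : ℂ) : M2 :=
  if a = 0 then -1 else (1 - z • quatMat (star a)) * quatMat (‖a‖⁻¹ • a)

lemma isSymm_blaschkeUnit (a : ℍ[ℝ]) : IsSymm (blaschkeUnit a) := by
  unfold blaschkeUnit
  split_ifs
  · exact isSymm_one.neg
  · exact (isSymm_one.sub (isSymm_smul_quatMat _)).mul (isSymm_const _)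

lemma isHol_blaschkeUnit (a : ℍ[ℝ]) : IsHol (blaschkeUnit a) := by
  unfold blaschkeUnit
  split_ifs
  · exact isHol_const _
  · exact ((isHol_const 1).sub (isHol_smul_const _)).mul (isHol_const _)

/-- All matrices involved are combinations of 1, a and ā and commute. This lets a linear factor on
the right be replaced by a Blaschke factor; for a = 0 the factor is q while a - q is -q, hence the
unit -1. -/
lemma blaschkeUnit_mul {a : ℍ[ℝ]} (ha : ‖a‖ < 1) {z : ℂ} (hz : z ∈ 𝔻) :
    blaschkeUnit a z * blaschkeMat a z = quatMat a - z • 1 := by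
  unfold blaschkeUnit blaschkeMat
  have hd := blaschkeDen_ne_zero ha hz
  split_ifs with h
  · subst h
    have : quatMat 0 = 0 := by
      ext i j
      fin_cases i <;> fin_cases j <;> apply Complex.ext <;> simp [quatMat]
    rw [this]; simp
  · have hn : ‖a‖ ≠ 0 := by simpa using h
    have c1 : Commute (quatMat a) (quatMat (star a)) := by
      change _ * _ = _ * _
      rw [← quatMat_mul, ← quatMat_mul, Quaternion.self_mul_star, Quaternion.star_mul_self]
    have c2 : Commute (quatMat (‖a‖⁻¹ • a)) (1 - z • quatMat a) := by
      rw [quatMat_smul]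
      exact ((Commute.one_right _).sub_right ((Commute.refl _).smul_right z)).smul_left _
    have c3 : Commute (quatMat (‖a‖⁻¹ • a)) (quatMat a - z • 1) := by
      rw [quatMat_smul]
      exact ((Commute.refl _).sub_right ((Commute.one_right _).smul_right z)).smul_left _
    have c4 : quatMat (‖a‖⁻¹ • a) * quatMat (‖a‖⁻¹ • star a) = 1 := by
      rw [quatMat_smul, quatMat_smul, smul_mul_smul_comm, quatMat_mul_star, smul_smul]
      rw [show ((‖a‖⁻¹ : ℝ) : ℂ) * ((‖a‖⁻¹ : ℝ) : ℂ) * ((‖a‖ ^ 2 : ℝ) : ℂ) = 1 by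
        have : (‖a‖ : ℂ) ≠ 0 := by exact_mod_cast hn
        push_cast; field_simp, one_smul]
    have c5 : (1 - z • quatMat (star a)) * (1 - z • quatMat a) = blaschkeDen a z • 1 := by
      have := one_sub_smul_mul (star a) z
      rwa [star_star, blaschkeDen_star] at this
    calc _ = (blaschkeDen a z)⁻¹ • ((1 - z • quatMat (star a)) * (quatMat (‖a‖⁻¹ • a) *
              (1 - z • quatMat a)) * (quatMat a - z • 1) * quatMat (‖a‖⁻¹ • star a)) := by
            simp only [smul_mul_assoc, mul_smul_comm, mul_assoc]
      _ = (blaschkeDen a z)⁻¹ • ((1 - z • quatMat (star a)) * (1 - z • quatMat a) *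
            (quatMat (‖a‖⁻¹ • a) * (quatMat a - z • 1)) * quatMat (‖a‖⁻¹ • star a)) := by
            rw [c2.eq]; simp only [mul_assoc]
      _ = (blaschkeDen a z)⁻¹ • ((blaschkeDen a z • 1) *
            (quatMat a - z • 1) * (quatMat (‖a‖⁻¹ • a) * quatMat (‖a‖⁻¹ • star a))) := by
            rw [c3.eq, c5]; simp only [mul_assoc]
      _ = _ := by
            rw [c4, mul_one, smul_mul_assoc, one_mul, smul_smul, inv_mul_cancel₀ hd, one_smul]

lemma norm_le_of_entries {A : M2} {r : ℝ} (h : ∀ i j, ‖A i j‖ ≤ r) : ‖A‖ ≤ 2 * r := by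
  have hr : 0 ≤ r := (norm_nonneg _).trans (h 0 0)
  have : ‖A‖₊ ≤ 2 * ⟨r, hr⟩ := by
    rw [Matrix.linfty_opNNNorm_def]
    apply Finset.sup_le
    intro i _
    have h' : ∀ i j, ‖A i j‖₊ ≤ ⟨r, hr⟩ := h
    rw [Fin.sum_univ_two]
    exact (add_le_add (h' i 0) (h' i 1)).trans_eq (two_mul _).symm
  exact_mod_cast this

lemma norm_entry_le (A : M2) (i j : Fin 2) : ‖A i j‖ ≤ ‖A‖ := by
  have : ‖A i j‖₊ ≤ ‖A‖₊ := by
    rw [Matrix.linfty_opNNNorm_def]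
    refine le_trans ?_ (Finset.le_sup (f := fun i => ∑ j, ‖A i j‖₊) (Finset.mem_univ i))
    exact Finset.single_le_sum (f := fun j => ‖A i j‖₊) (fun _ _ => zero_le) (Finset.mem_univ j)
  exact_mod_cast this

lemma norm_quatMat_le (a : ℍ[ℝ]) : ‖quatMat a‖ ≤ 2 * ‖a‖ := by
  have h := norm_sq_eq a
  have h1 : ‖(⟨a.re, a.imI⟩ : ℂ)‖ ≤ ‖a‖ := by
    apply le_of_sq_le_sq _ (norm_nonneg _)
    rw [← Complex.normSq_eq_norm_sq, h, Complex.normSq_mk]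
    nlinarith [sq_nonneg a.imJ, sq_nonneg a.imK]
  have h2 : ‖(⟨a.imJ, a.imK⟩ : ℂ)‖ ≤ ‖a‖ := by
    apply le_of_sq_le_sq _ (norm_nonneg _)
    rw [← Complex.normSq_eq_norm_sq, h, Complex.normSq_mk]
    nlinarith [sq_nonneg a.re, sq_nonneg a.imI]
  apply norm_le_of_entries
  intro i j
  fin_cases i <;> fin_cases j
  · exact h1
  · exact h2
  · simpa [quatMat] using h2
  · simpa [quatMat] using h1

/-- The normalisation by ā/|a| makes M_a - 1 a multiple of 1 - |a|, which is what the Blaschke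
condition sums. The 9 is 3 · 3, one 3 for each remaining factor, because the matrix norm of a
quaternion is at most twice its modulus. -/
lemma norm_blaschkeMat_sub_one_le {a : ℍ[ℝ]} (ha : ‖a‖ < 1) {z : ℂ} (hz : z ∈ 𝔻) :
    ‖blaschkeMat a z - 1‖ ≤ 9 / (1 - ‖z‖) ^ 2 * (1 - ‖a‖) := by
  have hd := blaschkeDen_ne_zero ha hz
  rw [mem_ball_zero_iff] at hz
  have hden := sq_le_norm_blaschkeDen ha hz
  have hpos : 0 < (1 - ‖z‖) ^ 2 := by have : 0 < 1 - ‖z‖ := by linarith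
                                      positivity
  have hle : (1 - ‖z‖) ^ 2 ≤ 1 := by nlinarith [norm_nonneg z]
  unfold blaschkeMat
  split_ifs with h
  · subst h
    rw [norm_zero, sub_zero, mul_one, le_div_iff₀ hpos]
    have : ‖z • (1 : M2) - 1‖ ≤ 2 := by
      refine (norm_sub_le _ _).trans ?_
      rw [norm_smul, norm_one]; linarith
    nlinarith
  · have hn : ‖a‖ ≠ 0 := by simpa using h
    have hn' : (‖a‖ : ℂ) ≠ 0 := by exact_mod_cast hn
    have key : (blaschkeDen a z)⁻¹ • ((1 - z • quatMat a) * (quatMat a - z • 1))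
          * quatMat (‖a‖⁻¹ • star a) - 1 =
        (-((1 - ‖a‖ : ℝ) : ℂ) * (blaschkeDen a z)⁻¹) • ((1 - z • quatMat a) *
          (1 + z • quatMat (‖a‖⁻¹ • star a))) := by
      have e1 : (1 : M2) = (blaschkeDen a z)⁻¹ • ((1 - z • quatMat a) * (1 - z • quatMat (star a))) := by
        rw [one_sub_smul_mul, smul_smul, inv_mul_cancel₀ hd, one_smul]
      -- Since a ā = |a|², the left side is |a| - z ā/|a| - 1 + z ā = -(1 - |a|)(1 + z ā/|a|).
      have e2 : (quatMat a - z • 1) * quatMat (‖a‖⁻¹ • star a) - (1 - z • quatMat (star a)) =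
        (-((1 - ‖a‖ : ℝ) : ℂ)) • (1 + z • quatMat (‖a‖⁻¹ • star a)) := by
        rw [quatMat_smul, mul_smul_comm, sub_mul, quatMat_mul_star, smul_mul_assoc, one_mul,
          smul_sub, smul_smul, smul_add, smul_smul, smul_smul, smul_smul]
        have : (((‖a‖⁻¹ : ℝ) : ℂ) * ((‖a‖ ^ 2 : ℝ) : ℂ)) = ‖a‖ := by
          push_cast; field_simp
        rw [this]
        have e3 : -((1 - ‖a‖ : ℝ) : ℂ) * z * ((‖a‖⁻¹ : ℝ) : ℂ) = z - ((‖a‖⁻¹ : ℝ) : ℂ) * z := by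
          push_cast; field_simp; ring
        rw [e3]
        push_cast
        module
      calc _ = (blaschkeDen a z)⁻¹ • ((1 - z • quatMat a) * ((quatMat a - z • 1) *
              quatMat (‖a‖⁻¹ • star a) - (1 - z • quatMat (star a)))) := by
            rw [smul_mul_assoc, mul_assoc, mul_sub (1 - z • quatMat a) (_ * _), smul_sub, ← e1]
        _ = _ := by rw [e2, mul_smul_comm, smul_smul, mul_comm (-_)]
    rw [key, norm_smul, norm_mul, norm_neg, Complex.norm_real, norm_inv, Real.norm_eq_abs,
      abs_of_nonneg (by linarith)]
    have h1 : ‖1 - z • quatMat a‖ ≤ 3 := by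
      refine (norm_sub_le _ _).trans ?_
      rw [norm_smul, norm_one]
      nlinarith [norm_quatMat_le a, norm_nonneg z, norm_nonneg (quatMat a)]
    have h2 : ‖1 + z • quatMat (‖a‖⁻¹ • star a)‖ ≤ 3 := by
      refine (norm_add_le _ _).trans ?_
      have := norm_quatMat_le (‖a‖⁻¹ • star a)
      rw [norm_smul, norm_star, norm_inv, norm_norm, inv_mul_cancel₀ hn] at this
      rw [norm_smul, norm_one]
      nlinarith [norm_nonneg z, norm_nonneg (quatMat (‖a‖⁻¹ • star a))]
    calc _ ≤ (1 - ‖a‖) * ((1 - ‖z‖) ^ 2)⁻¹ * (3 * 3) := by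
          have h0 : 0 ≤ 1 - ‖a‖ := by linarith
          have h3 : ‖(1 - z • quatMat a) * (1 + z • quatMat (‖a‖⁻¹ • star a))‖ ≤ 3 * 3 :=
            (norm_mul_le _ _).trans (mul_le_mul h1 h2 (norm_nonneg _) (by norm_num))
          gcongr
      _ = _ := by field_simp; ring

end QuatHardy

end

/-! ### Division by scalar functions and extraction of one zero. -/

noncomputable section

namespace QuatHardy

local notation "conj" => starRingEnd ℂ
local notation "𝔻" => Metric.ball (0 : ℂ) 1

lemma analyticAt_of_disc {F : ℂ → ℂ} (hF : DifferentiableOn ℂ F 𝔻) {z : ℂ} (hz : z ∈ 𝔻) :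
    AnalyticAt ℂ F z := hF.analyticOnNhd Metric.isOpen_ball z hz

lemma order_ne_top {s : ℂ → ℂ} (hs : DifferentiableOn ℂ s 𝔻) (h0 : ∃ z ∈ 𝔻, s z ≠ 0) {z : ℂ}
    (hz : z ∈ 𝔻) : analyticOrderAt s z ≠ ⊤ := by
  obtain ⟨w, hw, hw0⟩ := h0
  refine (hs.analyticOnNhd Metric.isOpen_ball).analyticOrderAt_ne_top_of_isPreconnected
    (convex_ball _ _).isPreconnected hw hz ?_
  rw [(analyticAt_of_disc hs hw).analyticOrderAt_eq_zero.2 hw0]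
  simp

lemma mul_left_cancel_of_disc {s F G : ℂ → ℂ} (hs : DifferentiableOn ℂ s 𝔻)
    (h0 : ∃ z ∈ 𝔻, s z ≠ 0) (hF : DifferentiableOn ℂ F 𝔻) (hG : DifferentiableOn ℂ G 𝔻)
    (h : ∀ z ∈ 𝔻, s z * F z = s z * G z) : ∀ z ∈ 𝔻, F z = G z := by
  obtain ⟨w, hw, hw0⟩ := h0
  apply (hF.analyticOnNhd Metric.isOpen_ball).eqOn_of_preconnected_of_eventuallyEq
    (hG.analyticOnNhd Metric.isOpen_ball) (convex_ball _ _).isPreconnected hw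
  filter_upwards [(analyticAt_of_disc hs hw).continuousAt.eventually_ne hw0,
    Metric.isOpen_ball.mem_nhds hw] with z h1 h2
  exact mul_left_cancel₀ h1 (h z h2)

/-- Division of holomorphic functions on the disc. -/
lemma exists_eq_mul {s g : ℂ → ℂ} (hs : DifferentiableOn ℂ s 𝔻) (h0 : ∃ z ∈ 𝔻, s z ≠ 0)
    (hg : DifferentiableOn ℂ g 𝔻) (h : ∀ z ∈ 𝔻, analyticOrderAt s z ≤ analyticOrderAt g z) :
    ∃ k : ℂ → ℂ, DifferentiableOn ℂ k 𝔻 ∧ ∀ z ∈ 𝔻, g z = s z * k z := by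
  have hm : MeromorphicOn (g / s) 𝔻 := fun z hz =>
    (analyticAt_of_disc hg hz).meromorphicAt.div (analyticAt_of_disc hs hz).meromorphicAt
  -- The quotient in normal form has nonnegative order everywhere on the disc, so its singularities
  -- are removed.
  have ha : ∀ z ∈ 𝔻, AnalyticAt ℂ (toMeromorphicNFOn (g / s) 𝔻) z := by
    intro z hz
    rw [← (meromorphicNFOn_toMeromorphicNFOn (g / s) 𝔻 hz).meromorphicOrderAt_nonneg_iff_analyticAt,
      meromorphicOrderAt_toMeromorphicNFOn hm hz,
      meromorphicOrderAt_div (analyticAt_of_disc hg hz).meromorphicAt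
        (analyticAt_of_disc hs hz).meromorphicAt,
      (analyticAt_of_disc hg hz).meromorphicOrderAt_eq,
      (analyticAt_of_disc hs hz).meromorphicOrderAt_eq]
    have h1 := order_ne_top hs h0 hz
    have h2 := h z hz
    generalize analyticOrderAt s z = m at *
    generalize analyticOrderAt g z = n at *
    lift m to ℕ using h1
    induction n using ENat.recTopCoe with
    | top => simp
    | coe n =>
      have : m ≤ n := by exact_mod_cast h2
      simp only [ENat.map_natCast]
      rw [← WithTop.LinearOrderedAddCommGroup.coe_sub]
      exact_mod_cast (by omega : (0 : ℤ) ≤ (n : ℤ) - m)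
  refine ⟨_, fun z hz => (ha z hz).differentiableAt.differentiableWithinAt, fun z hz => ?_⟩
  have h1 := hm.toMeromorphicNFOn_eq_self_on_nhdsNE hz
  have h2 : ∀ᶠ w in 𝓝[≠] z, s w ≠ 0 := by
    rcases (analyticAt_of_disc hs hz).eventually_eq_zero_or_eventually_ne_zero with h | h
    · exact absurd (analyticOrderAt_eq_top.2 h) (order_ne_top hs h0 hz)
    · exact h
  have h3 : g =ᶠ[𝓝[≠] z] fun w => s w * toMeromorphicNFOn (g / s) 𝔻 w := by
    filter_upwards [h1, h2] with w e1 e2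
    rw [e1, Pi.div_apply, mul_div_cancel₀ _ e2]
  have h4 := ((analyticAt_of_disc hg hz).frequently_eq_iff_eventually_eq
    ((analyticAt_of_disc hs hz).mul (ha z hz))).1 h3.frequently
  exact Filter.EventuallyEq.eq_of_nhds (f := g)
    (g := fun w => s w * toMeromorphicNFOn (g / s) 𝔻 w) h4

/-- `IsSymm` concerns all of ℂ, while an entrywise quotient is controlled only on the disc.
Averaging over the involution restores the symmetry and preserves the division identity on the disc.
-/
lemma isSymm_symmetrize (K : ℂ → M2) :
    IsSymm fun z => (1 / 2 : ℂ) • (K z + quatConj (K (conj z))) := by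
  intro z
  simp only [Complex.conj_conj, quatConj_smul, quatConj_add, quatConj_quatConj]
  simp [add_comm, map_ofNat]

lemma isHol_quatConj_conj {K : ℂ → M2} (hK : IsHol K) : IsHol fun z => quatConj (K (conj z)) := by
  intro i j
  simp only [quatConj]
  fin_cases i <;> fin_cases j
  · exact differentiableOn_conj_conj (hK 1 1)
  · exact (differentiableOn_conj_conj (hK 1 0)).neg
  · exact (differentiableOn_conj_conj (hK 0 1)).neg
  · exact differentiableOn_conj_conj (hK 0 0)

lemma IsHol.add {A B : ℂ → M2} (hA : IsHol A) (hB : IsHol B) : IsHol fun z => A z + B z :=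
  fun i j => (hA i j).add (hB i j)

/-- Division of matrix functions by scalar functions. -/
lemma exists_eq_smul {s : ℂ → ℂ} (hs : DifferentiableOn ℂ s 𝔻) (h0 : ∃ z ∈ 𝔻, s z ≠ 0)
    (hsc : ∀ z, s (conj z) = conj (s z)) {A : ℂ → M2} (hA : IsSymm A) (hd : IsHol A)
    (h : ∀ z ∈ 𝔻, ∀ i j, analyticOrderAt s z ≤ analyticOrderAt (fun z => A z i j) z) :
    ∃ K : ℂ → M2, IsSymm K ∧ IsHol K ∧ ∀ z ∈ 𝔻, A z = s z • K z := by
  choose k hk1 hk2 using fun i j => exists_eq_mul hs h0 (hd i j) (fun z hz => h z hz i j)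
  set K : ℂ → M2 := fun z => Matrix.of fun i j => k i j z with hK
  have hKd : IsHol K := fun i j => hk1 i j
  have hKA : ∀ z ∈ 𝔻, A z = s z • K z := by
    intro z hz
    ext i j
    exact hk2 i j z hz
  refine ⟨_, isSymm_symmetrize K, IsHol.smul (differentiableOn_const _)
    (hKd.add (isHol_quatConj_conj hKd)), fun z hz => ?_⟩
  have hz' : conj z ∈ 𝔻 := by simpa using hz
  have e : A z = s z • quatConj (K (conj z)) := by
    have h1 := hKA _ hz'
    rw [hA, hsc] at h1
    have h2 := congrArg quatConj h1
    rwa [quatConj_quatConj, quatConj_smul, Complex.conj_conj] at h2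
  rw [smul_comm, smul_add, ← hKA z hz, ← e, ← two_smul ℂ, smul_smul]
  norm_num

lemma one_le_order {F : ℂ → ℂ} {z : ℂ} (hF : AnalyticAt ℂ F z) (h : F z = 0) :
    1 ≤ analyticOrderAt F z :=
  Order.one_le_iff_ne_zero.2 (hF.analyticOrderAt_ne_zero.2 h)

lemma order_sub_self (w : ℂ) : analyticOrderAt (fun z => z - w) w = 1 :=
  analyticOrderAt_id_sub_const_self

lemma order_sub_of_ne {w z : ℂ} (h : z ≠ w) : analyticOrderAt (fun z => z - w) z = 0 :=
  (AnalyticAt.analyticOrderAt_eq_zero (by fun_prop)).2 (sub_ne_zero.2 h)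

lemma order_blaschkeNum (a : ℍ[ℝ]) (z : ℂ) :
    analyticOrderAt (blaschkeNum a) z =
      analyticOrderAt (fun z => z - slicePt a) z + analyticOrderAt (fun z => z - conj (slicePt a)) z :=
  analyticOrderAt_mul (f := fun z => z - slicePt a) (g := fun z => z - conj (slicePt a))
    (by fun_prop) (by fun_prop)

lemma mul_left_cancel_mat {s : ℂ → ℂ} (hs : DifferentiableOn ℂ s 𝔻)
    (h0 : ∃ z ∈ 𝔻, s z ≠ 0) {A B : ℂ → M2} (hA : IsHol A) (hB : IsHol B)
    (h : ∀ z ∈ 𝔻, s z • A z = s z • B z) : ∀ z ∈ 𝔻, A z = B z := by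
  intro z hz
  ext i j
  refine mul_left_cancel_of_disc hs h0 (hA i j) (hB i j) (fun w hw => ?_) z hz
  exact congrFun (congrFun (h w hw) i) j

lemma conj_mem_disc {z : ℂ} (hz : z ∈ 𝔻) : conj z ∈ 𝔻 := by simpa using hz

lemma blaschkeNum_ne_zero {a : ℍ[ℝ]} {z : ℂ} (h1 : z ≠ slicePt a) (h2 : z ≠ conj (slicePt a)) :
    blaschkeNum a z ≠ 0 := mul_ne_zero (sub_ne_zero.2 h1) (sub_ne_zero.2 h2)

lemma exists_ne_two (a b : ℂ) : ∃ z ∈ 𝔻, z ≠ a ∧ z ≠ b := by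
  have hi : Set.Infinite 𝔻 := infinite_of_mem_nhds 0 (Metric.ball_mem_nhds _ one_pos)
  obtain ⟨z, hz, hz'⟩ := hi.exists_notMem_finite (Set.toFinite {a, b})
  simp only [Set.mem_insert_iff, Set.mem_singleton_iff, not_or] at hz'
  exact ⟨z, hz, hz'⟩

lemma exists_blaschkeNum_ne_zero (a : ℍ[ℝ]) : ∃ z ∈ 𝔻, blaschkeNum a z ≠ 0 := by
  obtain ⟨z, hz, h1, h2⟩ := exists_ne_two (slicePt a) (conj (slicePt a))
  exact ⟨z, hz, blaschkeNum_ne_zero h1 h2⟩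

lemma slicePt_coe {w : ℂ} (hw : 0 ≤ w.im) : slicePt (w : ℍ[ℝ]) = w := by
  apply Complex.ext
  · simp [slicePt]
  · simp [slicePt, norm_im_coeComplex, abs_of_nonneg hw]

lemma slicePt_eq_of {p q : ℍ[ℝ]} (h1 : p.re = q.re) (h2 : ‖p‖ = ‖q‖) : slicePt p = slicePt q := by
  apply Complex.ext
  · exact h1
  · have : ‖p.im‖ ^ 2 = ‖q.im‖ ^ 2 := by
      have hp := norm_sq_eq p
      have hq := norm_sq_eq q
      rw [h1, h2] at hp
      rw [norm_im_sq, norm_im_sq]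
      linarith
    exact (sq_eq_sq₀ (norm_nonneg _) (norm_nonneg _)).1 this

lemma slicePt_conjugate {u : ℍ[ℝ]} (hu : u ≠ 0) (q : ℍ[ℝ]) : slicePt (u⁻¹ * q * u) = slicePt q := by
  apply slicePt_eq_of
  · have h : ∀ a b : ℍ[ℝ], (a * b).re = (b * a).re := by
      intro a b; simp; ring
    rw [h, ← mul_assoc, mul_inv_cancel₀ hu, one_mul]
  · rw [norm_mul, norm_mul, norm_inv]
    have : ‖u‖ ≠ 0 := by simpa using hu
    field_simp

lemma quatMat_coe_row (w : ℂ) : quatMat (w : ℍ[ℝ]) = !![w, 0; 0, conj w] := by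
  ext i j
  fin_cases i <;> fin_cases j <;> apply Complex.ext <;> simp [quatMat]

/-- A singular matrix is annihilated by `c̄ - w` for some `c` on the sphere of `w`. -/
lemma exists_mul_eq_zero {B : M2} (hB : B.det = 0) {w : ℂ} (hw : 0 ≤ w.im) :
    ∃ c : ℍ[ℝ], slicePt c = w ∧ B * (quatMat (star c) - w • 1) = 0 := by
  by_cases h0 : B = 0
  · exact ⟨w, slicePt_coe hw, by rw [h0, zero_mul]⟩
  have : ∃ i, B i ≠ 0 := by
    by_contra h
    push Not at h
    exact h0 (funext h)
  obtain ⟨i, hi⟩ := this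
  -- Read a nonzero row of B as a quaternion u. From u (u⁻¹ w u) = w u, this row is a left
  -- eigenvector, with eigenvalue w, of the matrix of u⁻¹ w u.
  set u : ℍ[ℝ] := (B i 0 : ℍ[ℝ]) + (B i 1 : ℍ[ℝ]) * unitJ with hu
  have hu0 : u ≠ 0 := by
    intro h
    have e1 := congrArg QuaternionAlgebra.re h
    have e2 := congrArg QuaternionAlgebra.imI h
    have e3 := congrArg QuaternionAlgebra.imJ h
    have e4 := congrArg QuaternionAlgebra.imK h
    simp [hu] at e1 e2 e3 e4
    apply hi
    funext j
    fin_cases j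
    · exact Complex.ext e1 e2
    · exact Complex.ext e3 e4
  refine ⟨star (u⁻¹ * w * u), ?_, ?_⟩
  · rw [slicePt_star, slicePt_conjugate hu0, slicePt_coe hw]
  · rw [star_star]
    set Q := quatMat (u⁻¹ * w * u) with hQ
    have hrow : quatMat u * Q = quatMat (w : ℍ[ℝ]) * quatMat u := by
      rw [hQ, ← quatMat_mul, ← quatMat_mul]
      congr 1
      rw [← mul_assoc, ← mul_assoc, mul_inv_cancel₀ hu0, one_mul]
    have hu1 : quatMat u 0 0 = B i 0 := by apply Complex.ext <;> simp [quatMat, hu]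
    have hu2 : quatMat u 0 1 = B i 1 := by apply Complex.ext <;> simp [quatMat, hu]
    have r0 := congrFun (congrFun hrow 0) 0
    have r1 := congrFun (congrFun hrow 0) 1
    simp only [Matrix.mul_apply, Fin.sum_univ_two, hu1, hu2, quatMat_coe_row] at r0 r1
    simp at r0 r1
    rw [Matrix.det_fin_two] at hB
    have key : ∀ k j, (B * (Q - w • 1)) k j = B k 0 * (Q 0 j - w * (1 : M2) 0 j)
        + B k 1 * (Q 1 j - w * (1 : M2) 1 j) := by
      intro k j
      simp [Matrix.mul_apply, Fin.sum_univ_two]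
    have ki : ∀ j, (B * (Q - w • 1)) i j = 0 := by
      intro j
      rw [key]
      fin_cases j
      · simp [Matrix.one_apply]; linear_combination r0
      · simp [Matrix.one_apply]; linear_combination r1
    -- Since det B = 0, every row is proportional to the chosen one and inherits the eigenvector
    -- property.
    have hdet : ∀ k, B k 0 * B i 1 = B k 1 * B i 0 := by
      intro k
      fin_cases k <;> fin_cases i <;> simp <;> first | ring1 | linear_combination hB | linear_combination -hB
    ext k j
    rw [Matrix.zero_apply]
    have h2 := ki j
    have h3 := hdet k
    rw [key] at h2 ⊢
    by_cases hB0 : B i 0 = 0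
    · have hB1 : B i 1 ≠ 0 := by
        intro h
        apply hi
        funext j
        fin_cases j
        · exact hB0
        · exact h
      apply mul_left_cancel₀ hB1
      linear_combination B k 1 * h2 + (Q 0 j - w * (1 : M2) 0 j) * h3
    · apply mul_left_cancel₀ hB0
      linear_combination B k 0 * h2 - (Q 1 j - w * (1 : M2) 1 j) * h3

/-- At a real point the symmetry makes A(w) the matrix of a quaternion, and its determinant is the
squared modulus. -/
lemma eq_zero_of_det_eq_zero_of_real {A : ℂ → M2} (hA : IsSymm A) {w : ℂ} (hw : w.im = 0)
    (h : (A w).det = 0) : A w = 0 := by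
  have hc : conj w = w := Complex.conj_eq_iff_im.2 hw
  have h1 := hA w
  rw [hc] at h1
  have h2 : A w = quatMat (rowQuat (A w)) := by
    conv_lhs => rw [h1]
    have e := h1
    have a0 := congrFun (congrFun h1 0) 0
    have a1 := congrFun (congrFun h1 0) 1
    have a2 := congrFun (congrFun h1 1) 0
    have a3 := congrFun (congrFun h1 1) 1
    simp [quatConj] at a0 a1 a2 a3
    ext i j
    fin_cases i <;> fin_cases j <;> simp [quatConj, quatMat]
    · exact a0.symm
    · rw [← a1]
  rw [h2, det_quatMat] at h
  have : rowQuat (A w) = 0 := by simpa using h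
  rw [h2, this]
  ext i j
  fin_cases i <;> fin_cases j <;> apply Complex.ext <;> simp [quatMat]

/-- Extraction of a linear factor on the right. -/
lemma exists_linear_factor {A : ℂ → M2} (hA : IsSymm A) (hd : IsHol A) {w : ℂ} (hw : w ∈ 𝔻)
    (him : 0 ≤ w.im) (hdet : (A w).det = 0) :
    ∃ (c : ℍ[ℝ]) (H : ℂ → M2), slicePt c = w ∧ IsSymm H ∧ IsHol H ∧
      ∀ z ∈ 𝔻, A z = H z * (quatMat c - z • 1) := by
  rcases him.eq_or_lt with h0 | h0
  -- Real zero: the whole matrix vanishes, and the scalar w - z divides it.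
  · have hA0 := eq_zero_of_det_eq_zero_of_real hA h0.symm hdet
    have hcw : conj w = w := Complex.conj_eq_iff_im.2 h0.symm
    obtain ⟨K, hK1, hK2, hK3⟩ := exists_eq_smul (s := fun z => w - z) (by fun_prop)
      (by obtain ⟨z, hz, h, _⟩ := exists_ne_two w w; exact ⟨z, hz, sub_ne_zero.2 h.symm⟩)
      (by intro z; simp [hcw]) hA hd (by
        intro z hz i j
        by_cases hzw : z = w
        · have e : (fun z => w - z) = -(fun z => z - w) := by funext z; simp
          rw [hzw, e, analyticOrderAt_neg, order_sub_self]
          exact one_le_order (analyticAt_of_disc (hd i j) hw) (by rw [hA0]; rfl)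
        · rw [(AnalyticAt.analyticOrderAt_eq_zero (by fun_prop)).2 (sub_ne_zero.2 (Ne.symm hzw))]
          exact zero_le)
    refine ⟨w, K, slicePt_coe h0.le, hK1, hK2, fun z hz => ?_⟩
    have : quatMat (w : ℍ[ℝ]) = w • 1 := by
      rw [quatMat_coe_row, hcw]
      ext i j
      fin_cases i <;> fin_cases j <;> simp
    rw [hK3 z hz, this, ← sub_smul, mul_smul_comm, mul_one]
  · obtain ⟨c, hc, hc0⟩ := exists_mul_eq_zero hdet him
    -- Nonreal zero: A(z)(c̄ - z) vanishes at w and, by symmetry, at w̄, so it is divisible by (c̄ -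
    -- z)(c - z), which is a scalar with simple zeros there. Cancelling this scalar gives A(z) =
    -- K(z)(c - z).
    have hCs : IsSymm fun z => A z * (quatMat (star c) - z • 1) :=
      hA.mul ((isSymm_const _).sub isSymm_id)
    have hCd : IsHol fun z => A z * (quatMat (star c) - z • 1) :=
      hd.mul ((isHol_const _).sub (isHol_smul_const 1))
    have hcw : conj w ≠ w := by
      intro h
      exact h0.ne' (Complex.conj_eq_iff_im.1 h)
    have hC' : A (conj w) * (quatMat (star c) - conj w • 1) = 0 := by
      have := hCs w
      simp only at this
      rw [this, hc0]
      ext i j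
      fin_cases i <;> fin_cases j <;> simp [quatConj]
    obtain ⟨K, hK1, hK2, hK3⟩ := exists_eq_smul (differentiable_blaschkeNum c).differentiableOn
      (exists_blaschkeNum_ne_zero c) (conj_blaschkeNum c) hCs hCd (by
        intro z hz i j
        rw [order_blaschkeNum, hc]
        by_cases hzw : z = w
        · rw [hzw, order_sub_self, order_sub_of_ne hcw.symm, add_zero]
          exact one_le_order (analyticAt_of_disc (hCd i j) hw) (congrFun (congrFun hc0 i) j)
        · by_cases hzw' : z = conj w
          · rw [hzw', order_sub_self, order_sub_of_ne hcw, zero_add]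
            exact one_le_order (analyticAt_of_disc (hCd i j) (conj_mem_disc hw))
              (congrFun (congrFun hC' i) j)
          · rw [order_sub_of_ne hzw, order_sub_of_ne hzw', add_zero]
            exact zero_le)
    refine ⟨c, K, hc, hK1, hK2, ?_⟩
    apply mul_left_cancel_mat (differentiable_blaschkeNum c).differentiableOn
      (exists_blaschkeNum_ne_zero c) hd (hK2.mul ((isHol_const _).sub (isHol_smul_const 1)))
    intro z hz
    have e : (quatMat (star c) - z • 1) * (quatMat c - z • 1) = blaschkeNum c z • 1 := by
      have e1 : quatMat (star c) - z • 1 = (quatMat c - z • 1).adjugate := by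
        rw [quatMat_star]
        simp only [Matrix.adjugate_fin_two]
        ext i j
        fin_cases i <;> fin_cases j <;> simp
      rw [e1, Matrix.adjugate_mul, det_sub_smul_one]
    rw [← smul_mul_assoc, ← hK3 z hz, mul_assoc, e, mul_smul_comm, mul_one]

/-- Extraction of a Blaschke factor on the right. -/
lemma exists_blaschke_factor {A : ℂ → M2} (hA : IsSymm A) (hd : IsHol A) {w : ℂ} (hw : w ∈ 𝔻)
    (him : 0 ≤ w.im) (hdet : (A w).det = 0) :
    ∃ (c : ℍ[ℝ]) (H : ℂ → M2), slicePt c = w ∧ IsSymm H ∧ IsHol H ∧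
      ∀ z ∈ 𝔻, A z = H z * blaschkeMat c z := by
  obtain ⟨c, H, hc, h1, h2, h3⟩ := exists_linear_factor hA hd hw him hdet
  have hc1 : ‖c‖ < 1 := by rw [← norm_slicePt, hc]; simpa using hw
  refine ⟨c, fun z => H z * blaschkeUnit c z, hc, h1.mul (isSymm_blaschkeUnit c),
    h2.mul (isHol_blaschkeUnit c), fun z hz => ?_⟩
  rw [mul_assoc, blaschkeUnit_mul hc1 hz, h3 z hz]

/-- The order of vanishing does not decrease in locally uniform limits. -/
lemma le_order_of_tendsto {F : ℕ → ℂ → ℂ} {G : ℂ → ℂ}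
    (h : TendstoLocallyUniformlyOn F G Filter.atTop 𝔻) (hF : ∀ n, DifferentiableOn ℂ (F n) 𝔻)
    {z : ℂ} (hz : z ∈ 𝔻) {k : ℕ} (hk : ∀ᶠ n in Filter.atTop, (k : ℕ∞) ≤ analyticOrderAt (F n) z) :
    (k : ℕ∞) ≤ analyticOrderAt G z := by
  have hG := h.differentiableOn (.of_forall hF) Metric.isOpen_ball
  rw [natCast_le_analyticOrderAt_iff_iteratedDeriv_eq_zero (analyticAt_of_disc hG hz)]
  -- Order at least k means that all derivatives below k vanish, and Weierstrass' theorem passes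
  -- each of them to the limit.
  have key : ∀ i, TendstoLocallyUniformlyOn (fun n => iteratedDeriv i (F n)) (iteratedDeriv i G)
      Filter.atTop 𝔻 ∧ ∀ n, DifferentiableOn ℂ (iteratedDeriv i (F n)) 𝔻 := by
    intro i
    induction i with
    | zero => simpa using ⟨h, hF⟩
    | succ i ih =>
      simp only [iteratedDeriv_succ]
      exact ⟨ih.1.deriv (.of_forall ih.2) Metric.isOpen_ball,
        fun n => (ih.2 n).deriv Metric.isOpen_ball⟩
  intro i hi
  refine tendsto_nhds_unique ((key i).1.tendsto_at hz) ?_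
  refine tendsto_const_nhds.congr' ?_
  filter_upwards [hk] with n hn
  exact ((natCast_le_analyticOrderAt_iff_iteratedDeriv_eq_zero
    (analyticAt_of_disc (hF n) hz)).1 hn i hi).symm

lemma tendsto_mul_adjugate_apply {α : Type*} {l : Filter α} {A L : α → M2} {a b : M2}
    (hA : Filter.Tendsto A l (𝓝 a)) (hL : Filter.Tendsto L l (𝓝 b)) (i j : Fin 2) :
    Filter.Tendsto (fun x => (A x * (L x).adjugate) i j) l (𝓝 ((a * b.adjugate) i j)) := by
  have h1 : Filter.Tendsto (fun x => (L x).adjugate) l (𝓝 b.adjugate) :=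
    ((continuous_id.matrix_adjugate : Continuous fun B : M2 => B.adjugate).tendsto b).comp hL
  have h2 : Filter.Tendsto (fun x => A x * (L x).adjugate) l (𝓝 (a * b.adjugate)) := hA.mul h1
  exact tendsto_pi_nhds.1 (tendsto_pi_nhds.1 h2 i) j

end QuatHardy

end

/-! ### Infinite products of matrix functions. -/

noncomputable section

namespace QuatHardy

local notation "conj" => starRingEnd ℂ
local notation "𝔻" => Metric.ball (0 : ℂ) 1

attribute [local instance] Matrix.linftyOpNormedRing Matrix.linftyOpNormedAlgebra

/-- Ordered products growing on the right. -/
def seqProd {R : Type*} [Monoid R] (F : ℕ → R) : ℕ → R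
  | 0 => 1
  | n + 1 => seqProd F n * F n

lemma seqProd_add {R : Type*} [Monoid R] (F : ℕ → R) (k n : ℕ) :
    seqProd F (k + n) = seqProd F k * seqProd (fun i => F (k + i)) n := by
  induction n with
  | zero => simp [seqProd]
  | succ n ih => rw [← add_assoc, seqProd, ih, seqProd, mul_assoc]

lemma seqProd_congr {R : Type*} [Monoid R] {F G : ℕ → R} {n : ℕ} (h : ∀ i < n, F i = G i) :
    seqProd F n = seqProd G n := by
  induction n with
  | zero => rfl
  | succ n ih => rw [seqProd, seqProd, ih fun i hi => h i (by omega), h n (by omega)]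

section NormedRing

variable {R : Type*} [NormedRing R] [NormOneClass R] {F : ℕ → R} {e : ℕ → ℝ}

/-- Each factor has norm at most 1 + e n ≤ exp (e n), so no commutativity is needed. -/
lemma norm_seqProd_le (he0 : ∀ n, 0 ≤ e n) (hs : Summable e) (h : ∀ n, ‖F n - 1‖ ≤ e n) (n : ℕ) :
    ‖seqProd F n‖ ≤ Real.exp (∑' i, e i) := by
  have : ‖seqProd F n‖ ≤ Real.exp (∑ i ∈ Finset.range n, e i) := by
    induction n with
    | zero => simp [seqProd]
    | succ n ih =>
      rw [seqProd, Finset.sum_range_succ, Real.exp_add]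
      refine (norm_mul_le _ _).trans ?_
      have h1 : ‖F n‖ ≤ Real.exp (e n) := by
        have : ‖F n‖ ≤ ‖F n - 1‖ + ‖(1 : R)‖ := by
          simpa using norm_add_le (F n - 1) 1
        rw [norm_one] at this
        linarith [h n, Real.add_one_le_exp (e n)]
      gcongr
  exact this.trans (Real.exp_le_exp.2 (hs.sum_le_tsum _ fun i _ => he0 i))

lemma dist_seqProd_le (he0 : ∀ n, 0 ≤ e n) (hs : Summable e) (h : ∀ n, ‖F n - 1‖ ≤ e n) (n : ℕ) :
    dist (seqProd F n) (seqProd F n.succ) ≤ Real.exp (∑' i, e i) * e n := by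
  rw [dist_eq_norm, seqProd, ← norm_neg, neg_sub]
  have : seqProd F n * F n - seqProd F n = seqProd F n * (F n - 1) := by noncomm_ring
  rw [this]
  refine (norm_mul_le _ _).trans ?_
  gcongr
  · exact norm_seqProd_le he0 hs h n
  · exact h n

lemma exists_tendsto_seqProd [CompleteSpace R] (he0 : ∀ n, 0 ≤ e n) (hs : Summable e)
    (h : ∀ n, ‖F n - 1‖ ≤ e n) : ∃ L, Filter.Tendsto (seqProd F) Filter.atTop (𝓝 L) :=
  cauchySeq_tendsto_of_complete
    (cauchySeq_of_dist_le_of_summable _ (dist_seqProd_le he0 hs h) (hs.mul_left _))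

lemma norm_seqProd_sub_le (he0 : ∀ n, 0 ≤ e n) (hs : Summable e)
    (h : ∀ n, ‖F n - 1‖ ≤ e n) {L : R} (hL : Filter.Tendsto (seqProd F) Filter.atTop (𝓝 L)) (n : ℕ) :
    ‖seqProd F n - L‖ ≤ Real.exp (∑' i, e i) * ∑' m, e (n + m) := by
  rw [← dist_eq_norm, ← tsum_mul_left]
  exact dist_le_tsum_of_dist_le_of_tendsto _ (dist_seqProd_le he0 hs h) (hs.mul_left _) hL n

end NormedRing

/-- A sequence of holomorphic matrix functions whose product converges on the disc. -/
structure NearOne (F : ℕ → ℂ → M2) (e : ℕ → ℝ) : Prop where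
  nonneg : ∀ n, 0 ≤ e n
  summable : Summable e
  hol : ∀ n, IsHol (F n)
  le : ∀ n, ∀ z ∈ 𝔻, ‖F n z - 1‖ ≤ 9 / (1 - ‖z‖) ^ 2 * e n

lemma NearOne.shift {F : ℕ → ℂ → M2} {e : ℕ → ℝ} (h : NearOne F e) (k : ℕ) :
    NearOne (fun n => F (k + n)) fun n => e (k + n) where
  nonneg n := h.nonneg _
  summable := by
    have := (summable_nat_add_iff k).2 h.summable
    simpa only [add_comm] using this
  hol n := h.hol _
  le n := h.le _

/-- The finite products of a sequence of matrix functions. -/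
def prodMat (F : ℕ → ℂ → M2) (n : ℕ) (z : ℂ) : M2 := seqProd (fun k => F k z) n

open Classical in
/-- The infinite product of a sequence of matrix functions on the disc. -/
def limProd (F : ℕ → ℂ → M2) (z : ℂ) : M2 :=
  -- The value 1 off the disc is fixed by `quatConj`, so the limit satisfies `IsSymm` on all of ℂ.
  if z ∈ 𝔻 then Filter.limUnder Filter.atTop fun n => prodMat F n z else 1

/-- The constant in the estimate of the speed of convergence. -/
def convConst (r S : ℝ) : ℝ := Real.exp (9 / (1 - r) ^ 2 * S) * (9 / (1 - r) ^ 2)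

lemma NearOne.tendsto {F : ℕ → ℂ → M2} {e : ℕ → ℝ} (h : NearOne F e) {z : ℂ} (hz : z ∈ 𝔻) :
    Filter.Tendsto (fun n => prodMat F n z) Filter.atTop (𝓝 (limProd F z)) := by
  rw [limProd, if_pos hz]
  exact tendsto_nhds_limUnder (exists_tendsto_seqProd
    (fun n => mul_nonneg (by positivity) (h.nonneg n)) (h.summable.mul_left _)
    (fun n => h.le n z hz))

lemma NearOne.norm_sub_le {F : ℕ → ℂ → M2} {e : ℕ → ℝ} (h : NearOne F e) {r : ℝ} (hr : r < 1) {z : ℂ}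
    (hz : ‖z‖ ≤ r) (n : ℕ) :
    ‖prodMat F n z - limProd F z‖ ≤ convConst r (∑' i, e i) * ∑' m, e (n + m) := by
  have hz' : z ∈ 𝔻 := by rw [mem_ball_zero_iff]; linarith
  have hC : 9 / (1 - ‖z‖) ^ 2 ≤ 9 / (1 - r) ^ 2 := by
    have : 0 < 1 - r := by linarith
    gcongr
  have h0 : ∀ n, 0 ≤ 9 / (1 - r) ^ 2 * e n := fun n => mul_nonneg (by positivity) (h.nonneg n)
  have h1 : ∀ n, ‖F n z - 1‖ ≤ 9 / (1 - r) ^ 2 * e n := fun n =>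
    (h.le n z hz').trans (mul_le_mul_of_nonneg_right hC (h.nonneg n))
  have hL : Filter.Tendsto (seqProd fun k => F k z) Filter.atTop (𝓝 (limProd F z)) := h.tendsto hz'
  have key := norm_seqProd_sub_le h0 (h.summable.mul_left _) h1 hL n
  rw [convConst, mul_assoc, ← tsum_mul_left, ← tsum_mul_left]
  exact key

lemma tendsto_tail {e : ℕ → ℝ} (K : ℝ) :
    Filter.Tendsto (fun n => K * ∑' m, e (n + m)) Filter.atTop (𝓝 0) := by
  have := (tendsto_sum_nat_add e).const_mul K
  simpa only [mul_zero, add_comm] using this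

lemma isHol_prodMat {F : ℕ → ℂ → M2} (h : ∀ n, IsHol (F n)) (n : ℕ) : IsHol (prodMat F n) := by
  induction n with
  | zero => exact isHol_const 1
  | succ n ih => exact ih.mul (h n)

lemma isSymm_prodMat {F : ℕ → ℂ → M2} (h : ∀ n, IsSymm (F n)) (n : ℕ) : IsSymm (prodMat F n) := by
  induction n with
  | zero => exact isSymm_one
  | succ n ih => exact ih.mul (h n)

lemma IsHol.continuousOn {A : ℂ → M2} (hA : IsHol A) : ContinuousOn A 𝔻 := by
  have : ∀ i, ContinuousOn (fun z => A z i) 𝔻 := fun i => continuousOn_pi.2 fun j => (hA i j).continuousOn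
  exact continuousOn_pi.2 this

lemma NearOne.tendstoLocallyUniformlyOn {F : ℕ → ℂ → M2} {e : ℕ → ℝ} (h : NearOne F e) (i j : Fin 2) :
    TendstoLocallyUniformlyOn (fun n z => prodMat F n z i j) (fun z => limProd F z i j)
      Filter.atTop 𝔻 := by
  rw [tendstoLocallyUniformlyOn_iff_forall_isCompact Metric.isOpen_ball]
  intro K hK hKc
  obtain ⟨r, hr, hKr⟩ : ∃ r < 1, ∀ z ∈ K, ‖z‖ ≤ r := by
    rcases K.eq_empty_or_nonempty with rfl | hne
    · exact ⟨0, one_pos, by simp⟩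
    · obtain ⟨w, hw, hmax⟩ := hKc.exists_isMaxOn hne continuous_norm.continuousOn
      exact ⟨‖w‖, by simpa using hK hw, fun z hz => hmax hz⟩
  rw [Metric.tendstoUniformlyOn_iff]
  intro ε hε
  filter_upwards [(tendsto_tail (convConst r (∑' i, e i))).eventually (gt_mem_nhds hε)] with n hn z hz
  rw [dist_comm, dist_eq_norm]
  refine lt_of_le_of_lt ?_ hn
  refine le_trans ?_ (h.norm_sub_le hr (hKr z hz) n)
  exact norm_entry_le (prodMat F n z - limProd F z) i j

lemma NearOne.isHol_limProd {F : ℕ → ℂ → M2} {e : ℕ → ℝ} (h : NearOne F e) : IsHol (limProd F) :=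
  fun i j => (h.tendstoLocallyUniformlyOn i j).differentiableOn
    (.of_forall fun n => isHol_prodMat h.hol n i j) Metric.isOpen_ball

lemma continuous_quatConj : Continuous quatConj := by
  unfold quatConj
  refine continuous_pi fun i => continuous_pi fun j => ?_
  have hc : ∀ k l : Fin 2, Continuous fun A : M2 => A k l := fun k l =>
    (continuous_apply l).comp (continuous_apply k)
  fin_cases i <;> fin_cases j
  · exact Complex.continuous_conj.comp (hc 1 1)
  · exact (Complex.continuous_conj.comp (hc 1 0)).neg
  · exact (Complex.continuous_conj.comp (hc 0 1)).neg
  · exact Complex.continuous_conj.comp (hc 0 0)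

lemma NearOne.isSymm_limProd {F : ℕ → ℂ → M2} {e : ℕ → ℝ} (h : NearOne F e) (hF : ∀ n, IsSymm (F n)) :
    IsSymm (limProd F) := by
  intro z
  by_cases hz : z ∈ 𝔻
  · have h1 := h.tendsto (conj_mem_disc hz)
    have h2 := (continuous_quatConj.tendsto _).comp (h.tendsto hz)
    refine tendsto_nhds_unique h1 (h2.congr fun n => ?_)
    exact (isSymm_prodMat hF n z).symm
  · have hz' : conj z ∉ 𝔻 := by simpa using hz
    rw [limProd, limProd, if_neg hz, if_neg hz', quatConj_one]

lemma NearOne.limProd_eq {F : ℕ → ℂ → M2} {e : ℕ → ℝ} (h : NearOne F e) (k : ℕ) {z : ℂ} (hz : z ∈ 𝔻) :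
    limProd F z = prodMat F k z * limProd (fun n => F (k + n)) z := by
  have h1 := (h.tendsto hz).comp (Filter.tendsto_atTop_mono (fun n => Nat.le_add_left n k)
    Filter.tendsto_id)
  have h2 := ((h.shift k).tendsto hz).const_mul (prodMat F k z)
  refine tendsto_nhds_unique h1 (h2.congr fun n => ?_)
  exact (seqProd_add (fun i => F i z) k n).symm

lemma NearOne.tendsto_limProd_shift {F : ℕ → ℂ → M2} {e : ℕ → ℝ} (h : NearOne F e) {z : ℂ} (hz : z ∈ 𝔻) :
    Filter.Tendsto (fun k => limProd (fun n => F (k + n)) z) Filter.atTop (𝓝 1) := by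
  have hz1 : ‖z‖ < 1 := by simpa using hz
  refine tendsto_iff_norm_sub_tendsto_zero.2 ?_
  refine squeeze_zero (fun _ => norm_nonneg _) (fun k => ?_)
    (tendsto_tail (e := e) (convConst ‖z‖ (∑' i, e i)))
  -- The empty product is 1, so the estimate at n = 0 compares the tail product with 1. Its constant
  -- is bounded by that of the full sequence.
  have h1 := (h.shift k).norm_sub_le hz1 le_rfl 0
  rw [← norm_neg, neg_sub] at h1
  refine h1.trans ?_
  simp only [zero_add]
  have h2 : 0 ≤ ∑' m, e (k + m) := tsum_nonneg fun m => h.nonneg _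
  have h3 : ∑' i, e (k + i) ≤ ∑' i, e i := by
    rw [← h.summable.sum_add_tsum_nat_add k]
    simp only [add_comm k]
    linarith [Finset.sum_nonneg fun i (_ : i ∈ Finset.range k) => h.nonneg i]
  unfold convConst
  gcongr

lemma order_det_mul {A B C : ℂ → M2} (hB : IsHol B) (hC : IsHol C)
    (h : ∀ z ∈ 𝔻, A z = B z * C z) {z : ℂ} (hz : z ∈ 𝔻) :
    analyticOrderAt (fun z => (A z).det) z =
      analyticOrderAt (fun z => (B z).det) z + analyticOrderAt (fun z => (C z).det) z := by
  rw [← analyticOrderAt_mul (analyticAt_of_disc hB.det hz) (analyticAt_of_disc hC.det hz)]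
  apply analyticOrderAt_congr
  filter_upwards [Metric.isOpen_ball.mem_nhds hz] with w hw
  rw [h w hw, Matrix.det_mul]
  rfl

lemma order_det_prodMat {F : ℕ → ℂ → M2} (h : ∀ n, IsHol (F n)) (n : ℕ) {z : ℂ} (hz : z ∈ 𝔻) :
    analyticOrderAt (fun z => (prodMat F n z).det) z =
      ∑ j ∈ Finset.range n, analyticOrderAt (fun z => (F j z).det) z := by
  induction n with
  | zero =>
    rw [Finset.sum_range_zero, analyticOrderAt_eq_zero]
    right
    simp [prodMat, seqProd]
  | succ n ih =>
    rw [Finset.sum_range_succ, ← ih]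
    exact order_det_mul (isHol_prodMat h n) (h n) (fun _ _ => rfl) hz

/-- The tail products at z tend to 1, so from some n on their determinants do not vanish at z and
all the order sits in the first n factors. How large n must be depends on z. -/
lemma NearOne.order_det_limProd {F : ℕ → ℂ → M2} {e : ℕ → ℝ} (h : NearOne F e) {z : ℂ} (hz : z ∈ 𝔻) :
    ∀ᶠ n in Filter.atTop, analyticOrderAt (fun z => (limProd F z).det) z =
      ∑ j ∈ Finset.range n, analyticOrderAt (fun z => (F j z).det) z := by
  have h1 : Filter.Tendsto (fun k => (limProd (fun n => F (k + n)) z).det) Filter.atTop (𝓝 1) := by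
    have hc : Continuous fun A : M2 => A.det := continuous_id.matrix_det
    simpa [Function.comp_def] using (hc.tendsto 1).comp (h.tendsto_limProd_shift hz)
  filter_upwards [h1.eventually_ne one_ne_zero] with n hn
  rw [order_det_mul (isHol_prodMat h.hol n) (h.shift n).isHol_limProd (fun w hw => h.limProd_eq n hw) hz,
    order_det_prodMat h.hol n hz,
    (analyticAt_of_disc (h.shift n).isHol_limProd.det hz).analyticOrderAt_eq_zero.2 hn, add_zero]

end QuatHardy

end

/-! ### Blaschke products with prescribed spheres. -/

noncomputable section

namespace QuatHardy

local notation "conj" => starRingEnd ℂ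
local notation "𝔻" => Metric.ball (0 : ℂ) 1

attribute [local instance] Matrix.linftyOpNormedRing Matrix.linftyOpNormedAlgebra

open Classical in
/-- The factors of the Blaschke product of `a`, continued by `1`. -/
def facMat (N : ℕ∞) (a : ℕ → ℍ[ℝ]) (k : ℕ) : ℂ → M2 :=
  if (k : ℕ∞) < N then blaschkeMat (a k) else fun _ => 1

open Classical in
/-- The terms of the series in the Blaschke condition, continued by `0`. -/
def defect (N : ℕ∞) (a : ℕ → ℍ[ℝ]) (k : ℕ) : ℝ := if (k : ℕ∞) < N then 1 - ‖a k‖ else 0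

/-- The Blaschke condition. -/
structure BlaschkeSeq (N : ℕ∞) (a : ℕ → ℍ[ℝ]) : Prop where
  lt_one : ∀ n : ℕ, (n : ℕ∞) < N → ‖a n‖ < 1
  summable : Summable (defect N a)

lemma isSymm_facMat (N : ℕ∞) (a : ℕ → ℍ[ℝ]) (k : ℕ) : IsSymm (facMat N a k) := by
  unfold facMat
  split_ifs
  · exact isSymm_blaschkeMat _
  · exact isSymm_one

lemma BlaschkeSeq.nearOne {N : ℕ∞} {a : ℕ → ℍ[ℝ]} (h : BlaschkeSeq N a) :
    NearOne (facMat N a) (defect N a) where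
  nonneg n := by
    unfold defect
    split_ifs with hn
    · linarith [h.lt_one n hn]
    · exact le_rfl
  summable := h.summable
  hol n := by
    unfold facMat
    split_ifs with hn
    · exact isHol_blaschkeMat (h.lt_one n hn)
    · exact isHol_const 1
  le n z hz := by
    unfold facMat defect
    split_ifs with hn
    · exact norm_blaschkeMat_sub_one_le (h.lt_one n hn) hz
    · simp

lemma ofMat_one_eq : ofMat (fun _ => 1) = fun _ => 1 := funext ofMat_one

lemma partialProduct_eq (N : ℕ∞) (a : ℕ → ℍ[ℝ]) (k : ℕ) :
    partialProduct N a k = ofMat (prodMat (facMat N a) k) := by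
  induction k with
  | zero => exact ofMat_one_eq.symm
  | succ k ih =>
    rw [partialProduct]
    split_ifs with h
    · rw [ih, blaschkeFactor_eq, starMul_eq,
        toMat_ofMat (isSymm_prodMat (isSymm_facMat N a) k), toMat_ofMat (isSymm_blaschkeMat _)]
      congr 1
      funext z
      simp [prodMat, seqProd, facMat, h]
    · rw [ih]
      congr 1
      funext z
      simp [prodMat, seqProd, facMat, h]

lemma norm_rowQuat_le (B : M2) : ‖rowQuat B‖ ≤ 2 * ‖B‖ := by
  have hJ : ‖unitJ‖ = 1 := by
    have := norm_sq_eq unitJ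
    simp only [re_unitJ, imI_unitJ, imJ_unitJ, imK_unitJ] at this
    nlinarith [norm_nonneg unitJ]
  have hc : ∀ w : ℂ, ‖(w : ℍ[ℝ])‖ = ‖w‖ := fun w => by
    rw [← slicePoint_unitI, slicePoint_mem_unitBall unitI_mem]
  refine (norm_add_le _ _).trans ?_
  rw [norm_mul, hJ, hc, hc]
  linarith [norm_entry_le B 0 0, norm_entry_le B 0 1]

/-- Transfers uniform estimates from the disc to the ball. Each of `quatMat` and `rowQuat` costs a
factor 2, and |u| cancels. -/
lemma norm_ofMat_sub_le {A B : ℂ → M2} (hA : IsSymm A) (hB : IsSymm B) (q : ℍ[ℝ]) :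
    ‖ofMat A q - ofMat B q‖ ≤ 4 * ‖A (slicePt q) - B (slicePt q)‖ := by
  obtain ⟨J, hJ, hq⟩ := exists_slicePoint q
  obtain ⟨u, hu, huJ⟩ := exists_rotation hJ
  have h1 := mul_ofMat hA hJ huJ (slicePt q).re (slicePt q).im
  have h2 := mul_ofMat hB hJ huJ (slicePt q).re (slicePt q).im
  rw [← hq] at h1 h2
  have h3 : ‖u‖ * ‖ofMat A q - ofMat B q‖ ≤ ‖u‖ * (4 * ‖A (slicePt q) - B (slicePt q)‖) := by
    rw [← norm_mul, mul_sub, h1, h2, ← rowQuat_sub, ← mul_sub]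
    refine (norm_rowQuat_le _).trans ?_
    have := norm_mul_le (quatMat u) (A (slicePt q) - B (slicePt q))
    have h4 := norm_quatMat_le u
    have h5 := norm_nonneg (A (slicePt q) - B (slicePt q))
    change 2 * ‖quatMat u * (A (slicePt q) - B (slicePt q))‖ ≤ _
    nlinarith
  exact le_of_mul_le_mul_left h3 (norm_pos_iff.2 hu)

lemma exists_lt_one_of_isCompact {K : Set ℍ[ℝ]} (hK : K ⊆ unitBall) (hKc : IsCompact K) :
    ∃ r < 1, ∀ q ∈ K, ‖q‖ ≤ r := by
  rcases K.eq_empty_or_nonempty with rfl | hne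
  · exact ⟨0, one_pos, by simp⟩
  · obtain ⟨w, hw, hmax⟩ := hKc.exists_isMaxOn hne continuous_norm.continuousOn
    exact ⟨‖w‖, hK hw, fun z hz => hmax hz⟩

lemma isBlaschkeProductOf_limProd {N : ℕ∞} {a : ℕ → ℍ[ℝ]} (h : BlaschkeSeq N a) :
    IsBlaschkeProductOf N a (ofMat (limProd (facMat N a))) := by
  refine ⟨h.lt_one, ?_, ?_⟩
  · have e : defect N a = Set.indicator {n : ℕ | (n : ℕ∞) < N} fun n => 1 - ‖a n‖ := by
      funext n
      simp only [defect, Set.indicator]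
      rfl
    have := h.summable
    rw [e, ← summable_subtype_iff_indicator] at this
    exact this
  · intro K hK hKc
    obtain ⟨r, hr, hKr⟩ := exists_lt_one_of_isCompact hK hKc
    rw [Metric.tendstoUniformlyOn_iff]
    intro ε hε
    have ht := tendsto_tail (e := defect N a) (4 * convConst r (∑' i, defect N a i))
    filter_upwards [ht.eventually (gt_mem_nhds hε)] with n hn q hq
    rw [dist_comm, dist_eq_norm, partialProduct_eq]
    refine lt_of_le_of_lt (norm_ofMat_sub_le (isSymm_prodMat (isSymm_facMat N a) n)
      (h.nearOne.isSymm_limProd (isSymm_facMat N a)) q) (lt_of_le_of_lt ?_ hn)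
    rw [mul_assoc]
    gcongr
    apply h.nearOne.norm_sub_le hr
    rw [norm_slicePt]
    exact hKr q hq

/-- The real quadratic polynomial with roots `w` and `w̄`. -/
def quad (w z : ℂ) : ℂ := (z - w) * (z - conj w)

lemma blaschkeNum_eq_quad (a : ℍ[ℝ]) : blaschkeNum a = quad (slicePt a) := rfl

open Classical in
/-- The order at `z` of the determinant of a factor with zero `w k`. -/
def facOrd (N : ℕ∞) (w : ℕ → ℂ) (z : ℂ) (k : ℕ) : ℕ∞ :=
  if (k : ℕ∞) < N then analyticOrderAt (quad (w k)) z else 0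

lemma order_det_blaschkeMat {a : ℍ[ℝ]} (ha : ‖a‖ < 1) {z : ℂ} (hz : z ∈ 𝔻) :
    analyticOrderAt (fun z => (blaschkeMat a z).det) z = analyticOrderAt (quad (slicePt a)) z := by
  have h0 : analyticOrderAt (blaschkeDen a) z = 0 :=
    (analyticAt_of_disc (differentiable_blaschkeDen a).differentiableOn hz).analyticOrderAt_eq_zero.2
      (blaschkeDen_ne_zero ha hz)
  rw [← blaschkeNum_eq_quad, ← zero_add (analyticOrderAt (fun z => (blaschkeMat a z).det) z), ← h0,
    ← analyticOrderAt_mul (analyticAt_of_disc (differentiable_blaschkeDen a).differentiableOn hz)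
      (analyticAt_of_disc (isHol_blaschkeMat ha).det hz)]
  apply analyticOrderAt_congr
  filter_upwards [Metric.isOpen_ball.mem_nhds hz] with w hw
  rw [Pi.mul_apply, det_blaschkeMat ha hw, mul_div_cancel₀ _ (blaschkeDen_ne_zero ha hw)]

lemma order_det_facMat {N : ℕ∞} {a : ℕ → ℍ[ℝ]} (h : ∀ n : ℕ, (n : ℕ∞) < N → ‖a n‖ < 1) {z : ℂ}
    (hz : z ∈ 𝔻) (k : ℕ) :
    analyticOrderAt (fun z => (facMat N a k z).det) z = facOrd N (fun n => slicePt (a n)) z k := by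
  unfold facMat facOrd
  split_ifs with hk
  · exact order_det_blaschkeMat (h k hk) hz
  · rw [analyticOrderAt_eq_zero]
    right
    simp

lemma order_quad_ne_top (w z : ℂ) : analyticOrderAt (quad w) z ≠ ⊤ := by
  have : analyticOrderAt (quad w) z = analyticOrderAt (fun z => z - w) z
      + analyticOrderAt (fun z => z - conj w) z :=
    analyticOrderAt_mul (f := fun z => z - w) (g := fun z => z - conj w) (by fun_prop) (by fun_prop)
  have key : ∀ v, analyticOrderAt (fun z => z - v) z ≠ ⊤ := by
    intro v
    by_cases h : z = v
    · rw [h, order_sub_self]; simp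
    · rw [order_sub_of_ne h]; simp
  rw [this]
  exact WithTop.add_ne_top.2 ⟨key _, key _⟩

lemma one_le_order_quad (w : ℂ) : 1 ≤ analyticOrderAt (quad w) w :=
  one_le_order (by unfold quad; fun_prop) (by simp [quad])

/-- Extraction of finitely many Blaschke factors with prescribed spheres. -/
lemma exists_finite_factorization {N : ℕ∞} {w : ℕ → ℂ} (hw : ∀ j, w j ∈ 𝔻) (him : ∀ j, 0 ≤ (w j).im)
    (n : ℕ) : ∀ {A : ℂ → M2}, IsSymm A → IsHol A →
      (∀ z ∈ 𝔻, ∑ j ∈ Finset.range n, facOrd N w z j ≤ analyticOrderAt (fun z => (A z).det) z) →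
      ∃ (c : ℕ → ℍ[ℝ]) (H : ℂ → M2), (∀ j, slicePt (c j) = w j) ∧ IsSymm H ∧ IsHol H ∧
        ∀ z ∈ 𝔻, A z = H z * prodMat (facMat N c) n z := by
  induction n with
  | zero =>
    intro A hA hd _
    exact ⟨fun j => w j, A, fun j => slicePt_coe (him j), hA, hd,
      fun z _ => by simp [prodMat, seqProd]⟩
  | succ n ih =>
    intro A hA hd hord
    by_cases hn : (n : ℕ∞) < N
    · have h1 : (A (w n)).det = 0 := by
        have h2 := hord (w n) (hw n)
        rw [Finset.sum_range_succ] at h2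
        have h3 : 1 ≤ analyticOrderAt (fun z => (A z).det) (w n) := by
          refine le_trans ?_ (le_trans le_add_self h2)
          rw [facOrd, if_pos hn]
          exact one_le_order_quad _
        exact apply_eq_zero_of_analyticOrderAt_ne_zero (f := fun z => (A z).det) (Order.one_le_iff_ne_zero.1 h3)
      -- Factors come off on the right, so the last one is taken first; the cofactor keeps enough
      -- order for the earlier ones. All points found therefore depend on n.
      obtain ⟨cn, H1, hcn, hs, hh, hA1⟩ := exists_blaschke_factor hA hd (hw n) (him n) h1
      have hcn1 : ‖cn‖ < 1 := by rw [← norm_slicePt, hcn]; simpa using hw n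
      obtain ⟨c, H, hc, hs', hh', hH⟩ := ih hs hh (by
        intro z hz
        have h2 := hord z hz
        rw [Finset.sum_range_succ, facOrd, if_pos hn,
          order_det_mul hh (isHol_blaschkeMat hcn1) hA1 hz, order_det_blaschkeMat hcn1 hz, hcn] at h2
        exact (ENat.add_le_add_iff_right (order_quad_ne_top _ _)).1 h2)
      refine ⟨Function.update c n cn, H, ?_, hs', hh', ?_⟩
      · intro j
        by_cases hj : j = n
        · rw [hj, Function.update_self, hcn]
        · rw [Function.update_of_ne hj, hc]
      · intro z hz
        rw [hA1 z hz, hH z hz, mul_assoc]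
        congr 1
        rw [prodMat, prodMat, seqProd]
        congr 1
        · apply seqProd_congr
          intro i hi
          simp only [facMat, Function.update_of_ne hi.ne]
        · simp [facMat, hn]
    · obtain ⟨c, H, hc, hs', hh', hH⟩ := ih hA hd (by
        intro z hz
        refine le_trans ?_ (hord z hz)
        rw [Finset.sum_range_succ]
        exact le_self_add)
      refine ⟨c, H, hc, hs', hh', fun z hz => ?_⟩
      rw [hH z hz]
      simp [prodMat, seqProd, facMat, hn]

lemma continuous_slicePt : Continuous slicePt := by
  have : slicePt = fun q => (q.re : ℂ) + ‖q.im‖ * Complex.I := by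
    funext q
    apply Complex.ext <;> simp [slicePt]
  rw [this]
  have h1 : Continuous fun q : ℍ[ℝ] => q.re := Quaternion.continuous_re
  have h2 : Continuous fun q : ℍ[ℝ] => q.im := Quaternion.continuous_im
  fun_prop

/-- This compactness allows a limit of the points that depend on the number of extracted factors. -/
lemma isCompact_sphere (w : ℂ) : IsCompact {q : ℍ[ℝ] | slicePt q = w} := by
  have : ProperSpace ℍ[ℝ] := FiniteDimensional.proper ℝ _
  apply Metric.isCompact_of_isClosed_isBounded
  · exact isClosed_eq continuous_slicePt continuous_const
  · rw [isBounded_iff_forall_norm_le]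
    exact ⟨‖w‖, fun q hq => by rw [← norm_slicePt, hq]⟩

lemma continuous_quatMat : Continuous quatMat := by
  have h1 : Continuous fun q : ℍ[ℝ] => (⟨q.re, q.imI⟩ : ℂ) := fstQuat.continuous
  have h2 : Continuous fun q : ℍ[ℝ] => (⟨q.imJ, q.imK⟩ : ℂ) := sndQuat.continuous
  refine continuous_pi fun i => continuous_pi fun j => ?_
  fin_cases i <;> fin_cases j
  · exact h1
  · exact h2
  · exact (Complex.continuous_conj.comp h2).neg
  · exact Complex.continuous_conj.comp h1

/-- Joint continuity of Blaschke factors along a sphere. -/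
lemma tendsto_blaschkeMat {c : ℕ → ℍ[ℝ]} {a : ℍ[ℝ]} (hc : Filter.Tendsto c Filter.atTop (𝓝 a))
    (hs : ∀ n, slicePt (c n) = slicePt a) (ha : ‖a‖ < 1) {z : ℂ} (hz : z ∈ 𝔻) :
    Filter.Tendsto (fun y : ℕ × ℂ => blaschkeMat (c y.1) y.2) (Filter.atTop ×ˢ 𝓝 z)
      (𝓝 (blaschkeMat a z)) := by
  -- Along a sphere the modulus and the denominator are constant, so neither the case a = 0 nor the
  -- normalisation causes a discontinuity.
  have hn : ∀ n, ‖c n‖ = ‖a‖ := fun n => by rw [← norm_slicePt, hs, norm_slicePt]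
  have h2 : Filter.Tendsto (fun y : ℕ × ℂ => y.2) (Filter.atTop ×ˢ 𝓝 z) (𝓝 z) := Filter.tendsto_snd
  by_cases h0 : a = 0
  · have e : ∀ n, c n = 0 := fun n => by rw [← norm_eq_zero, hn, h0, norm_zero]
    simp only [e, h0, blaschkeMat, if_true]
    exact h2.smul_const _
  · have e : ∀ n, c n ≠ 0 := fun n => by rw [← norm_ne_zero_iff, hn]; simpa using h0
    have h1 : Filter.Tendsto (fun y : ℕ × ℂ => c y.1) (Filter.atTop ×ˢ 𝓝 z) (𝓝 a) :=
      hc.comp Filter.tendsto_fst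
    have hQ : Filter.Tendsto (fun y : ℕ × ℂ => quatMat (c y.1)) (Filter.atTop ×ˢ 𝓝 z)
      (𝓝 (quatMat a)) := (continuous_quatMat.tendsto _).comp h1
    have hQ' : Filter.Tendsto (fun y : ℕ × ℂ => quatMat (‖a‖⁻¹ • star (c y.1)))
        (Filter.atTop ×ˢ 𝓝 z) (𝓝 (quatMat (‖a‖⁻¹ • star a))) :=
      (continuous_quatMat.tendsto _).comp (h1.star.const_smul _)
    have hD : Filter.Tendsto (fun y : ℕ × ℂ => (blaschkeDen (c y.1) y.2)⁻¹)
        (Filter.atTop ×ˢ 𝓝 z) (𝓝 (blaschkeDen a z)⁻¹) := by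
      have : ∀ y : ℕ × ℂ, blaschkeDen (c y.1) y.2 = blaschkeDen a y.2 := fun y => by
        rw [blaschkeDen, hs, blaschkeDen]
      simp only [this]
      exact (((differentiable_blaschkeDen a).continuous.tendsto z).comp h2).inv₀
        (blaschkeDen_ne_zero ha hz)
    simp only [blaschkeMat, e, h0, if_false, hn]
    exact (hD.smul ((tendsto_const_nhds.sub (h2.smul hQ)).mul (hQ.sub (h2.smul_const _)))).mul hQ'

lemma tendsto_facMat {N : ℕ∞} {c : ℕ → ℕ → ℍ[ℝ]} {a : ℕ → ℍ[ℝ]}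
    (hc : Filter.Tendsto c Filter.atTop (𝓝 a))
    (hs : ∀ n j, slicePt (c n j) = slicePt (a j)) (ha : ∀ n : ℕ, (n : ℕ∞) < N → ‖a n‖ < 1)
    {z : ℂ} (hz : z ∈ 𝔻) (k : ℕ) :
    Filter.Tendsto (fun y : ℕ × ℂ => facMat N (c y.1) k y.2) (Filter.atTop ×ˢ 𝓝 z)
      (𝓝 (facMat N a k z)) := by
  unfold facMat
  split_ifs with h
  · exact tendsto_blaschkeMat ((continuous_apply k).tendsto a |>.comp hc) (fun n => hs n k) (ha k h) hz
  · exact tendsto_const_nhds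

lemma tendsto_prodMat {N : ℕ∞} {c : ℕ → ℕ → ℍ[ℝ]} {a : ℕ → ℍ[ℝ]}
    (hc : Filter.Tendsto c Filter.atTop (𝓝 a))
    (hs : ∀ n j, slicePt (c n j) = slicePt (a j)) (ha : ∀ n : ℕ, (n : ℕ∞) < N → ‖a n‖ < 1)
    {z : ℂ} (hz : z ∈ 𝔻) (k : ℕ) :
    Filter.Tendsto (fun y : ℕ × ℂ => prodMat (facMat N (c y.1)) k y.2) (Filter.atTop ×ˢ 𝓝 z)
      (𝓝 (prodMat (facMat N a) k z)) := by
  induction k with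
  | zero => exact tendsto_const_nhds
  | succ k ih => exact ih.mul (tendsto_facMat hc hs ha hz k)

lemma defect_congr {N : ℕ∞} {a c : ℕ → ℍ[ℝ]} (h : ∀ j, slicePt (c j) = slicePt (a j)) :
    defect N c = defect N a := by
  funext j
  rw [defect, defect, ← norm_slicePt (c j), h, norm_slicePt]

lemma BlaschkeSeq.congr {N : ℕ∞} {a c : ℕ → ℍ[ℝ]} (ha : BlaschkeSeq N a)
    (h : ∀ j, slicePt (c j) = slicePt (a j)) : BlaschkeSeq N c where
  lt_one n hn := by rw [← norm_slicePt, h, norm_slicePt]; exact ha.lt_one n hn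
  summable := by rw [defect_congr h]; exact ha.summable

/-- Convergence of growing partial products along a convergent sequence of zero sequences. -/
lemma tendsto_prodMat_diag {N : ℕ∞} {c : ℕ → ℕ → ℍ[ℝ]} {a : ℕ → ℍ[ℝ]} {m : ℕ → ℕ}
    (hm : Filter.Tendsto m Filter.atTop Filter.atTop) (hc : Filter.Tendsto c Filter.atTop (𝓝 a))
    (hs : ∀ n j, slicePt (c n j) = slicePt (a j)) (ha : BlaschkeSeq N a) {z : ℂ} (hz : z ∈ 𝔻) :
    Filter.Tendsto (fun y : ℕ × ℂ => prodMat (facMat N (c y.1)) (m y.1) y.2) (Filter.atTop ×ˢ 𝓝 z)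
      (𝓝 (limProd (facMat N a) z)) := by
  obtain ⟨r, hzr, hr⟩ := exists_between (show ‖z‖ < 1 by simpa using hz)
  set S := ∑' i, defect N a i
  set t : ℕ → ℝ := fun n => convConst r S * ∑' i, defect N a (n + i) with ht
  have ht0 : Filter.Tendsto t Filter.atTop (𝓝 0) := tendsto_tail _
  -- The defects depend only on the spheres, hence one tail bound serves all sequences c n at once.
  -- Inserting both infinite products leaves four terms, each below ε/4.
  have hb : ∀ n k y, ‖y‖ ≤ r →
      ‖prodMat (facMat N (c n)) k y - limProd (facMat N (c n)) y‖ ≤ t k := by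
    intro n k y hy
    have := (ha.congr (hs n)).nearOne.norm_sub_le hr hy k
    rwa [defect_congr (hs n)] at this
  refine Metric.tendsto_nhds.2 fun ε hε => ?_
  have h4 : ∀ᶠ n in Filter.atTop, t n < ε / 4 := ht0.eventually (gt_mem_nhds (by linarith))
  obtain ⟨k, hk⟩ := h4.exists
  have e1 : ∀ᶠ y : ℕ × ℂ in Filter.atTop ×ˢ 𝓝 z, t (m y.1) < ε / 4 :=
    Filter.tendsto_fst.eventually (hm.eventually h4)
  have e2 : ∀ᶠ y : ℕ × ℂ in Filter.atTop ×ˢ 𝓝 z, ‖y.2‖ < r :=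
    Filter.tendsto_snd.eventually ((continuous_norm.tendsto z).eventually (gt_mem_nhds hzr))
  have e3 := Metric.tendsto_nhds.1 (tendsto_prodMat hc hs ha.lt_one hz k) (ε / 4) (by linarith)
  filter_upwards [e1, e2, e3] with y h1 h2 h3
  have b1 := hb y.1 (m y.1) y.2 h2.le
  have b2 := hb y.1 k y.2 h2.le
  have b3 := ha.nearOne.norm_sub_le hr hzr.le k
  rw [← dist_eq_norm] at b1 b2 b3
  calc _ ≤ dist (prodMat (facMat N (c y.1)) (m y.1) y.2) (limProd (facMat N (c y.1)) y.2)
        + dist (limProd (facMat N (c y.1)) y.2) (prodMat (facMat N (c y.1)) k y.2)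
        + (dist (prodMat (facMat N (c y.1)) k y.2) (prodMat (facMat N a) k z)
        + dist (prodMat (facMat N a) k z) (limProd (facMat N a) z)) :=
        (dist_triangle _ (prodMat (facMat N (c y.1)) k y.2) _).trans
          (add_le_add (dist_triangle _ _ _) (dist_triangle _ _ _))
    _ < ε := by
      rw [dist_comm (limProd _ _)]
      have : t k < ε / 4 := hk
      linarith

/-- Extraction of an infinite Blaschke product with prescribed spheres. -/
theorem exists_factorization {N : ℕ∞} {w : ℕ → ℂ} (hw : ∀ j, w j ∈ 𝔻) (him : ∀ j, 0 ≤ (w j).im)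
    (hsum : BlaschkeSeq N fun j => (w j : ℍ[ℝ])) {A : ℂ → M2} (hA : IsSymm A) (hd : IsHol A)
    (hord : ∀ n, ∀ z ∈ 𝔻, ∑ j ∈ Finset.range n, facOrd N w z j
      ≤ analyticOrderAt (fun z => (A z).det) z) :
    ∃ (c : ℕ → ℍ[ℝ]) (H : ℂ → M2), (∀ j, slicePt (c j) = w j) ∧ IsSymm H ∧ IsHol H ∧
      ∀ z ∈ 𝔻, A z = H z * limProd (facMat N c) z := by
  choose c H hc hHs hHd hH using fun n => exists_finite_factorization hw him n hA hd (hord n)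
  -- Tychonoff: the sequences of points found for each n lie in a product of compact spheres.
  obtain ⟨a, ha, φ, hφ, hlim⟩ := (isCompact_univ_pi fun j => isCompact_sphere (w j)).tendsto_subseq
    (x := c) (fun n j _ => hc n j)
  have ha' : ∀ j, slicePt (a j) = w j := fun j => ha j trivial
  have hs : ∀ n j, slicePt (c n j) = slicePt (a j) := fun n j => by rw [hc, ha']
  have hBa : BlaschkeSeq N a := hsum.congr fun j => by rw [slicePt_coe (him j), ha']
  have hBc : ∀ n, BlaschkeSeq N (c n) := fun n => hBa.congr (hs n)
  set L := limProd (facMat N a) with hL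
  have hLd : IsHol L := hBa.nearOne.isHol_limProd
  have hLs : IsSymm L := hBa.nearOne.isSymm_limProd (isSymm_facMat N a)
  have hfin : ∀ z ∈ 𝔻, ∀ᶠ n in Filter.atTop, analyticOrderAt (fun z => (L z).det) z =
      ∑ j ∈ Finset.range n, facOrd N w z j := by
    intro z hz
    filter_upwards [hBa.nearOne.order_det_limProd hz] with n hn
    rw [hn]
    refine Finset.sum_congr rfl fun j _ => ?_
    rw [order_det_facMat hBa.lt_one hz]
    simp only [ha']
  have htop : ∀ z ∈ 𝔻, analyticOrderAt (fun z => (L z).det) z ≠ ⊤ := by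
    intro z hz
    obtain ⟨n, hn⟩ := (hfin z hz).exists
    rw [hn]
    refine (WithTop.sum_ne_top).2 fun j _ => ?_
    unfold facOrd
    split_ifs
    · exact order_quad_ne_top _ _
    · exact ENat.natCast_ne_top 0
  have hL0 : ∃ z ∈ 𝔻, (L z).det ≠ 0 := by
    by_contra hcon
    push Not at hcon
    refine htop 0 (Metric.mem_ball_self one_pos) (analyticOrderAt_eq_top.2 ?_)
    filter_upwards [Metric.isOpen_ball.mem_nhds (Metric.mem_ball_self one_pos)] with z hz
    exact hcon z hz
  -- Nothing is known about convergence of the cofactors H, so divisibility is expressed without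
  -- them: A · adj P has entries divisible by det P, and it converges to A · adj L.
  set G : ℕ → ℂ → M2 := fun n z => A z * (prodMat (facMat N (c (φ n))) (φ n) z).adjugate with hG
  have hGd : ∀ n, IsHol (G n) := fun n =>
    hd.mul (isHol_prodMat (hBc (φ n)).nearOne.hol (φ n)).adjugate
  have hGH : ∀ n, ∀ z ∈ 𝔻, G n z = (prodMat (facMat N (c (φ n))) (φ n) z).det • H (φ n) z := by
    intro n z hz
    rw [hG]
    simp only
    rw [hH (φ n) z hz, mul_assoc, Matrix.mul_adjugate, mul_smul_comm, mul_one]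
  have hlimG : ∀ i j, TendstoLocallyUniformlyOn (fun n z => G n z i j)
      (fun z => (A z * (L z).adjugate) i j) Filter.atTop 𝔻 := by
    intro i j
    rw [Metric.isOpen_ball.tendstoLocallyUniformlyOn_iff_forall_tendsto]
    intro z hz
    have hAz : Filter.Tendsto A (𝓝 z) (𝓝 (A z)) :=
      hd.continuousOn.continuousAt (Metric.isOpen_ball.mem_nhds hz)
    have hLz : Filter.Tendsto L (𝓝 z) (𝓝 (L z)) :=
      hLd.continuousOn.continuousAt (Metric.isOpen_ball.mem_nhds hz)
    have t1 : Filter.Tendsto (fun y : ℕ × ℂ => (A y.2 * (L y.2).adjugate) i j)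
        (Filter.atTop ×ˢ 𝓝 z) (𝓝 ((A z * (L z).adjugate) i j)) :=
      tendsto_mul_adjugate_apply (hAz.comp Filter.tendsto_snd) (hLz.comp Filter.tendsto_snd) i j
    have t2 : Filter.Tendsto (fun y : ℕ × ℂ => G y.1 y.2 i j)
        (Filter.atTop ×ˢ 𝓝 z) (𝓝 ((A z * (L z).adjugate) i j)) :=
      tendsto_mul_adjugate_apply (hAz.comp Filter.tendsto_snd)
        (tendsto_prodMat_diag hφ.tendsto_atTop hlim (fun n => hs (φ n)) hBa hz) i j
    have := t1.prodMk_nhds t2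
    exact this.mono_right (nhds_le_uniformity _)
  -- At a fixed z, the determinants of the finite products eventually have the same order as det L,
  -- since orders depend only on the spheres. So the entries of the limit A · adj L vanish at least
  -- to that order and det L divides them.
  obtain ⟨K, hK1, hK2, hK3⟩ := exists_eq_smul hLd.det hL0 (fun z => det_conj hLs z)
    (hA.mul hLs.adjugate) (hd.mul hLd.adjugate) (by
      intro z hz i j
      obtain ⟨k, hk⟩ := ENat.ne_top_iff_exists.1 (htop z hz)
      rw [← hk]
      apply le_order_of_tendsto (hlimG i j) (fun n => hGd n i j) hz
      filter_upwards [hφ.tendsto_atTop.eventually (hfin z hz)] with n hn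
      have e : (fun z => G n z i j) =ᶠ[𝓝 z]
          (fun z => (prodMat (facMat N (c (φ n))) (φ n) z).det) * fun z => H (φ n) z i j := by
        filter_upwards [Metric.isOpen_ball.mem_nhds hz] with y hy
        rw [hGH n y hy]
        rfl
      rw [analyticOrderAt_congr e, analyticOrderAt_mul
        (analyticAt_of_disc (isHol_prodMat (hBc (φ n)).nearOne.hol (φ n)).det hz)
        (analyticAt_of_disc (hHd (φ n) i j) hz),
        order_det_prodMat (hBc (φ n)).nearOne.hol (φ n) hz, hk, hn]
      refine le_trans (le_of_eq ?_) le_self_add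
      refine Finset.sum_congr rfl fun j _ => ?_
      rw [order_det_facMat (hBc (φ n)).lt_one hz]
      simp only [hc])
  refine ⟨a, K, ha', hK1, hK2, ?_⟩
  -- Multiplying A · adj L = det L · K by L on the right gives det L · A = det L · K L.
  apply mul_left_cancel_mat hLd.det hL0 hd (hK2.mul hLd)
  intro z hz
  rw [← smul_mul_assoc, ← hK3 z hz, mul_assoc, Matrix.adjugate_mul, mul_smul_comm, mul_one]

end QuatHardy

end

/-! ### Spherical and isolated multiplicities. -/

noncomputable section

namespace QuatHardy

local notation "conj" => starRingEnd ℂ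
local notation "𝔻" => Metric.ball (0 : ℂ) 1

lemma order_mul_disc {F G : ℂ → ℂ} (hF : DifferentiableOn ℂ F 𝔻) (hG : DifferentiableOn ℂ G 𝔻)
    {H : ℂ → ℂ} (h : ∀ z ∈ 𝔻, H z = F z * G z) {z : ℂ} (hz : z ∈ 𝔻) :
    analyticOrderAt H z = analyticOrderAt F z + analyticOrderAt G z := by
  rw [← analyticOrderAt_mul (analyticAt_of_disc hF hz) (analyticAt_of_disc hG hz)]
  apply analyticOrderAt_congr
  filter_upwards [Metric.isOpen_ball.mem_nhds hz] with w hw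
  exact h w hw

lemma order_sub_pow_self (w : ℂ) (n : ℕ) : analyticOrderAt (fun z => (z - w) ^ n) w = n := by
  have := analyticOrderAt_pow (f := fun z => z - w) (z₀ := w) (by fun_prop) n
  rw [order_sub_self, nsmul_one] at this
  exact this

lemma order_sub_pow_of_ne {w z : ℂ} (h : z ≠ w) (n : ℕ) :
    analyticOrderAt (fun z => (z - w) ^ n) z = 0 :=
  (AnalyticAt.analyticOrderAt_eq_zero (by fun_prop)).2 (pow_ne_zero _ (sub_ne_zero.2 h))

lemma exists_sub_pow_ne_zero (w : ℂ) (n : ℕ) : ∃ z ∈ 𝔻, (z - w) ^ n ≠ 0 := by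
  obtain ⟨z, hz, h, _⟩ := exists_ne_two w w
  exact ⟨z, hz, pow_ne_zero _ (sub_ne_zero.2 h)⟩

lemma order_le_conj_conj {F : ℂ → ℂ} (hF : DifferentiableOn ℂ F 𝔻) {z : ℂ} (hz : z ∈ 𝔻) :
    analyticOrderAt F (conj z) ≤ analyticOrderAt (fun z => conj (F (conj z))) z := by
  refine ENat.forall_natCast_le_iff_le.1 fun n hn => ?_
  obtain ⟨k, hk, hFk⟩ := exists_eq_mul (s := fun w => (w - conj z) ^ n) (by fun_prop)
    (exists_sub_pow_ne_zero _ _) hF (by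
      intro w hw
      by_cases h : w = conj z
      · rw [h, order_sub_pow_self]; exact hn
      · rw [order_sub_pow_of_ne h]; exact zero_le)
  rw [order_mul_disc (F := fun w => (w - z) ^ n) (by fun_prop) (differentiableOn_conj_conj hk)
    (fun w hw => by rw [hFk _ (conj_mem_disc hw)]; simp) hz, order_sub_pow_self]
  exact le_self_add

lemma order_conj_conj {F : ℂ → ℂ} (hF : DifferentiableOn ℂ F 𝔻) {z : ℂ} (hz : z ∈ 𝔻) :
    analyticOrderAt (fun z => conj (F (conj z))) z = analyticOrderAt F (conj z) := by
  apply le_antisymm _ (order_le_conj_conj hF hz)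
  have h := order_le_conj_conj (differentiableOn_conj_conj hF) (conj_mem_disc hz)
  simpa using h

/-- The largest order to which all entries of `A` vanish at `z`. -/
def matOrd (A : ℂ → M2) (z : ℂ) : ℕ∞ := ⨅ i, ⨅ j, analyticOrderAt (fun z => A z i j) z

lemma matOrd_le (A : ℂ → M2) (z : ℂ) (i j : Fin 2) : matOrd A z ≤ analyticOrderAt (fun z => A z i j) z :=
  (iInf_le _ i).trans (iInf_le _ j)

/-- The symmetry permutes the entries up to sign and conjugation, neither of which affects orders.
-/
lemma matOrd_eq {A : ℂ → M2} (hA : IsSymm A) (hd : IsHol A) {z : ℂ} (hz : z ∈ 𝔻) :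
    matOrd A (conj z) = matOrd A z := by
  have key : ∀ z ∈ 𝔻, matOrd A z ≤ matOrd A (conj z) := by
    intro z hz
    refine le_iInf fun i => le_iInf fun j => ?_
    rw [← order_conj_conj (hd i j) hz]
    simp only [hA _]
    fin_cases i <;> fin_cases j
    · have e : (fun z => conj (quatConj (A z) 0 0)) = fun z => A z 1 1 := by
        funext z; simp [quatConj]
      exact (matOrd_le A z 1 1).trans_eq (congrArg (analyticOrderAt · z) e.symm)
    · have e : (fun z => conj (quatConj (A z) 0 1)) = -fun z => A z 1 0 := by
        funext z; simp [quatConj]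
      refine (matOrd_le A z 1 0).trans_eq ?_
      rw [← analyticOrderAt_neg]
      exact (congrArg (analyticOrderAt · z) e.symm)
    · have e : (fun z => conj (quatConj (A z) 1 0)) = -fun z => A z 0 1 := by
        funext z; simp [quatConj]
      refine (matOrd_le A z 0 1).trans_eq ?_
      rw [← analyticOrderAt_neg]
      exact (congrArg (analyticOrderAt · z) e.symm)
    · have e : (fun z => conj (quatConj (A z) 1 1)) = fun z => A z 0 0 := by
        funext z; simp [quatConj]
      exact (matOrd_le A z 0 0).trans_eq (congrArg (analyticOrderAt · z) e.symm)
  apply le_antisymm _ (key z hz)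
  simpa using key _ (conj_mem_disc hz)

/-- The matrix function of `linearProduct`. -/
def listMat : List ℍ[ℝ] → ℂ → M2
  | [] => fun _ => 1
  | p :: ps => fun z => (z • 1 - quatMat p) * listMat ps z

lemma toMat_linearProduct (ps : List ℍ[ℝ]) : toMat (linearProduct ps) = listMat ps := by
  induction ps with
  | nil =>
    rw [linearProduct, ← ofMat_one_eq, toMat_ofMat isSymm_one]
    rfl
  | cons p ps ih =>
    rw [linearProduct, toMat_starMul, toMat_sub_const, ih]
    rfl

lemma isSymm_listMat (ps : List ℍ[ℝ]) : IsSymm (listMat ps) := by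
  rw [← toMat_linearProduct]; exact isSymm_toMat _

lemma isHol_linear (p : ℍ[ℝ]) : IsHol fun z => z • 1 - quatMat p :=
  (isHol_smul_const 1).sub (isHol_const _)

lemma order_quad_self {w : ℂ} (hw : 0 < w.im) : analyticOrderAt (quad w) w = 1 := by
  have hcw : w ≠ conj w := fun h => hw.ne' (Complex.conj_eq_iff_im.1 h.symm)
  have : analyticOrderAt (quad w) w = analyticOrderAt (fun z => z - w) w
      + analyticOrderAt (fun z => z - conj w) w :=
    analyticOrderAt_mul (f := fun z => z - w) (g := fun z => z - conj w) (by fun_prop) (by fun_prop)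
  rw [this, order_sub_self, order_sub_of_ne hcw, add_zero]

lemma order_quad_conj {w : ℂ} (hw : 0 < w.im) : analyticOrderAt (quad w) (conj w) = 1 := by
  have hcw : conj w ≠ w := fun h => hw.ne' (Complex.conj_eq_iff_im.1 h)
  have : analyticOrderAt (quad w) (conj w) = analyticOrderAt (fun z => z - w) (conj w)
      + analyticOrderAt (fun z => z - conj w) (conj w) :=
    analyticOrderAt_mul (f := fun z => z - w) (g := fun z => z - conj w) (by fun_prop) (by fun_prop)
  rw [this, order_sub_self, order_sub_of_ne hcw, zero_add]

lemma order_quad_real {w : ℂ} (hw : w.im = 0) : analyticOrderAt (quad w) w = 2 := by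
  have hcw : conj w = w := Complex.conj_eq_iff_im.2 hw
  have : quad w = fun z => (z - w) ^ 2 := by funext z; rw [quad, hcw, pow_two]
  rw [this, order_sub_pow_self]; rfl

lemma order_quad_of_ne {w z : ℂ} (h1 : z ≠ w) (h2 : z ≠ conj w) : analyticOrderAt (quad w) z = 0 :=
  (AnalyticAt.analyticOrderAt_eq_zero (by unfold quad; fun_prop)).2
    (mul_ne_zero (sub_ne_zero.2 h1) (sub_ne_zero.2 h2))

lemma differentiable_quad (w : ℂ) : Differentiable ℂ (quad w) := by unfold quad; fun_prop

/-- The definition of multiplicity wants linear factors on the left. The adjugate reverses products,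
so they come from right extraction applied to adj A, and each lowers the order of the determinant by
one. -/
lemma exists_linear_product {w : ℂ} (hw : w ∈ 𝔻) (him : 0 < w.im) (n : ℕ) : ∀ {A : ℂ → M2},
    IsSymm A → IsHol A → A w ≠ 0 → analyticOrderAt (fun z => (A z).det) w = n →
    ∃ (ps : List ℍ[ℝ]) (K : ℂ → M2), ps.length = n ∧ (∀ p ∈ ps, slicePt p = w) ∧
      ps.IsChain (fun p p' => p ≠ star p') ∧ IsSymm K ∧ IsHol K ∧ (K w).det ≠ 0 ∧
      ∀ z ∈ 𝔻, A z = listMat ps z * K z := by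
  induction n with
  | zero =>
    intro A hA hd _ hord
    refine ⟨[], A, rfl, by simp, List.isChain_nil, hA, hd, ?_, fun z _ => (one_mul _).symm⟩
    exact (analyticAt_of_disc hd.det hw).analyticOrderAt_eq_zero.1 (by simpa using hord)
  | succ n ih =>
    intro A hA hd hAw hord
    have hdet : (A w).det = 0 :=
      apply_eq_zero_of_analyticOrderAt_ne_zero (f := fun z => (A z).det) (by rw [hord]; simp)
    have hdet' : (A w).adjugate.det = 0 := by
      rw [Matrix.det_adjugate, hdet]; simp
    obtain ⟨c, H, hc, hHs, hHd, hH⟩ := exists_linear_factor hA.adjugate hd.adjugate hw him.le hdet'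
    set A1 : ℂ → M2 := fun z => - (H z).adjugate with hA1
    have hA1s : IsSymm A1 := hHs.adjugate.neg
    have hA1d : IsHol A1 := fun i j => (hHd.adjugate i j).neg
    have hfac : ∀ z ∈ 𝔻, A z = (z • 1 - quatMat (star c)) * A1 z := by
      intro z hz
      have h1 := congrArg Matrix.adjugate (hH z hz)
      have h2 : ((A z).adjugate).adjugate = A z := by
        simp only [Matrix.adjugate_fin_two]
        ext i j
        fin_cases i <;> fin_cases j <;> simp
      rw [h2, Matrix.adjugate_mul_distrib] at h1
      rw [h1, hA1, mul_neg, ← neg_mul, ← adjugate_smul_one_sub]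
      congr 1
      simp only [Matrix.adjugate_fin_two]
      ext i j
      fin_cases i <;> fin_cases j <;> simp
    have hA1w : A1 w ≠ 0 := by
      intro h
      apply hAw
      rw [hfac w hw, h, mul_zero]
    have hord1 : analyticOrderAt (fun z => (A1 z).det) w = n := by
      have h1 := order_det_mul (isHol_linear (star c)) hA1d hfac hw
      have h2 : (fun z : ℂ => (z • 1 - quatMat (star c)).det) = quad w := by
        funext z
        rw [det_smul_one_sub, blaschkeNum_star, blaschkeNum_eq_quad, hc]
      rw [hord, h2, order_quad_self him, add_comm] at h1
      push_cast at h1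
      exact (ENat.add_right_injective_of_ne_top (by simp) h1).symm
    obtain ⟨ps, K, hlen, hps, hchain, hKs, hKd, hK0, hK⟩ := ih hA1s hA1d hA1w hord1
    refine ⟨star c :: ps, K, by simp [hlen], ?_, ?_, hKs, hKd, hK0, ?_⟩
    · intro p hp
      rcases List.mem_cons.1 hp with rfl | hp
      · rw [slicePt_star, hc]
      · exact hps p hp
    · cases ps with
      | nil => exact List.isChain_singleton _
      | cons p' ps =>
        refine List.isChain_cons_cons.2 ⟨?_, hchain⟩
        -- Two consecutive conjugate points would multiply to the scalar `quad w`, which vanishes at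
        -- w, against A(w) ≠ 0.
        intro h
        apply hAw
        rw [star_inj] at h
        rw [hfac w hw, hK w hw, listMat, h, ← mul_assoc, ← mul_assoc]
        have : (w • 1 - quatMat (star p')) * (w • 1 - quatMat p') = 0 := by
          rw [← adjugate_smul_one_sub, Matrix.adjugate_mul, det_smul_one_sub, blaschkeNum_eq_quad,
            ← h, hc]
          simp [quad]
        rw [this, zero_mul, zero_mul]
    · intro z hz
      rw [hfac z hz, hK z hz, listMat, mul_assoc]

lemma exists_eq_smul_matOrd {A : ℂ → M2} (hA : IsSymm A) (hd : IsHol A) {w : ℂ} (hw : w ∈ 𝔻)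
    {s : ℂ → ℂ} (hs : Differentiable ℂ s) (hsc : ∀ z, s (conj z) = conj (s z))
    (h0 : ∃ z ∈ 𝔻, s z ≠ 0) (h1 : analyticOrderAt s w = matOrd A w)
    (h2 : analyticOrderAt s (conj w) = matOrd A w)
    (h3 : ∀ z, z ≠ w → z ≠ conj w → analyticOrderAt s z = 0) :
    ∃ K : ℂ → M2, IsSymm K ∧ IsHol K ∧ (∀ z ∈ 𝔻, A z = s z • K z) ∧ K w ≠ 0 := by
  obtain ⟨K, hK1, hK2, hK3⟩ := exists_eq_smul hs.differentiableOn h0 hsc hA hd (by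
    intro z hz i j
    by_cases e1 : z = w
    · rw [e1, h1]; exact matOrd_le _ _ _ _
    · by_cases e2 : z = conj w
      · rw [e2, h2, ← matOrd_eq hA hd hw]; exact matOrd_le _ _ _ _
      · rw [h3 z e1 e2]; exact zero_le)
  refine ⟨K, hK1, hK2, hK3, fun hK0 => ?_⟩
  -- If K(w) were zero, every entry of A would vanish to one order more.
  have : matOrd A w + 1 ≤ matOrd A w := by
    refine le_iInf fun i => le_iInf fun j => ?_
    rw [order_mul_disc hs.differentiableOn (hK2 i j)
      (H := fun z => A z i j) (fun z hz => by rw [hK3 z hz]; rfl) hw, h1]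
    gcongr
    exact one_le_order (analyticAt_of_disc (hK2 i j) hw) (congrFun (congrFun hK0 i) j)
  rw [← h1] at this
  have htop := order_ne_top hs.differentiableOn h0 hw
  exact absurd this (not_le.2 (ENat.lt_add_one_iff htop |>.2 le_rfl))

lemma mem_disc_mk {x y : ℝ} (h : x ^ 2 + y ^ 2 < 1) : (⟨x, |y|⟩ : ℂ) ∈ 𝔻 := by
  rw [mem_ball_zero_iff, Complex.norm_eq_sqrt_sq_add_sq, Real.sqrt_lt' one_pos]
  simpa using h

lemma IsSliceRegular.hasMultiplicities {f : ℍ[ℝ] → ℍ[ℝ]} (hf : IsSliceRegular f) {x y : ℝ}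
    (hxy : x ^ 2 + y ^ 2 < 1) (hy : y ≠ 0) {m n : ℕ} (hm : matOrd (toMat f) ⟨x, |y|⟩ = m)
    (hn : analyticOrderAt (fun z => (toMat f z).det) ⟨x, |y|⟩ = 2 * m + n) :
    HasMultiplicities f x y m n := by
  set w : ℂ := ⟨x, |y|⟩ with hw
  have hwd : w ∈ 𝔻 := mem_disc_mk hxy
  have him : 0 < w.im := abs_pos.2 hy
  have hqa : ∀ z, AnalyticAt ℂ (quad w) z := fun z => by unfold quad; fun_prop
  have hqo : ∀ z, analyticOrderAt (fun z => quad w z ^ m) z = m • analyticOrderAt (quad w) z := fun z =>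
    analyticOrderAt_pow (hqa z) m
  obtain ⟨K, hKs, hKd, hAK, hK0⟩ := exists_eq_smul_matOrd (isSymm_toMat f) hf.isHol hwd
    (s := fun z => quad w z ^ m) ((differentiable_quad w).pow m) (by intro z; simp [quad, mul_comm])
    (by obtain ⟨z, hz, h1, h2⟩ := exists_ne_two w (conj w)
        exact ⟨z, hz, pow_ne_zero _ (mul_ne_zero (sub_ne_zero.2 h1) (sub_ne_zero.2 h2))⟩)
    (by rw [hqo, order_quad_self him, hm]; simp)
    (by rw [hqo, order_quad_conj him, hm]; simp)
    (by intro z h1 h2; rw [hqo, order_quad_of_ne h1 h2]; simp)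
  -- A scalar enters a 2 × 2 determinant squared, so dividing by the m-th power of `quad w` removes
  -- exactly 2m.
  have hord : analyticOrderAt (fun z => (K z).det) w = n := by
    have h1 : analyticOrderAt (fun z => (toMat f z).det) w
        = analyticOrderAt (fun z => quad w z ^ (m * 2)) w + analyticOrderAt (fun z => (K z).det) w :=
      order_mul_disc (F := fun z => quad w z ^ (m * 2))
        ((differentiable_quad w).pow _).differentiableOn hKd.det (fun z hz => by
        rw [hAK z hz, Matrix.det_smul, Fintype.card_fin, pow_mul]) hwd
    have h2 : analyticOrderAt (fun z => quad w z ^ (m * 2)) w = ((2 * m : ℕ) : ℕ∞) := by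
      have := analyticOrderAt_pow (hqa w) (m * 2)
      rw [order_quad_self him, nsmul_one, mul_comm m] at this
      rw [mul_comm m]
      exact this
    rw [hn, h2] at h1
    push_cast at h1
    exact (ENat.add_right_injective_of_ne_top (ENat.natCast_ne_top (2 * m))
      (by push_cast; exact h1)).symm
  obtain ⟨ps, k, hlen, hps, hchain, hks, hkd, hk0, hk⟩ :=
    exists_linear_product hwd him n hKs hKd hK0 hord
  refine Or.inl ⟨hy, ps, ofMat k, hlen, fun p hp => sphereAt_iff.2 (hps p hp), hchain,
    isSliceRegular_ofMat hks hkd, fun q hq => ofMat_ne_zero hks ?_, fun q hq => ?_⟩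
  · rw [sphereAt_iff.1 hq]; exact hk0
  · have hz : slicePt q ∈ 𝔻 := by rw [mem_ball_zero_iff, norm_slicePt]; exact hq
    have hsy : IsSymm fun z => listMat ps z * k z := (isSymm_listMat ps).mul hks
    rw [starMul_eq, toMat_linearProduct, toMat_ofMat hks, ← ofMat_poly_smul hsy, hf.eq_ofMat hq]
    apply ofMat_congr (isSymm_toMat f) (IsSymm.smul (s := fun z => ((z - x) ^ 2 + (y ^ 2 : ℝ)) ^ m)
      (by intro z; simp) hsy)
    rw [hAK _ hz, hk _ hz]
    congr 2
    rw [quad]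
    have e1 : w + conj w = 2 * x := by apply Complex.ext <;> simp [hw]; ring
    have e2 : w * conj w = x ^ 2 + (y ^ 2 : ℝ) := by
      rw [Complex.mul_conj, Complex.normSq_mk]
      push_cast
      rw [← pow_two, ← pow_two, ← Complex.ofReal_pow |y|, sq_abs]
      push_cast
      ring
    linear_combination -slicePt q * e1 + e2

lemma IsSliceRegular.hasMultiplicities_real {f : ℍ[ℝ] → ℍ[ℝ]} (hf : IsSliceRegular f) {x : ℝ}
    (hx : (x : ℂ) ∈ 𝔻) {n : ℕ} (hn : matOrd (toMat f) x = n) :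
    HasMultiplicities f x 0 0 n ∧ analyticOrderAt (fun z => (toMat f z).det) x = 2 * n := by
  obtain ⟨K, hKs, hKd, hAK, hK0⟩ := exists_eq_smul_matOrd (isSymm_toMat f) hf.isHol hx
    (s := fun z => (z - x) ^ n) (by fun_prop) (by intro z; simp) (exists_sub_pow_ne_zero _ _)
    (by rw [order_sub_pow_self, hn])
    (by rw [Complex.conj_ofReal, order_sub_pow_self, hn])
    (by intro z h1 _; exact order_sub_pow_of_ne h1 n)
  -- At a real point K ≠ 0 already means det K ≠ 0, so the order of the determinant is exactly 2n.
  have hdet : (K x).det ≠ 0 := fun h => hK0 (eq_zero_of_det_eq_zero_of_real hKs (by simp) h)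
  constructor
  · refine Or.inr ⟨rfl, rfl, ofMat K, isSliceRegular_ofMat hKs hKd, ?_, fun q hq => ?_⟩
    · have hsx : (K (slicePt (x : ℍ[ℝ]))).det ≠ 0 := by
        have : slicePt (x : ℍ[ℝ]) = x := by apply Complex.ext <;> simp [slicePt]
        rwa [this]
      exact ofMat_ne_zero hKs hsx
    · have hz : slicePt q ∈ 𝔻 := by rw [mem_ball_zero_iff, norm_slicePt]; exact hq
      rw [← ofMat_linear_smul hKs, hf.eq_ofMat hq]
      exact ofMat_congr (isSymm_toMat f) (IsSymm.smul (s := fun z => (z - x) ^ n)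
        (by intro z; simp) hKs) (hAK _ hz)
  · rw [order_mul_disc (F := fun z => (z - x) ^ (n * 2)) (by fun_prop) hKd.det (fun z hz => by
        rw [hAK z hz, Matrix.det_smul, Fintype.card_fin, pow_mul]) hx, order_sub_pow_self,
      (analyticAt_of_disc hKd.det hx).analyticOrderAt_eq_zero.2 hdet, add_zero]
    push_cast
    ring

end QuatHardy

end

/-! ### Hardy means, Jensen's formula and the Blaschke condition. -/

noncomputable section

namespace QuatHardy

local notation "conj" => starRingEnd ℂ
local notation "𝔻" => Metric.ball (0 : ℂ) 1

lemma eventually_mem_Ioo : ∀ᶠ r : ℝ in 𝓝[<] 1, r ∈ Set.Ioo 0 1 :=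
  Ioo_mem_nhdsLT one_pos

lemma slicePoint_polar {J : ℍ[ℝ]} (hJ : J ∈ imagUnits) (r θ : ℝ) :
    ‖slicePoint J (r * Real.cos θ) (r * Real.sin θ)‖ = |r| := by
  have h := slicePoint_mem_unitBall hJ ⟨r * Real.cos θ, r * Real.sin θ⟩
  rw [h, Complex.norm_eq_sqrt_sq_add_sq, ← Real.sqrt_sq_eq_abs]
  congr 1
  simp only
  nlinarith [Real.sin_sq_add_cos_sq θ]

/-- The integral means of a Hardy function are bounded. -/
lemma MemHardy.exists_bound {p : ℝ≥0∞} (hp : 0 < p) {f : ℍ[ℝ] → ℍ[ℝ]} (hf : MemHardy p f) :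
    ∃ s : ℝ, 0 < s ∧ ∃ C : ℝ≥0∞, C ≠ ⊤ ∧ ∀ J ∈ imagUnits, ∀ᶠ r : ℝ in 𝓝[<] 1,
      ∫⁻ θ in Set.Ioc 0 (2 * Real.pi),
        ‖f (slicePoint J (r * Real.cos θ) (r * Real.sin θ))‖ₑ ^ s ≤ C := by
  have hM := hf.2
  unfold hardyNorm at hM
  split_ifs at hM with h
  -- For p = ∞ any exponent would do; s = 1 gives the bound sup |f| · 2π.
  · refine ⟨1, one_pos, _, ENNReal.mul_ne_top hM.ne (ENNReal.ofReal_ne_top (r := 2 * Real.pi - 0)),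
      fun J hJ => ?_⟩
    filter_upwards [eventually_mem_Ioo] with r hr
    rw [← Real.volume_Ioc, ← MeasureTheory.setLIntegral_const]
    refine MeasureTheory.lintegral_mono fun θ => ?_
    simp only [ENNReal.rpow_one]
    refine le_iSup₂ (f := fun q (_ : q ∈ unitBall) => ‖f q‖ₑ)
      (slicePoint J (r * Real.cos θ) (r * Real.sin θ)) ?_
    change ‖_‖ < 1
    rw [slicePoint_polar hJ, abs_of_pos hr.1]
    exact hr.2
  · have hs : 0 < p.toReal := ENNReal.toReal_pos hp.ne' h
    set M := ⨆ I ∈ imagUnits, Filter.limsup (fun r : ℝ => integralMean p.toReal f I r) (𝓝[<] 1)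
    set k := ENNReal.ofReal (1 / (2 * Real.pi)) with hk
    have hk0 : k ≠ 0 := by
      rw [hk, ne_eq, ENNReal.ofReal_eq_zero, not_le]
      positivity
    -- The constant undoes the p-th root and the factor 1/2π; M + 1 lies strictly above the upper
    -- limit, so the means stay below it near r = 1.
    refine ⟨p.toReal, hs, k⁻¹ * (M + 1) ^ p.toReal, ?_, fun J hJ => ?_⟩
    · exact ENNReal.mul_ne_top (ENNReal.inv_ne_top.2 hk0)
        (ENNReal.rpow_ne_top_of_nonneg hs.le (ENNReal.add_ne_top.2 ⟨hM.ne, ENNReal.one_ne_top⟩))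
    · have h1 : Filter.limsup (fun r : ℝ => integralMean p.toReal f J r) (𝓝[<] 1) < M + 1 :=
        lt_of_le_of_lt (le_iSup₂ (f := fun I (_ : I ∈ imagUnits) =>
          Filter.limsup (fun r : ℝ => integralMean p.toReal f I r) (𝓝[<] 1)) J hJ)
          (ENNReal.lt_add_right hM.ne one_ne_zero)
      filter_upwards [Filter.eventually_lt_of_limsup_lt h1] with r hr
      have h2 := ENNReal.rpow_le_rpow hr.le hs.le
      rw [integralMean, ← ENNReal.rpow_mul, one_div_mul_cancel hs.ne', ENNReal.rpow_one] at h2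
      rw [mul_comm k⁻¹, ← div_eq_mul_inv, ENNReal.le_div_iff_mul_le (Or.inl hk0)
        (Or.inl ENNReal.ofReal_ne_top), mul_comm]
      exact h2

lemma IsSliceRegular.continuousOn_coe {f : ℍ[ℝ] → ℍ[ℝ]} (hf : IsSliceRegular f) :
    ContinuousOn (fun z : ℂ => f z) 𝔻 := by
  have h : (fun z : ℂ => f z) = fun z => pairQuat (toMat f z 0 0, toMat f z 0 1) := by
    funext z
    exact (rowQuat_toMat f z).symm
  rw [h]
  exact pairQuat.continuous.comp_continuousOn
    ((hf.isHol 0 0).continuousOn.prodMk (hf.isHol 0 1).continuousOn)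

lemma slicePoint_unitI_polar (r θ : ℝ) :
    slicePoint unitI (r * Real.cos θ) (r * Real.sin θ) = ((circleMap 0 r θ : ℂ) : ℍ[ℝ]) := by
  rw [← slicePoint_unitI, circleMap_zero_re, circleMap_zero_im]

lemma slicePoint_neg_unitI_polar (r θ : ℝ) :
    slicePoint (-unitI) (r * Real.cos θ) (r * Real.sin θ) = ((conj (circleMap 0 r θ) : ℂ) : ℍ[ℝ]) := by
  rw [← slicePoint_unitI, Complex.conj_re, Complex.conj_im, circleMap_zero_re, circleMap_zero_im]
  simp [slicePoint]

lemma norm_det_toMat_le (f : ℍ[ℝ] → ℍ[ℝ]) (z : ℂ) :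
    ‖(toMat f z).det‖ ≤ ‖f z‖ ^ 2 + ‖f (conj z : ℂ)‖ ^ 2 := by
  have h1 : ∀ z : ℂ, ‖f z‖ ^ 2 = ‖splitF f z‖ ^ 2 + ‖splitG f z‖ ^ 2 := by
    intro z
    rw [norm_sq_eq, ← Complex.normSq_eq_norm_sq, ← Complex.normSq_eq_norm_sq]
    simp [splitF, splitG, Complex.normSq_apply]
    ring
  rw [h1, h1, Matrix.det_fin_two]
  simp only [toMat]
  simp only [Matrix.of_apply, Matrix.cons_val_zero, Matrix.cons_val_one, Matrix.cons_val',
    Matrix.cons_val_fin_one]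
  refine (norm_sub_le _ _).trans ?_
  rw [norm_mul, norm_mul, norm_neg, RCLike.norm_conj, RCLike.norm_conj]
  nlinarith [sq_nonneg (‖splitF f z‖ - ‖splitF f (conj z)‖), sq_nonneg (‖splitG f z‖ - ‖splitG f (conj z)‖),
    sq_nonneg (‖splitF f z‖ + ‖splitF f (conj z)‖), sq_nonneg (‖splitG f z‖ + ‖splitG f (conj z)‖)]

/-- With m the larger of |f(z)| and |f(z̄)|, |det| ≤ 2m² and log m ≤ m^s / s. So a bound on means of
any positive power controls the logarithm. -/
lemma log_det_le (f : ℍ[ℝ] → ℍ[ℝ]) (z : ℂ) {s : ℝ} (hs : 0 < s) :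
    Real.log ‖(toMat f z).det‖ ≤
      Real.log 2 + (‖f z‖ ^ s + ‖f (conj z : ℂ)‖ ^ s) * (2 / s) := by
  have h1 := norm_det_toMat_le f z
  set a := ‖f z‖ with ha
  set b := ‖f (conj z : ℂ)‖ with hb
  have ha0 : 0 ≤ a := norm_nonneg _
  have hb0 : 0 ≤ b := norm_nonneg _
  have hlog2 : 0 ≤ Real.log 2 := Real.log_nonneg one_le_two
  have hpos : 0 ≤ Real.log 2 + (a ^ s + b ^ s) * (2 / s) := by positivity
  rcases (norm_nonneg (toMat f z).det).eq_or_lt with h0 | h0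
  -- At a zero of the determinant `Real.log` takes the value 0, so the right side must be
  -- nonnegative.
  · rw [← h0, Real.log_zero]; exact hpos
  · set m := max a b with hm
    have hm0 : 0 < m := by
      by_contra hcon
      have e1 : a = 0 := le_antisymm ((le_max_left a b).trans (not_lt.1 hcon)) ha0
      have e2 : b = 0 := le_antisymm ((le_max_right a b).trans (not_lt.1 hcon)) hb0
      rw [e1, e2] at h1
      linarith
    have h2 : ‖(toMat f z).det‖ ≤ 2 * m ^ 2 := by
      have e1 : a ^ 2 ≤ m ^ 2 := by gcongr; exact le_max_left _ _
      have e2 : b ^ 2 ≤ m ^ 2 := by gcongr; exact le_max_right _ _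
      linarith
    have h3 := Real.log_le_log h0 h2
    rw [Real.log_mul two_ne_zero (by positivity), Real.log_pow] at h3
    have h4 : Real.log m ≤ m ^ s / s := Real.log_le_rpow_div hm0.le hs
    have h5 : m ^ s ≤ a ^ s + b ^ s := by
      rcases max_cases a b with ⟨h, _⟩ | ⟨h, _⟩
      · rw [hm, h]; linarith [Real.rpow_nonneg hb0 s]
      · rw [hm, h]; linarith [Real.rpow_nonneg ha0 s]
    have h6 : m ^ s / s ≤ (a ^ s + b ^ s) / s := by gcongr
    have h7 : (a ^ s + b ^ s) * (2 / s) = 2 * ((a ^ s + b ^ s) / s) := by ring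
    rw [h7]
    push_cast at h3
    linarith

lemma integral_le_of_lintegral_le {g : ℝ → ℍ[ℝ]} (hg : Continuous g) {s : ℝ} (hs : 0 < s) {C : ℝ≥0∞}
    (hC : C ≠ ⊤) (h : ∫⁻ θ in Set.Ioc 0 (2 * Real.pi), ‖g θ‖ₑ ^ s ≤ C) :
    ∫ θ in 0..2 * Real.pi, ‖g θ‖ ^ s ≤ C.toReal := by
  have hcont : Continuous fun θ => ‖g θ‖ ^ s :=
    hg.norm.rpow_const fun _ => Or.inr hs.le
  rw [intervalIntegral.integral_of_le Real.two_pi_pos.le]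
  rw [← ENNReal.ofReal_le_iff_le_toReal hC, MeasureTheory.ofReal_integral_eq_lintegral_ofReal]
  · refine le_trans (le_of_eq (MeasureTheory.lintegral_congr fun θ => ?_)) h
    rw [← ENNReal.ofReal_rpow_of_nonneg (norm_nonneg _) hs.le, ofReal_norm]
  · exact (hcont.intervalIntegrable 0 (2 * Real.pi)).1
  · exact .of_forall fun θ => Real.rpow_nonneg (norm_nonneg _) _

/-- The logarithmic means of the determinant of a Hardy function are bounded. -/
lemma MemHardy.exists_circleAverage_le {p : ℝ≥0∞} (hp : 0 < p) {f : ℍ[ℝ] → ℍ[ℝ]} (hf : MemHardy p f) :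
    ∃ C : ℝ, ∀ᶠ r : ℝ in 𝓝[<] 1,
      Real.circleAverage (fun z => Real.log ‖(toMat f z).det‖) 0 r ≤ C := by
  obtain ⟨s, hs, C, hC, hb⟩ := hf.exists_bound hp
  -- The determinant involves f at z̄ as well; those values form the mean of f on the slice of -i.
  have hneg : -unitI ∈ imagUnits := by
    change -unitI * -unitI = -1
    rw [neg_mul_neg]; exact unitI_mem
  refine ⟨(2 * Real.pi)⁻¹ * (2 * Real.pi * Real.log 2 + (C.toReal + C.toReal) * (2 / s)), ?_⟩
  filter_upwards [hb _ unitI_mem, hb _ hneg, eventually_mem_Ioo] with r h1 h2 hr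
  have hmem : ∀ θ, circleMap 0 r θ ∈ 𝔻 := fun θ => by
    rw [mem_ball_zero_iff, norm_circleMap_zero, abs_of_pos hr.1]; exact hr.2
  simp only [slicePoint_unitI_polar] at h1
  simp only [slicePoint_neg_unitI_polar] at h2
  have c1 : Continuous fun θ => f (circleMap 0 r θ : ℂ) :=
    hf.1.continuousOn_coe.comp_continuous (continuous_circleMap 0 r) hmem
  have c2 : Continuous fun θ => f (conj (circleMap 0 r θ) : ℂ) :=
    hf.1.continuousOn_coe.comp_continuous
      (Complex.continuous_conj.comp (continuous_circleMap 0 r)) fun θ => conj_mem_disc (hmem θ)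
  have i1 := integral_le_of_lintegral_le c1 hs hC h1
  have i2 := integral_le_of_lintegral_le c2 hs hC h2
  have c1' : Continuous fun θ => ‖f (circleMap 0 r θ : ℂ)‖ ^ s :=
    c1.norm.rpow_const fun _ => Or.inr hs.le
  have c2' : Continuous fun θ => ‖f (conj (circleMap 0 r θ) : ℂ)‖ ^ s :=
    c2.norm.rpow_const fun _ => Or.inr hs.le
  have hsub : Metric.sphere (0 : ℂ) |r| ⊆ 𝔻 := fun z hz => by
    rw [mem_sphere_zero_iff_norm, abs_of_pos hr.1] at hz
    rw [mem_ball_zero_iff, hz]; exact hr.2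
  have hint : CircleIntegrable (fun z => Real.log ‖(toMat f z).det‖) 0 r :=
    MeromorphicOn.circleIntegrable_log_norm fun z hz =>
      (analyticAt_of_disc hf.1.isHol.det (hsub hz)).meromorphicAt
  rw [Real.circleAverage_def, smul_eq_mul]
  have hpi : 0 ≤ (2 * Real.pi)⁻¹ := by positivity
  apply mul_le_mul_of_nonneg_left _ hpi
  calc _ ≤ ∫ θ in 0..2 * Real.pi, (Real.log 2 + (‖f (circleMap 0 r θ : ℂ)‖ ^ s
        + ‖f (conj (circleMap 0 r θ) : ℂ)‖ ^ s) * (2 / s)) := by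
        apply intervalIntegral.integral_mono_on Real.two_pi_pos.le hint
        · exact (continuous_const.add ((c1'.add c2').mul continuous_const)).intervalIntegrable _ _
        · intro θ _
          exact log_det_le f _ hs
    _ = 2 * Real.pi * Real.log 2 + ((∫ θ in 0..2 * Real.pi, ‖f (circleMap 0 r θ : ℂ)‖ ^ s)
        + ∫ θ in 0..2 * Real.pi, ‖f (conj (circleMap 0 r θ) : ℂ)‖ ^ s) * (2 / s) := by
        have k1 : IntervalIntegrable (fun θ => (‖f (circleMap 0 r θ : ℂ)‖ ^ s
            + ‖f (conj (circleMap 0 r θ) : ℂ)‖ ^ s) * (2 / s)) MeasureTheory.volume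
            0 (2 * Real.pi) :=
          ((c1'.add c2').mul continuous_const).intervalIntegrable _ _
        rw [intervalIntegral.integral_add (by simp) k1,
          intervalIntegral.integral_mul_const, intervalIntegral.integral_add
          (c1'.intervalIntegrable _ _) (c2'.intervalIntegrable _ _)]
        simp
    _ ≤ _ := by gcongr

/-- The Blaschke condition from Jensen's formula. -/
theorem summable_of_circleAverage_le {d : ℂ → ℂ} (hd : DifferentiableOn ℂ d 𝔻)
    (h0 : ∃ z ∈ 𝔻, d z ≠ 0) {C : ℝ}
    (hC : ∀ᶠ r : ℝ in 𝓝[<] 1, Real.circleAverage (fun z => Real.log ‖d z‖) 0 r ≤ C) :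
    Summable fun z : 𝔻 => (analyticOrderNatAt d z : ℝ) * (1 - ‖(z : ℂ)‖) := by
  set T := Real.log ‖meromorphicTrailingCoeffAt d 0‖
  set n0 : ℝ := (analyticOrderNatAt d 0 : ℝ)
  have hnn : ∀ z : 𝔻, 0 ≤ (analyticOrderNatAt d z : ℝ) * (1 - ‖(z : ℂ)‖) := fun z => by
    have : ‖(z : ℂ)‖ < 1 := mem_ball_zero_iff.1 z.2
    exact mul_nonneg (Nat.cast_nonneg _) (by linarith)
  have hdiv : ∀ r ∈ Set.Ioo (0 : ℝ) 1, ∀ z, ‖z‖ ≤ r →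
      MeromorphicOn.divisor d (Metric.closedBall 0 |r|) z = (analyticOrderNatAt d z : ℤ) := by
    intro r hr z hz
    have hsub : Metric.closedBall (0 : ℂ) |r| ⊆ 𝔻 :=
      Metric.closedBall_subset_ball (by rw [abs_of_pos hr.1]; exact hr.2)
    have hz' : z ∈ Metric.closedBall (0 : ℂ) |r| := by
      rw [mem_closedBall_zero_iff, abs_of_pos hr.1]; exact hz
    rw [MeromorphicOn.AnalyticOnNhd.divisor_apply (fun w hw => analyticAt_of_disc hd (hsub hw)) hz']
    have := order_ne_top hd h0 (hsub hz')
    rw [← Nat.cast_analyticOrderNatAt this]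
    rfl
  -- Jensen's formula at radius r bounds the sum of log (r/|z|) over all zeros inside. Its terms are
  -- nonnegative, so it may be cut down to S, and then r → 1. The term n₀ log r of the origin
  -- disappears in the limit.
  have key : ∀ S : Finset ℂ, (∀ z ∈ S, z ∈ 𝔻 ∧ z ≠ 0) →
      ∑ z ∈ S, (analyticOrderNatAt d z : ℝ) * Real.log (1 * ‖z‖⁻¹) ≤ C - T := by
    intro S hS
    have hlim : Filter.Tendsto (fun r : ℝ => ∑ z ∈ S, (analyticOrderNatAt d z : ℝ) * Real.log (r * ‖z‖⁻¹)
        + n0 * Real.log r) (𝓝[<] 1)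
        (𝓝 (∑ z ∈ S, (analyticOrderNatAt d z : ℝ) * Real.log (1 * ‖z‖⁻¹) + n0 * Real.log 1)) := by
      apply Filter.Tendsto.mono_left _ nhdsWithin_le_nhds
      have hl : Filter.Tendsto Real.log (𝓝 1) (𝓝 (Real.log 1)) :=
        (Real.continuousAt_log one_ne_zero).tendsto
      refine (tendsto_finsetSum _ fun z hz => ?_).add (hl.const_mul _)
      have hne : 1 * ‖z‖⁻¹ ≠ 0 := by simpa using (hS z hz).2
      exact (((Real.continuousAt_log hne).tendsto.comp
        (Filter.tendsto_id.mul_const (‖z‖⁻¹)))).const_mul _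
    rw [Real.log_one, mul_zero, add_zero] at hlim
    apply le_of_tendsto hlim
    have hSr : ∀ᶠ r : ℝ in 𝓝[<] 1, ∀ z ∈ S, ‖z‖ < r := by
      rw [Filter.eventually_all_finset]
      intro z hz
      apply Filter.Eventually.filter_mono nhdsWithin_le_nhds
      exact lt_mem_nhds (by simpa using (hS z hz).1)
    filter_upwards [hC, eventually_mem_Ioo, hSr] with r h1 hr hSr
    have hsub : Metric.closedBall (0 : ℂ) |r| ⊆ 𝔻 :=
      Metric.closedBall_subset_ball (by rw [abs_of_pos hr.1]; exact hr.2)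
    have hm : MeromorphicOn d (Metric.closedBall 0 |r|) := fun z hz =>
      (analyticAt_of_disc hd (hsub hz)).meromorphicAt
    rw [hm.circleAverage_log_norm hr.1.ne', hdiv r hr 0 (by simpa using hr.1.le)] at h1
    have hfs := (MeromorphicOn.divisor d (Metric.closedBall 0 |r|)).finiteSupport
      (isCompact_closedBall 0 |r|)
    classical
    set g : ℂ → ℝ := fun u => (MeromorphicOn.divisor d (Metric.closedBall 0 |r|) u : ℝ)
      * Real.log (r * ‖0 - u‖⁻¹) with hg
    have hgsup : g.support ⊆ ((hfs.toFinset ∪ S : Finset ℂ) : Set ℂ) := by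
      intro u hu
      rw [Finset.coe_union, Set.Finite.coe_toFinset]
      left
      intro h
      apply hu
      simp only [hg]
      rw [h]; simp
    have hg0 : ∀ u, 0 ≤ g u := by
      intro u
      by_cases hu : ‖u‖ ≤ r
      · simp only [hg]
        rw [hdiv r hr u hu]
        apply mul_nonneg (by positivity)
        by_cases hu0 : u = 0
        · simp [hu0]
        · apply Real.log_nonneg
          rw [zero_sub, norm_neg, ← div_eq_mul_inv, one_le_div (by simpa using hu0)]
          exact hu
      · have : u ∉ Metric.closedBall (0 : ℂ) |r| := by
          rw [mem_closedBall_zero_iff, abs_of_pos hr.1]; exact hu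
        simp only [hg]
        rw [Function.locallyFinsuppWithin.apply_eq_zero_of_notMem _ this]
        simp
    have h2 : ∑ z ∈ S, (analyticOrderNatAt d z : ℝ) * Real.log (r * ‖z‖⁻¹) ≤ ∑ᶠ u, g u := by
      rw [finsum_eq_sum_of_support_subset _ hgsup]
      refine le_trans (le_of_eq (Finset.sum_congr rfl fun z hz => ?_))
        (Finset.sum_le_sum_of_subset_of_nonneg Finset.subset_union_right fun u _ _ => hg0 u)
      simp only [hg]
      rw [hdiv r hr z (hSr z hz).le, zero_sub, norm_neg]
      simp
    simp only [Int.cast_natCast] at h1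
    have h1' : ∑ᶠ u, g u + n0 * Real.log r + T ≤ C := h1
    linarith
  -- The origin contributes at most n₀; elsewhere 1 - |z| ≤ log (1/|z|).
  apply summable_of_sum_le hnn (c := n0 + (C - T))
  intro S
  classical
  set S' : Finset ℂ := (S.map (Function.Embedding.subtype _)).erase 0 with hS'
  have h1 : ∑ z ∈ S, (analyticOrderNatAt d z : ℝ) * (1 - ‖(z : ℂ)‖)
      = ∑ z ∈ S.map (Function.Embedding.subtype _), (analyticOrderNatAt d z : ℝ) * (1 - ‖z‖) := by
    rw [Finset.sum_map]; rfl
  have hS'd : ∀ z ∈ S', z ∈ 𝔻 ∧ z ≠ 0 := by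
    intro z hz
    rw [hS', Finset.mem_erase, Finset.mem_map] at hz
    obtain ⟨hz0, w, _, rfl⟩ := hz
    exact ⟨w.2, hz0⟩
  have h2 : ∑ z ∈ S.map (Function.Embedding.subtype _), (analyticOrderNatAt d z : ℝ) * (1 - ‖z‖)
      ≤ n0 + ∑ z ∈ S', (analyticOrderNatAt d z : ℝ) * (1 - ‖z‖) := by
    by_cases h : (0 : ℂ) ∈ S.map (Function.Embedding.subtype _)
    · rw [← Finset.add_sum_erase _ _ h]
      simp [n0, S']
    · rw [hS', Finset.erase_eq_of_notMem h]
      have : 0 ≤ n0 := Nat.cast_nonneg _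
      linarith
  have h3 : ∑ z ∈ S', (analyticOrderNatAt d z : ℝ) * (1 - ‖z‖)
      ≤ ∑ z ∈ S', (analyticOrderNatAt d z : ℝ) * Real.log (1 * ‖z‖⁻¹) := by
    refine Finset.sum_le_sum fun z hz => mul_le_mul_of_nonneg_left ?_ (Nat.cast_nonneg _)
    have hz0 : 0 < ‖z‖ := norm_pos_iff.2 (hS'd z hz).2
    have := Real.log_le_sub_one_of_pos hz0
    rw [one_mul, Real.log_inv]
    linarith
  rw [h1]
  linarith [key S' hS'd]

end QuatHardy

end

/-! ### Listing zeros and deleting idle factors. -/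

noncomputable section

namespace QuatHardy

local notation "conj" => starRingEnd ℂ
local notation "𝔻" => Metric.ball (0 : ℂ) 1

lemma summable_ite_iff {P : ℕ → Prop} [DecidablePred P] {f : ℕ → ℝ} :
    Summable (fun k => if P k then f k else 0) ↔ Summable fun k : {k // P k} => f k := by
  have e : (fun k => if P k then f k else 0) = Set.indicator {k | P k} f := by
    funext n
    by_cases h : P n <;> simp [h]
  rw [e, ← summable_subtype_iff_indicator]
  rfl

/-- Each term is repeated d times; used for pairs (d = 2) and for blocks of three. -/
lemma summable_comp_div {f : ℕ → ℝ} (hf : Summable f) (h0 : ∀ n, 0 ≤ f n) (d : ℕ) [NeZero d] :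
    Summable fun k => f (k / d) := by
  have h : Summable fun x : ℕ × Fin d => f x.1 * 1 :=
    hf.mul_of_nonneg (g := fun _ : Fin d => (1 : ℝ)) Summable.of_finite h0 fun _ => zero_le_one
  have := (Nat.divModEquiv d).summable_iff.2 h
  simpa [Function.comp_def] using this

/-- A countable type is indexed by an initial segment of `ℕ`. -/
lemma exists_equiv_initial (T : Type*) [Countable T] :
    ∃ M : ℕ∞, Nonempty ({i : ℕ // (i : ℕ∞) < M} ≃ T) := by
  rcases finite_or_infinite T with h | h
  · obtain ⟨n, ⟨e⟩⟩ := Finite.exists_equiv_fin T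
    refine ⟨n, ⟨Equiv.trans ⟨fun i => ⟨i.1, by exact_mod_cast i.2⟩, fun i => ⟨i.1, by exact_mod_cast i.2⟩,
      fun _ => rfl, fun _ => rfl⟩ e.symm⟩⟩
  · obtain ⟨hd⟩ := nonempty_denumerable T
    exact ⟨⊤, ⟨(Equiv.subtypeUnivEquiv fun i => ENat.natCast_lt_top i).trans (Denumerable.eqv T).symm⟩⟩

open Classical in
/-- Listing the points of a discrete set with multiplicities. -/
lemma exists_enumeration {D : Set ℂ} (hD : D ⊆ 𝔻) {m : ℂ → ℕ}
    (hs : Summable fun z : D => (m z : ℝ) * (1 - ‖(z : ℂ)‖)) :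
    ∃ (M : ℕ∞) (w : ℕ → ℂ), (∀ j, w j ∈ 𝔻) ∧ (∀ j : ℕ, (j : ℕ∞) < M → w j ∈ D) ∧
      (∀ j : ℕ, ¬ (j : ℕ∞) < M → w j = 0) ∧
      Summable (fun j : ℕ => if (j : ℕ∞) < M then 1 - ‖w j‖ else 0) ∧
      ∀ z ∈ D, {j : ℕ | (j : ℕ∞) < M ∧ w j = z}.encard = m z := by
  have hpos : ∀ z : D, 0 < 1 - ‖(z : ℂ)‖ := fun z => by
    have := mem_ball_zero_iff.1 (hD z.2)
    linarith
  have hT : Summable fun t : Σ z : D, Fin (m z) => 1 - ‖(t.1 : ℂ)‖ := by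
    rw [summable_sigma_of_nonneg fun t => (hpos t.1).le]
    refine ⟨fun _ => Summable.of_finite, ?_⟩
    simpa only [tsum_fintype, Finset.sum_const, Finset.card_univ, Fintype.card_fin,
      nsmul_eq_mul] using hs
  -- A summable family with all terms positive has a countable index set, so no separate argument on
  -- isolated zeros is needed.
  have hc : Countable (Σ z : D, Fin (m z)) := by
    have h1 := hT.countable_support
    have h2 : (Function.support fun t : Σ z : D, Fin (m z) => 1 - ‖(t.1 : ℂ)‖) = Set.univ :=
      Set.eq_univ_of_forall fun t => (hpos t.1).ne'
    rw [h2] at h1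
    exact Set.countable_univ_iff.1 h1
  obtain ⟨M, ⟨e⟩⟩ := exists_equiv_initial (Σ z : D, Fin (m z))
  set w : ℕ → ℂ := fun j => if h : (j : ℕ∞) < M then (e ⟨j, h⟩).1 else 0 with hw
  have hwe : ∀ j : {i : ℕ // (i : ℕ∞) < M}, w j = (e j).1 := fun j => by
    simp only [hw, dif_pos j.2]
  have hwD : ∀ j : ℕ, (j : ℕ∞) < M → w j ∈ D := fun j hj => by
    rw [hwe ⟨j, hj⟩]; exact (e ⟨j, hj⟩).1.2
  have hw0 : ∀ j : ℕ, ¬ (j : ℕ∞) < M → w j = 0 := fun j hj => by simp only [hw, dif_neg hj]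
  refine ⟨M, w, fun j => ?_, hwD, hw0, ?_, fun z hz => ?_⟩
  · by_cases hj : (j : ℕ∞) < M
    · exact hD (hwD j hj)
    · rw [hw0 j hj]; exact Metric.mem_ball_self one_pos
  · rw [summable_ite_iff]
    simp only [hwe]
    exact e.summable_iff.2 hT
  · have h1 : {j : ℕ | (j : ℕ∞) < M ∧ w j = z}
        = Set.range fun i : Fin (m z) => ((e.symm ⟨⟨z, hz⟩, i⟩ : {i : ℕ // (i : ℕ∞) < M}) : ℕ) := by
      ext j
      constructor
      · rintro ⟨hj, hjz⟩
        rw [hwe ⟨j, hj⟩] at hjz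
        obtain ⟨⟨⟨z', hz'⟩, i⟩, h⟩ : ∃ t, e ⟨j, hj⟩ = t := ⟨_, rfl⟩
        rw [h] at hjz
        obtain rfl : z' = z := hjz
        have h2 := congrArg Subtype.val (e.symm_apply_apply ⟨j, hj⟩)
        rw [h] at h2
        exact ⟨i, h2⟩
      · rintro ⟨i, rfl⟩
        refine ⟨(e.symm ⟨⟨z, hz⟩, i⟩).2, ?_⟩
        rw [hwe]
        simp
    have hinj : Function.Injective
        fun i : Fin (m z) => ((e.symm ⟨⟨z, hz⟩, i⟩ : {i : ℕ // (i : ℕ∞) < M}) : ℕ) := by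
      intro i i' h
      have := e.symm.injective (Subtype.ext h)
      simpa using this
    rw [h1, ← Set.image_univ, hinj.encard_image, Set.encard_univ]
    simp

/-- A product over a subset of `ℕ` is a Blaschke product. -/
lemma exists_blaschkeSeq_tendsto {P : ℕ → Prop} [DecidablePred P] {b : ℕ → ℍ[ℝ]} (hb : ∀ k, P k → ‖b k‖ < 1)
    (hs : Summable fun k => if P k then 1 - ‖b k‖ else 0) :
    ∃ (K : ℕ∞) (a : ℕ → ℍ[ℝ]), BlaschkeSeq K a ∧ ∀ z ∈ 𝔻,
      Filter.Tendsto (fun n => seqProd (fun k => if P k then blaschkeMat (b k) z else 1) n)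
        Filter.atTop (𝓝 (limProd (facMat K a) z)) := by
  -- The active indices are listed increasingly by `Nat.nth`, and K counts them. Idle factors are 1,
  -- so the product up to n is the compressed product up to `Nat.count P n`.
  set K : ℕ∞ := (Set.ofPred P).encard with hK
  have hlt : ∀ k : ℕ, (k : ℕ∞) < K ↔ ∀ hf : (Set.ofPred P).Finite, k < hf.toFinset.card := by
    intro k
    constructor
    · intro h hf
      rw [hK, hf.encard_eq_coe_toFinset_card] at h
      exact_mod_cast h
    · intro h
      by_cases hf : (Set.ofPred P).Finite
      · rw [hK, hf.encard_eq_coe_toFinset_card]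
        exact_mod_cast h hf
      · rw [hK, Set.encard_eq_top hf]
        exact ENat.natCast_lt_top k
  have hBS : BlaschkeSeq K fun k => b (Nat.nth P k) := by
    refine ⟨fun n hn => hb _ (Nat.nth_mem n ((hlt n).1 hn)), ?_⟩
    unfold defect
    rw [summable_ite_iff] at hs ⊢
    have hinj : Function.Injective (fun k : {k : ℕ // (k : ℕ∞) < K} =>
        (⟨Nat.nth P k, Nat.nth_mem _ ((hlt k).1 k.2)⟩ : {k // P k})) := by
      intro k l h
      have h1 := congrArg (fun x : {k // P k} => Nat.count P x) h
      simp only [Nat.count_nth ((hlt k).1 k.2), Nat.count_nth ((hlt l).1 l.2)] at h1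
      exact Subtype.ext h1
    have h2 := hs.comp_injective hinj
    simp only [Function.comp_def] at h2
    exact h2
  refine ⟨K, _, hBS, fun z hz => ?_⟩
  set F := facMat K fun k => b (Nat.nth P k) with hF
  have hcount : ∀ n, seqProd (fun k => if P k then blaschkeMat (b k) z else 1) n
      = prodMat F (Nat.count P n) z := by
    intro n
    induction n with
    | zero => simp [seqProd, prodMat]
    | succ n ih =>
      rw [seqProd, ih, Nat.count_succ]
      split_ifs with h
      · have h1 : ((Nat.count P n : ℕ) : ℕ∞) < K := (hlt _).2 fun hf => Nat.count_lt_card hf h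
        rw [prodMat, prodMat, seqProd]
        simp [hF, facMat, h1, Nat.nth_count h]
      · simp
  simp only [hcount]
  have ht := hBS.nearOne.tendsto hz
  -- With finitely many active indices the count stays bounded and the product stabilises; otherwise
  -- the count tends to infinity.
  by_cases hf : (Set.ofPred P).Finite
  · have hKc : K = hf.toFinset.card := hf.encard_eq_coe_toFinset_card
    have hstab : ∀ n, prodMat F (hf.toFinset.card + n) z = prodMat F hf.toFinset.card z := by
      intro n
      induction n with
      | zero => rfl
      | succ n ih =>
        rw [← add_assoc, prodMat, seqProd]
        rw [prodMat] at ih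
        have : ¬ ((hf.toFinset.card + n : ℕ) : ℕ∞) < K := by
          rw [hKc, not_lt]
          exact_mod_cast Nat.le_add_right _ _
        rw [ih]
        simp only [hF, facMat, this, if_false, mul_one]
    have hL : limProd F z = prodMat F hf.toFinset.card z := by
      refine tendsto_nhds_unique ht (tendsto_const_nhds.congr' ?_)
      filter_upwards [Filter.eventually_ge_atTop hf.toFinset.card] with n hn
      obtain ⟨k, rfl⟩ := Nat.exists_eq_add_of_le hn
      exact (hstab k).symm
    rw [hL]
    refine tendsto_const_nhds.congr' ?_
    obtain ⟨n0, hn0⟩ := hf.bddAbove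
    filter_upwards [Filter.eventually_ge_atTop (n0 + 1)] with n hn
    congr 1
    rw [Nat.count_eq_card_filter_range]
    congr 1
    ext k
    simp only [Set.Finite.mem_toFinset, Finset.mem_filter, Finset.mem_range]
    constructor
    · intro hk
      have := hn0 hk
      exact ⟨by omega, hk⟩
    · exact fun hk => hk.2
  · refine ht.comp ?_
    refine Filter.tendsto_atTop_atTop_of_monotone (Nat.count_monotone P) fun n => ⟨Nat.nth P n, ?_⟩
    rw [Nat.count_nth fun h => absurd h hf]

end QuatHardy

end

/-! ### Conjugate pairs and interleaving. -/

noncomputable section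

namespace QuatHardy

local notation "conj" => starRingEnd ℂ
local notation "𝔻" => Metric.ball (0 : ℂ) 1

/-- Everything commutes, and each factor meets its conjugate, whose product with it is a scalar.
Hence pairs are central and build the spherical part. -/
lemma blaschkeMat_mul_star {a : ℍ[ℝ]} (ha : ‖a‖ < 1) {z : ℂ} (hz : z ∈ 𝔻) :
    blaschkeMat a z * blaschkeMat (star a) z = (blaschkeNum a z / blaschkeDen a z) • 1 := by
  have hd := blaschkeDen_ne_zero ha hz
  unfold blaschkeMat
  by_cases h : a = 0
  · subst h
    simp [blaschkeNum_zero, blaschkeDen_zero, smul_smul, pow_two]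
  · have hn : ‖a‖ ≠ 0 := by simpa using h
    have hn' : (‖a‖ : ℂ) ≠ 0 := by exact_mod_cast hn
    rw [if_neg h, if_neg (by simpa using h), star_star, norm_star, blaschkeDen_star, quatMat_smul,
      quatMat_smul]
    have c0 : Commute (quatMat (star a)) (quatMat a) := by
      change _ * _ = _ * _
      rw [← quatMat_mul, ← quatMat_mul, Quaternion.self_mul_star, Quaternion.star_mul_self]
    have c1 : Commute (quatMat (star a)) (1 - z • quatMat (star a)) :=
      (Commute.one_right _).sub_right ((Commute.refl _).smul_right z)
    have c2 : Commute (quatMat (star a)) (quatMat (star a) - z • 1) :=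
      (Commute.refl _).sub_right ((Commute.one_right _).smul_right z)
    have c3 : Commute (quatMat a - z • 1) (1 - z • quatMat (star a)) :=
      (Commute.one_right _).sub_right ((c0.symm.sub_left
        ((Commute.one_left _).smul_left z)).smul_right z)
    have e1 := one_sub_smul_mul a z
    have e2 : (quatMat a - z • 1) * (quatMat (star a) - z • 1) = blaschkeNum a z • 1 := by
      have := adjugate_smul_one_sub a z
      rw [← neg_mul_neg, neg_sub, neg_sub, ← this, Matrix.mul_adjugate, det_smul_one_sub]
    have e3 : quatMat (star a) * quatMat a = ((‖a‖ ^ 2 : ℝ) : ℂ) • 1 := by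
      rw [c0.eq, quatMat_mul_star]
    set U := 1 - z • quatMat a
    set U' := 1 - z • quatMat (star a)
    set V := quatMat a - z • 1
    set V' := quatMat (star a) - z • 1
    have e4 : (U * V * quatMat (star a)) * (U' * V' * quatMat a)
        = (blaschkeDen a z * blaschkeNum a z * ((‖a‖ ^ 2 : ℝ) : ℂ)) • 1 := by
      calc _ = U * V * (quatMat (star a) * U') * V' * quatMat a := by simp only [mul_assoc]
        _ = U * (V * U') * (quatMat (star a) * V') * quatMat a := by
          rw [c1.eq]; simp only [mul_assoc]
        _ = (U * U') * (V * V') * (quatMat (star a) * quatMat a) := by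
          rw [c2.eq, c3.eq]; simp only [mul_assoc]
        _ = _ := by
          rw [e1, e2, e3]
          simp only [smul_mul_assoc, one_mul, smul_smul, mul_assoc]
    simp only [smul_mul_assoc, mul_smul_comm, smul_smul]
    rw [e4, smul_smul]
    congr 1
    push_cast
    field_simp

open Classical in
lemma lt_two_mul_iff {M : ℕ∞} {k : ℕ} : (k : ℕ∞) < 2 * M ↔ ((k / 2 : ℕ) : ℕ∞) < M := by
  cases M with
  | top => simp [ENat.mul_top]
  | coe M => norm_cast; omega

lemma norm_conjPairs (α : ℕ → ℍ[ℝ]) (k : ℕ) : ‖conjPairs α k‖ = ‖α (k / 2)‖ := by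
  unfold conjPairs; split_ifs <;> simp

lemma slicePt_conjPairs (α : ℕ → ℍ[ℝ]) (k : ℕ) : slicePt (conjPairs α k) = slicePt (α (k / 2)) := by
  unfold conjPairs; split_ifs
  · rfl
  · exact slicePt_star _

lemma BlaschkeSeq.defect_nonneg {N : ℕ∞} {a : ℕ → ℍ[ℝ]} (h : BlaschkeSeq N a) (n : ℕ) :
    0 ≤ defect N a n := h.nearOne.nonneg n

lemma BlaschkeSeq.conjPairs {M : ℕ∞} {α : ℕ → ℍ[ℝ]} (h : BlaschkeSeq M α) :
    BlaschkeSeq (2 * M) (conjPairs α) where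
  lt_one n hn := by rw [norm_conjPairs]; exact h.lt_one _ (lt_two_mul_iff.1 hn)
  summable := by
    refine (summable_comp_div h.summable h.defect_nonneg 2).congr fun k => ?_
    simp only [defect, norm_conjPairs, lt_two_mul_iff]

lemma facMat_pair {M : ℕ∞} {α : ℕ → ℍ[ℝ]} (h : BlaschkeSeq M α) {z : ℂ} (hz : z ∈ 𝔻) (n : ℕ) :
    ∃ t : ℂ, facMat (2 * M) (conjPairs α) (2 * n) z * facMat (2 * M) (conjPairs α) (2 * n + 1) z
      = t • 1 := by
  have h1 : 2 * n / 2 = n := by omega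
  have h2 : (2 * n + 1) / 2 = n := by omega
  by_cases hn : (n : ℕ∞) < M
  · refine ⟨_, Eq.trans ?_ (blaschkeMat_mul_star (h.lt_one n hn) hz)⟩
    simp only [facMat, lt_two_mul_iff, h1, h2, hn, if_true, conjPairs]
    simp [Nat.add_mod]
  · exact ⟨1, by simp only [facMat, lt_two_mul_iff, h1, h2, hn, if_false, one_smul, mul_one]⟩

lemma prodMat_two_mul_succ (F : ℕ → ℂ → M2) (n : ℕ) (z : ℂ) :
    prodMat F (2 * (n + 1)) z = prodMat F (2 * n) z * (F (2 * n) z * F (2 * n + 1) z) := by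
  rw [prodMat, prodMat, show 2 * (n + 1) = 2 * n + 1 + 1 by ring, seqProd, seqProd, mul_assoc]

lemma prodMat_pairs {M : ℕ∞} {α : ℕ → ℍ[ℝ]} (h : BlaschkeSeq M α) {z : ℂ} (hz : z ∈ 𝔻) (n : ℕ) :
    ∃ s : ℂ, prodMat (facMat (2 * M) (conjPairs α)) (2 * n) z = s • 1 := by
  induction n with
  | zero => exact ⟨1, by simp [prodMat, seqProd]⟩
  | succ n ih =>
    obtain ⟨s, hs⟩ := ih
    obtain ⟨t, ht⟩ := facMat_pair h hz n
    refine ⟨s * t, ?_⟩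
    rw [prodMat_two_mul_succ, hs, ht, smul_mul_smul_comm, one_mul]

/-- Blaschke products over conjugate pairs have complex values on the slice. -/
lemma limProd_pairs {M : ℕ∞} {α : ℕ → ℍ[ℝ]} (h : BlaschkeSeq M α) (z : ℂ) :
    limProd (facMat (2 * M) (conjPairs α)) z
      = (limProd (facMat (2 * M) (conjPairs α)) z 0 0) • 1 := by
  by_cases hz : z ∈ 𝔻
  · have ht := (h.conjPairs.nearOne.tendsto hz).comp
      (Filter.tendsto_id.const_mul_atTop' (two_pos : 0 < 2))
    have hc : Continuous fun A : M2 => A 0 0 • (1 : M2) :=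
      Continuous.smul (f := fun A : M2 => A 0 0) (g := fun _ : M2 => (1 : M2))
        ((continuous_apply (0 : Fin 2)).comp (continuous_apply (0 : Fin 2))) continuous_const
    have ht2 := (hc.tendsto _).comp ht
    refine tendsto_nhds_unique ht (ht2.congr fun n => ?_)
    obtain ⟨s, hs⟩ := prodMat_pairs h hz n
    simp only [Function.comp_apply, id]
    rw [hs]
    simp
  · simp [limProd, hz]

/-- The scalar function of the Blaschke product over conjugate pairs. -/
def pairFun (M : ℕ∞) (α : ℕ → ℍ[ℝ]) (z : ℂ) : ℂ := limProd (facMat (2 * M) (conjPairs α)) z 0 0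

lemma BlaschkeSeq.differentiableOn_pairFun {M : ℕ∞} {α : ℕ → ℍ[ℝ]} (h : BlaschkeSeq M α) :
    DifferentiableOn ℂ (pairFun M α) 𝔻 := h.conjPairs.nearOne.isHol_limProd 0 0

lemma BlaschkeSeq.pairFun_conj {M : ℕ∞} {α : ℕ → ℍ[ℝ]} (h : BlaschkeSeq M α) (z : ℂ) :
    pairFun M α (conj z) = conj (pairFun M α z) := by
  have h1 := congrFun (congrFun (h.conjPairs.nearOne.isSymm_limProd (isSymm_facMat _ _) z) 0) 0
  have h2 := congrFun (congrFun (limProd_pairs h z) 1) 1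
  unfold pairFun
  rw [h1]
  simp only [quatConj, Matrix.of_apply, Matrix.cons_val_zero, Matrix.cons_val', Matrix.cons_val_fin_one]
  rw [h2]
  simp

/-- In the closed upper half plane z is a root of the quadratic of w j only if z = w j, since z
equal to the conjugate of w j forces both to be real. -/
lemma facOrd_eq_ite {N : ℕ∞} {w : ℕ → ℂ} (him : ∀ j, 0 ≤ (w j).im) {z : ℂ} (hz : 0 ≤ z.im) (j : ℕ)
    [Decidable ((j : ℕ∞) < N ∧ w j = z)] :
    facOrd N w z j = if (j : ℕ∞) < N ∧ w j = z then analyticOrderAt (quad z) z else 0 := by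
  by_cases h : (j : ℕ∞) < N
  · by_cases h2 : w j = z
    · simp [facOrd, h, h2]
    · rw [if_neg (fun h3 => h2 h3.2), facOrd, if_pos h]
      refine order_quad_of_ne (Ne.symm h2) fun h3 => h2 ?_
      have h4 : z.im = - (w j).im := by rw [h3]; simp
      have h5 : (w j).im = 0 := le_antisymm (by linarith) (him j)
      rw [h3, Complex.conj_eq_iff_im.2 h5]
  · rw [if_neg (fun h3 => h h3.1), facOrd, if_neg h]

lemma sum_facOrd_le {N : ℕ∞} {w : ℕ → ℂ} (him : ∀ j, 0 ≤ (w j).im) {z : ℂ} (hz : 0 ≤ z.im) (n : ℕ) :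
    ∑ j ∈ Finset.range n, facOrd N w z j
      ≤ {j : ℕ | (j : ℕ∞) < N ∧ w j = z}.encard * analyticOrderAt (quad z) z := by
  classical
  simp only [facOrd_eq_ite him hz]
  rw [← Finset.sum_filter, Finset.sum_const, nsmul_eq_mul]
  gcongr
  rw [← Set.encard_coe_eq_coe_finsetCard]
  apply Set.encard_le_encard
  intro j hj
  exact (Finset.mem_filter.1 hj).2

lemma sum_facOrd_eventually {N : ℕ∞} {w : ℕ → ℂ} (him : ∀ j, 0 ≤ (w j).im) {z : ℂ} (hz : 0 ≤ z.im)
    (hfin : {j : ℕ | (j : ℕ∞) < N ∧ w j = z}.Finite) :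
    ∀ᶠ n in Filter.atTop, ∑ j ∈ Finset.range n, facOrd N w z j
      = {j : ℕ | (j : ℕ∞) < N ∧ w j = z}.encard * analyticOrderAt (quad z) z := by
  classical
  obtain ⟨n0, hn0⟩ := hfin.bddAbove
  filter_upwards [Filter.eventually_ge_atTop (n0 + 1)] with n hn
  simp only [facOrd_eq_ite him hz]
  rw [← Finset.sum_filter, Finset.sum_const, nsmul_eq_mul]
  congr 1
  rw [← Set.encard_coe_eq_coe_finsetCard]
  congr 1
  ext j
  simp only [Finset.coe_filter, Finset.mem_range, Set.mem_ofPred_eq]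
  exact ⟨fun h => h.2, fun h => ⟨by have := hn0 h; omega, h⟩⟩

/-- The order of the determinant of a Blaschke product counts its zeros. -/
lemma order_det_blaschke {N : ℕ∞} {a : ℕ → ℍ[ℝ]} (ha : BlaschkeSeq N a) {z : ℂ} (hz : z ∈ 𝔻)
    (him : 0 ≤ z.im) (hfin : {j : ℕ | (j : ℕ∞) < N ∧ slicePt (a j) = z}.Finite) :
    analyticOrderAt (fun z => (limProd (facMat N a) z).det) z
      = {j : ℕ | (j : ℕ∞) < N ∧ slicePt (a j) = z}.encard * analyticOrderAt (quad z) z := by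
  have h1 := ha.nearOne.order_det_limProd hz
  have h2 := sum_facOrd_eventually (w := fun j => slicePt (a j)) (fun j => norm_nonneg _) him hfin
  obtain ⟨n, hn1, hn2⟩ := (h1.and h2).exists
  rw [hn1, ← hn2]
  exact Finset.sum_congr rfl fun j _ => order_det_facMat ha.lt_one hz j

lemma facOrd_conj (N : ℕ∞) (w : ℕ → ℂ) {z : ℂ} (hz : z ∈ 𝔻) (j : ℕ) :
    facOrd N w (conj z) j = facOrd N w z j := by
  unfold facOrd
  split_ifs
  · rw [← order_conj_conj (differentiable_quad _).differentiableOn hz]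
    congr 1
    funext y
    simp [quad, mul_comm]
  · rfl

lemma order_det_conj {A : ℂ → M2} (hA : IsSymm A) (hd : IsHol A) {z : ℂ} (hz : z ∈ 𝔻) :
    analyticOrderAt (fun z => (A z).det) (conj z) = analyticOrderAt (fun z => (A z).det) z := by
  rw [← order_conj_conj hd.det hz]
  congr 1
  funext y
  rw [det_conj hA, Complex.conj_conj]

lemma encard_pairs {M : ℕ∞} {w : ℕ → ℂ} {z : ℂ} {m : ℕ}
    (h : {j : ℕ | (j : ℕ∞) < M ∧ w j = z}.encard = m) :
    {k : ℕ | (k : ℕ∞) < 2 * M ∧ w (k / 2) = z}.encard = 2 * m := by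
  set S := {j : ℕ | (j : ℕ∞) < M ∧ w j = z} with hS
  have e : {k : ℕ | (k : ℕ∞) < 2 * M ∧ w (k / 2) = z}
      = (fun j => 2 * j) '' S ∪ (fun j => 2 * j + 1) '' S := by
    ext k
    simp only [lt_two_mul_iff, Set.mem_ofPred_eq, Set.mem_union, Set.mem_image, hS]
    constructor
    · intro hk
      rcases Nat.even_or_odd' k with ⟨j, rfl | rfl⟩
      · exact Or.inl ⟨j, by rwa [show 2 * j / 2 = j by omega] at hk, rfl⟩
      · exact Or.inr ⟨j, by rwa [show (2 * j + 1) / 2 = j by omega] at hk, rfl⟩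
    · rintro (⟨j, hj, rfl⟩ | ⟨j, hj, rfl⟩)
      · rwa [show 2 * j / 2 = j by omega]
      · rwa [show (2 * j + 1) / 2 = j by omega]
  rw [e, Set.encard_union_eq, Function.Injective.encard_image, Function.Injective.encard_image, h,
    two_mul]
  · intro i j hij; simp only at hij; omega
  · intro i j hij; simp only at hij; omega
  · rw [Set.disjoint_left]
    rintro _ ⟨i, _, rfl⟩ ⟨j, _, hj⟩
    simp only at hj
    omega

/-- The product of a Blaschke product over conjugate pairs with a Blaschke product is a Blaschke
product. -/
theorem exists_merge {M N : ℕ∞} {α c : ℕ → ℍ[ℝ]} (hα : BlaschkeSeq M α) (hc : BlaschkeSeq N c) :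
    ∃ (K : ℕ∞) (a : ℕ → ℍ[ℝ]), BlaschkeSeq K a ∧ ∀ z ∈ 𝔻, limProd (facMat K a) z
      = limProd (facMat (2 * M) (conjPairs α)) z * limProd (facMat N c) z := by
  set P : ℕ → Prop := fun k => if k % 3 = 2 then ((k / 3 : ℕ) : ℕ∞) < N else ((k / 3 : ℕ) : ℕ∞) < M
    with hP
  have : DecidablePred P := Classical.decPred P
  -- Blocks α, ᾱ, c. `P` drops the entries beyond the length of either sequence.
  set b : ℕ → ℍ[ℝ] := fun k => if k % 3 = 2 then c (k / 3) else
    if k % 3 = 0 then α (k / 3) else star (α (k / 3)) with hb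
  have hnb : ∀ k, ‖b k‖ = if k % 3 = 2 then ‖c (k / 3)‖ else ‖α (k / 3)‖ := by
    intro k
    simp only [hb]
    split_ifs <;> simp
  obtain ⟨K, a, ha, hlim⟩ := exists_blaschkeSeq_tendsto (P := P) (b := b) (by
      intro k hk
      rw [hnb]
      simp only [hP] at hk
      split_ifs at hk ⊢
      · exact hc.lt_one _ hk
      · exact hα.lt_one _ hk) (by
      refine Summable.of_nonneg_of_le (fun k => ?_) (fun k => ?_)
        ((summable_comp_div hc.summable hc.defect_nonneg 3).add
          (summable_comp_div hα.summable hα.defect_nonneg 3))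
      · have h1 := hc.defect_nonneg (k / 3)
        have h2 := hα.defect_nonneg (k / 3)
        rw [hnb]
        simp only [hP, defect] at h1 h2 ⊢
        split_ifs at h1 h2 ⊢ <;> linarith
      · have h1 := hc.defect_nonneg (k / 3)
        have h2 := hα.defect_nonneg (k / 3)
        rw [hnb]
        simp only [hP, defect] at h1 h2 ⊢
        split_ifs at h1 h2 ⊢ <;> linarith)
  refine ⟨K, a, ha, fun z hz => ?_⟩
  have h1 := (hlim z hz).comp (Filter.tendsto_id.const_mul_atTop' (three_pos : 0 < 3))
  have h2 := (hα.conjPairs.nearOne.tendsto hz).comp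
    (Filter.tendsto_id.const_mul_atTop' (two_pos : 0 < 2))
  have h3 := h2.mul (hc.nearOne.tendsto hz)
  refine tendsto_nhds_unique h1 (h3.congr fun n => ?_)
  simp only [Function.comp_apply, id]
  induction n with
  | zero => simp [prodMat, seqProd]
  | succ n ih =>
    -- Three factors of the interleaved product match two of the pairs and one of c: the pair is a
    -- scalar and moves past the earlier factors c.
    obtain ⟨t, ht⟩ := facMat_pair hα hz n
    have g0 : (if P (3 * n) then blaschkeMat (b (3 * n)) z else 1)
        = facMat (2 * M) (conjPairs α) (2 * n) z := by
      have e1 : 3 * n / 3 = n := by omega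
      have e2 : 2 * n / 2 = n := by omega
      have e3 : 3 * n % 3 = 0 := by omega
      have e4 : 2 * n % 2 = 0 := by omega
      simp only [hP, hb, facMat, lt_two_mul_iff, conjPairs, e1, e2, e3, e4]
      by_cases hn : (n : ℕ∞) < M <;> simp [hn]
    have g1 : (if P (3 * n + 1) then blaschkeMat (b (3 * n + 1)) z else 1)
        = facMat (2 * M) (conjPairs α) (2 * n + 1) z := by
      have e1 : (3 * n + 1) / 3 = n := by omega
      have e2 : (2 * n + 1) / 2 = n := by omega
      have e3 : (3 * n + 1) % 3 = 1 := by omega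
      have e4 : (2 * n + 1) % 2 = 1 := by omega
      simp only [hP, hb, facMat, lt_two_mul_iff, conjPairs, e1, e2, e3, e4]
      by_cases hn : (n : ℕ∞) < M <;> simp [hn]
    have g2 : (if P (3 * n + 2) then blaschkeMat (b (3 * n + 2)) z else 1) = facMat N c n z := by
      have e1 : (3 * n + 2) / 3 = n := by omega
      have e3 : (3 * n + 2) % 3 = 2 := by omega
      simp only [hP, hb, facMat, e1, e3]
      by_cases hn : (n : ℕ∞) < N <;> simp [hn]
    rw [prodMat_two_mul_succ, ht, show 3 * (n + 1) = 3 * n + 1 + 1 + 1 by ring, seqProd, seqProd,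
      seqProd, ← ih, g0, g1, g2, mul_assoc _ (facMat _ _ (2 * n) z), ht]
    change _ * (prodMat (facMat N c) n z * facMat N c n z) = _
    simp only [mul_smul_comm, smul_mul_assoc, mul_one, mul_assoc]

end QuatHardy

end

/-! ### Assembling the factorization. -/

noncomputable section

namespace QuatHardy

local notation "conj" => starRingEnd ℂ
local notation "𝔻" => Metric.ball (0 : ℂ) 1

lemma two_mul_matOrd_le {A : ℂ → M2} (hd : IsHol A) {z : ℂ} (hz : z ∈ 𝔻) :
    2 * matOrd A z ≤ analyticOrderAt (fun z => (A z).det) z := by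
  have key : ∀ i j k l, 2 * matOrd A z ≤ analyticOrderAt ((fun z => A z i j) * fun z => A z k l) z := by
    intro i j k l
    rw [analyticOrderAt_mul (analyticAt_of_disc (hd i j) hz) (analyticAt_of_disc (hd k l) hz), two_mul]
    exact add_le_add (matOrd_le A z i j) (matOrd_le A z k l)
  have e : (fun z => (A z).det)
      = ((fun z => A z 0 0) * fun z => A z 1 1) - ((fun z => A z 0 1) * fun z => A z 1 0) := by
    funext z
    exact Matrix.det_fin_two _
  rw [e]
  exact le_trans (le_min (key _ _ _ _) (key _ _ _ _)) le_analyticOrderAt_sub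

/-- If the determinant vanished identically, the matrix would vanish at all real points, hence on
the whole disc. -/
lemma exists_det_toMat_ne_zero {f : ℍ[ℝ] → ℍ[ℝ]} (hf : IsSliceRegular f)
    (h0 : ∃ q ∈ unitBall, f q ≠ 0) : ∃ z ∈ 𝔻, (toMat f z).det ≠ 0 := by
  by_contra! hcon
  obtain ⟨q, hq, hfq⟩ := h0
  have hA : ∀ i j, Set.EqOn (fun z => toMat f z i j) 0 𝔻 := fun i j =>
    eqOn_zero_of_real (hf.isHol i j) fun x hx => by
      have hx' : (x : ℂ) ∈ 𝔻 := by simpa using hx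
      rw [eq_zero_of_det_eq_zero_of_real (isSymm_toMat f) (Complex.ofReal_im x) (hcon _ hx')]
      rfl
  apply hfq
  have hz : slicePt q ∈ 𝔻 := by rw [mem_ball_zero_iff, norm_slicePt]; exact hq
  have hs0 : IsSymm fun _ => (0 : M2) := fun z => by
    ext i j
    fin_cases i <;> fin_cases j <;> simp [quatConj]
  rw [hf.eq_ofMat hq, ofMat_congr (isSymm_toMat f) hs0 (by ext i j; exact hA i j hz)]
  simp [ofMat, sliceExt, rowQuat]

lemma order_pairFun {M : ℕ∞} {α : ℕ → ℍ[ℝ]} (h : BlaschkeSeq M α) {z : ℂ} (hz : z ∈ 𝔻)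
    (him : 0 ≤ z.im) {m : ℕ} (hm : {j : ℕ | (j : ℕ∞) < M ∧ slicePt (α j) = z}.encard = m) :
    analyticOrderAt (pairFun M α) z = m * analyticOrderAt (quad z) z := by
  have h1 := encard_pairs hm
  have h2 := order_det_blaschke h.conjPairs hz him (by
    simp only [slicePt_conjPairs]
    rw [← Set.encard_lt_top_iff, h1]
    exact_mod_cast ENat.natCast_lt_top (2 * m))
  simp only [slicePt_conjPairs] at h2
  rw [h1, order_mul_disc h.differentiableOn_pairFun h.differentiableOn_pairFun (fun z _ => by
    rw [limProd_pairs h z, Matrix.det_smul]; simp [pairFun, pow_two]) hz, ← two_mul, mul_assoc] at h2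
  -- The determinant of the scalar matrix is the square of `pairFun` and each point is counted
  -- twice, so a factor 2 cancels.
  exact (ENat.mul_right_strictMono two_ne_zero (ENat.natCast_ne_top 2)).injective h2

/-- A regular function with the Blaschke condition on the zeros of its symmetrization is the product
of a zero-free function and a Blaschke product. -/
theorem IsSliceRegular.exists_factorization {f : ℍ[ℝ] → ℍ[ℝ]} (hf : IsSliceRegular f)
    (h0 : ∃ q ∈ unitBall, f q ≠ 0)
    (hsum : Summable fun z : 𝔻 =>
      (analyticOrderNatAt (fun z => (toMat f z).det) z : ℝ) * (1 - ‖(z : ℂ)‖)) :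
    ∃ (H : ℂ → M2) (M N : ℕ∞) (α c : ℕ → ℍ[ℝ]), IsSymm H ∧ IsHol H ∧ (∀ z ∈ 𝔻, (H z).det ≠ 0) ∧
      BlaschkeSeq M α ∧ BlaschkeSeq N c ∧
      (∀ z ∈ 𝔻, toMat f z = H z * (limProd (facMat (2 * M) (conjPairs α)) z * limProd (facMat N c) z)) ∧
      (∀ i : ℕ, (i : ℕ∞) < M → (α i).im ≠ 0) ∧
      ∀ x y : ℝ, x ^ 2 + y ^ 2 < 1 → ∃ m n : ℕ,
        HasMultiplicities f x y m n ∧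
        {i : ℕ | (i : ℕ∞) < M ∧ α i ∈ sphereAt x y}.encard = m ∧
        {i : ℕ | (i : ℕ∞) < N ∧ c i ∈ sphereAt x y}.encard = n := by
  set A := toMat f with hA
  set d := fun z => (A z).det with hd
  have hAs : IsSymm A := isSymm_toMat f
  have hAd : IsHol A := hf.isHol
  have hd0 := exists_det_toMat_ne_zero hf h0
  have hdtop : ∀ z ∈ 𝔻, analyticOrderAt d z ≠ ⊤ := fun z hz => order_ne_top hAd.det hd0 hz
  set m : ℂ → ℕ := fun z => (matOrd A z).toNat with hm
  have hmA : ∀ z ∈ 𝔻, matOrd A z = m z := by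
    intro z hz
    refine (ENat.natCast_toNat fun h => hdtop z hz ?_).symm
    have := two_mul_matOrd_le hAd hz
    rw [h] at this
    simpa using this
  -- At real points there is no spherical part, so the common order itself is the isolated
  -- multiplicity.
  set n : ℂ → ℕ := fun z => if z.im = 0 then m z else analyticOrderNatAt d z - 2 * m z with hn
  have hcast : ∀ z ∈ 𝔻, (analyticOrderNatAt d z : ℕ∞) = analyticOrderAt d z := fun z hz =>
    Nat.cast_analyticOrderNatAt (hdtop z hz)
  have hle : ∀ z ∈ 𝔻, 2 * m z ≤ analyticOrderNatAt d z := by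
    intro z hz
    have := two_mul_matOrd_le hAd hz
    rw [hmA z hz, ← hcast z hz] at this
    exact_mod_cast this
  have hord : ∀ z ∈ 𝔻, z.im ≠ 0 → analyticOrderAt d z = 2 * m z + n z := by
    intro z hz him
    rw [← hcast z hz]
    have h1 := hle z hz
    have h2 : n z = analyticOrderNatAt d z - 2 * m z := if_neg him
    exact_mod_cast (by omega : analyticOrderNatAt d z = 2 * m z + n z)
  have hreal : ∀ x : ℝ, (x : ℂ) ∈ 𝔻 → HasMultiplicities f x 0 0 (n x) ∧ analyticOrderAt d x = 2 * n x := by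
    intro x hx
    refine hf.hasMultiplicities_real hx ?_
    rw [hmA _ hx, hn]
    simp
  have hord0 : ∀ z ∈ 𝔻, z.im = 0 → analyticOrderAt d z = 2 * n z := by
    intro z hz him
    have e : ((z.re : ℝ) : ℂ) = z := Complex.ext rfl (by simp [him])
    have := (hreal z.re (by rwa [e])).2
    rwa [e] at this
  have hsub : ∀ {D : Set ℂ} (hD : D ⊆ 𝔻) {k : ℂ → ℕ} (_ : ∀ z ∈ D, k z ≤ analyticOrderNatAt d z),
      Summable fun z : D => (k z : ℝ) * (1 - ‖(z : ℂ)‖) := by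
    intro D hD k hk
    have hp : ∀ z : D, 0 ≤ 1 - ‖(z : ℂ)‖ := fun z => by
      have := mem_ball_zero_iff.1 (hD z.2)
      linarith
    refine Summable.of_nonneg_of_le (fun z => mul_nonneg (Nat.cast_nonneg _) (hp z)) (fun z => ?_)
      (hsum.comp_injective (Set.inclusion_injective hD))
    exact mul_le_mul_of_nonneg_right (by exact_mod_cast hk z z.2) (hp z)
  -- Every sphere has one representative in the closed upper half plane. Spherical zeros are listed
  -- off the real axis, isolated ones with it included.
  obtain ⟨M, w, hw, hwD, hw0, hws, hwc⟩ := exists_enumeration (D := {z | z ∈ 𝔻 ∧ 0 < z.im}) (m := m)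
    (fun z hz => hz.1) (hsub (fun z hz => hz.1) fun z hz => by have := hle z hz.1; omega)
  obtain ⟨N, v, hv, hvD, hv0, hvs, hvc⟩ := exists_enumeration (D := {z | z ∈ 𝔻 ∧ 0 ≤ z.im}) (m := n)
    (fun z hz => hz.1) (hsub (fun z hz => hz.1) fun z hz => by
      have := hle z hz.1
      simp only [hn]
      split_ifs <;> omega)
  have him_w : ∀ j, 0 ≤ (w j).im := fun j => by
    by_cases hj : (j : ℕ∞) < M
    · exact (hwD j hj).2.le
    · simp [hw0 j hj]
  have him_v : ∀ j, 0 ≤ (v j).im := fun j => by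
    by_cases hj : (j : ℕ∞) < N
    · exact (hvD j hj).2
    · simp [hv0 j hj]
  set α : ℕ → ℍ[ℝ] := fun j => w j with hα
  have hsα : ∀ j, slicePt (α j) = w j := fun j => slicePt_coe (him_w j)
  have hBα : BlaschkeSeq M α := by
    refine ⟨fun j _ => ?_, ?_⟩
    · rw [← norm_slicePt, hsα]
      simpa using hw j
    · unfold defect
      simp only [← norm_slicePt (α _), hsα]
      exact hws
  have hBv : BlaschkeSeq N fun j => (v j : ℍ[ℝ]) := by
    refine ⟨fun j _ => ?_, ?_⟩
    · rw [← norm_slicePt, slicePt_coe (him_v j)]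
      simpa using hv j
    · unfold defect
      simp only [← norm_slicePt ((v _ : ℂ) : ℍ[ℝ]), slicePt_coe (him_v _)]
      exact hvs
  set b := pairFun M α with hb
  have hbo : ∀ z ∈ 𝔻, 0 < z.im → analyticOrderAt b z = m z := by
    intro z hz him
    rw [hb, order_pairFun hBα hz him.le (m := m z) (by simp only [hsα]; exact hwc z ⟨hz, him⟩),
      order_quad_self him, mul_one]
  have hempty : ∀ z : ℂ, z.im = 0 → {j : ℕ | (j : ℕ∞) < M ∧ w j = z}.encard = (0 : ℕ) := by
    intro z him
    rw [Nat.cast_zero, Set.encard_eq_zero]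
    refine Set.eq_empty_of_forall_notMem fun j hj => ?_
    have h1 := (hwD j hj.1).2
    rw [hj.2, him] at h1
    exact lt_irrefl _ h1
  have hbo0 : ∀ z ∈ 𝔻, z.im = 0 → analyticOrderAt b z = 0 := by
    intro z hz him
    rw [hb, order_pairFun hBα hz him.ge (m := 0) (by simp only [hsα]; exact hempty z him)]
    simp
  have h0mem : (0 : ℂ) ∈ 𝔻 := Metric.mem_ball_self one_pos
  have hbd : DifferentiableOn ℂ b 𝔻 := hBα.differentiableOn_pairFun
  have hb0 : ∃ z ∈ 𝔻, b z ≠ 0 :=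
    ⟨0, h0mem, (analyticAt_of_disc hbd h0mem).analyticOrderAt_eq_zero.1 (hbo0 0 h0mem rfl)⟩
  have hble : ∀ z ∈ 𝔻, 0 ≤ z.im → analyticOrderAt b z ≤ matOrd A z := by
    intro z hz him
    rcases him.eq_or_lt with him | him
    · rw [hbo0 z hz him.symm]; exact zero_le
    · rw [hbo z hz him, hmA z hz]
  have hbconj : ∀ z ∈ 𝔻, analyticOrderAt b (conj z) = analyticOrderAt b z := by
    intro z hz
    rw [← order_conj_conj hbd hz]
    congr 1
    funext y
    rw [hb, hBα.pairFun_conj, Complex.conj_conj]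
  -- The scalar b has order m at nonreal points of the upper half plane and order 0 on the real
  -- axis, so it divides every entry of A.
  obtain ⟨F, hFs, hFd, hF⟩ := exists_eq_smul hbd hb0 hBα.pairFun_conj hAs hAd (by
    intro z hz i j
    refine le_trans ?_ (matOrd_le A z i j)
    rcases le_total 0 z.im with him | him
    · exact hble z hz him
    · rw [← hbconj z hz, ← matOrd_eq hAs hAd hz]
      exact hble _ (conj_mem_disc hz) (by simpa using him))
  have hFo : ∀ z ∈ 𝔻, 0 ≤ z.im →
      analyticOrderAt (fun z => (F z).det) z = n z * analyticOrderAt (quad z) z := by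
    intro z hz him
    have h1 : analyticOrderAt d z
        = analyticOrderAt (fun z => b z * b z) z + analyticOrderAt (fun z => (F z).det) z :=
      order_mul_disc (hbd.mul hbd) hFd.det (fun z hz => by
        rw [hd]
        simp only
        rw [hF z hz, Matrix.det_smul, Fintype.card_fin, pow_two]
        rfl) hz
    rw [order_mul_disc hbd hbd (fun _ _ => rfl) hz] at h1
    rcases him.eq_or_lt with him | him
    · rw [hbo0 z hz him.symm, add_zero, zero_add, hord0 z hz him.symm] at h1
      rw [← h1, order_quad_real him.symm, mul_comm]
    · rw [hbo z hz him, hord z hz him.ne', ← two_mul] at h1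
      rw [order_quad_self him, mul_one]
      exact (ENat.add_right_injective_of_ne_top (by
        exact_mod_cast ENat.natCast_ne_top (2 * m z)) h1).symm
  obtain ⟨c, H, hcv, hHs, hHd, hH⟩ := QuatHardy.exists_factorization hv him_v hBv hFs hFd (by
    intro k z hz
    rcases le_total 0 z.im with him | him
    · rw [hFo z hz him]
      refine (sum_facOrd_le him_v him k).trans_eq ?_
      rw [hvc z ⟨hz, him⟩]
    · have him' : 0 ≤ (conj z).im := by simpa using him
      rw [← order_det_conj hFs hFd hz, hFo _ (conj_mem_disc hz) him']
      refine le_trans (le_of_eq (Finset.sum_congr rfl fun j _ => (facOrd_conj N v hz j).symm)) ?_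
      refine (sum_facOrd_le him_v him' k).trans_eq ?_
      rw [hvc _ ⟨conj_mem_disc hz, him'⟩])
  have hBc : BlaschkeSeq N c := hBv.congr fun j => by rw [hcv, slicePt_coe (him_v j)]
  have hcn : ∀ z ∈ 𝔻, 0 ≤ z.im → {j : ℕ | (j : ℕ∞) < N ∧ slicePt (c j) = z}.encard = n z := by
    intro z hz him
    simp only [hcv]
    exact hvc z ⟨hz, him⟩
  -- The Blaschke product over c already uses up the whole finite order of det F, so none is left
  -- for det H.
  have hHne : ∀ z ∈ 𝔻, 0 ≤ z.im → (H z).det ≠ 0 := by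
    intro z hz him
    refine (analyticAt_of_disc hHd.det hz).analyticOrderAt_eq_zero.1 ?_
    have h1 := order_det_mul hHd hBc.nearOne.isHol_limProd hH hz
    rw [order_det_blaschke hBc hz him (by
      rw [← Set.encard_lt_top_iff, hcn z hz him]; exact ENat.natCast_lt_top _), hcn z hz him,
      hFo z hz him] at h1
    have h2 : (n z : ℕ∞) * analyticOrderAt (quad z) z ≠ ⊤ :=
      WithTop.mul_ne_top (ENat.natCast_ne_top _) (order_quad_ne_top _ _)
    exact (ENat.add_left_injective_of_ne_top h2 ((zero_add _).trans h1)).symm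
  refine ⟨H, M, N, α, c, hHs, hHd, ?_, hBα, hBc, ?_, ?_, ?_⟩
  · intro z hz
    rcases le_total 0 z.im with him | him
    · exact hHne z hz him
    · have h1 := hHne _ (conj_mem_disc hz) (by simpa using him)
      rw [det_conj hHs] at h1
      exact fun h => h1 (by rw [h, map_zero])
  · intro z hz
    rw [hF z hz, hH z hz, limProd_pairs hBα z, smul_mul_assoc, one_mul, mul_smul_comm]
    rfl
  · intro i hi h
    have h1 := (hwD i hi).2
    rw [← hsα, slicePt, h] at h1
    simp at h1
  · intro x y hxy
    have hz := mem_disc_mk hxy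
    simp only [sphereAt_iff, hsα]
    by_cases hy : y = 0
    · subst hy
      have e : (⟨x, |0|⟩ : ℂ) = x := Complex.ext rfl (by simp)
      rw [e] at hz ⊢
      exact ⟨0, n x, (hreal x hz).1, hempty _ (Complex.ofReal_im x),
        hcn _ hz (Complex.ofReal_im x).ge⟩
    · have him : 0 < (⟨x, |y|⟩ : ℂ).im := abs_pos.2 hy
      exact ⟨_, _, hf.hasMultiplicities hxy hy (hmA _ hz) (hord _ hz him.ne'), hwc _ ⟨hz, him⟩,
        hcn _ hz him.le⟩

end QuatHardy

end

/-! ### The theorem: translation back to functions on the ball. -/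

open QuatHardy
theorem mainTheorem3 (p : ℝ≥0∞) (hp : 0 < p) (f : ℍ[ℝ] → ℍ[ℝ])
    (hf : MemHardy p f) (hf0 : ∃ q ∈ unitBall, f q ≠ 0) :
    ∃ h g : ℍ[ℝ] → ℍ[ℝ],
      IsSliceRegular h ∧ IsSliceRegular g ∧
      (∀ q ∈ unitBall, h q ≠ 0) ∧
      IsBlaschkeProduct g ∧
      (∀ q ∈ unitBall, f q = starMul h g q) ∧
      -- `g` is the product of a Blaschke product of the spherical zeros and one of conjugates of
      -- the isolated zeros, with multiplicities
      ∃ (Bs Bi : ℍ[ℝ] → ℍ[ℝ]) (M N : ℕ∞) (α c : ℕ → ℍ[ℝ]),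
        IsSliceRegular Bs ∧ IsSliceRegular Bi ∧
        (∀ q ∈ unitBall, g q = starMul Bs Bi q) ∧
        IsBlaschkeProductOf (2 * M) (conjPairs α) Bs ∧
        IsBlaschkeProductOf N c Bi ∧
        (∀ i : ℕ, (i : ℕ∞) < M → (α i).im ≠ 0) ∧
        ∀ x y : ℝ, x ^ 2 + y ^ 2 < 1 → ∃ m n : ℕ,
          HasMultiplicities f x y m n ∧
          {i : ℕ | (i : ℕ∞) < M ∧ α i ∈ sphereAt x y}.encard = m ∧
          {i : ℕ | (i : ℕ∞) < N ∧ c i ∈ sphereAt x y}.encard = n := by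
  obtain ⟨C, hC⟩ := hf.exists_circleAverage_le hp
  obtain ⟨H, M, N, α, c, hHs, hHd, hH0, hα, hc, hfac, him, hmult⟩ := hf.1.exists_factorization hf0
    (summable_of_circleAverage_le hf.1.isHol.det (exists_det_toMat_ne_zero hf.1 hf0) hC)
  have hLs := hα.conjPairs.nearOne.isSymm_limProd (isSymm_facMat (2 * M) (conjPairs α))
  have hLd := hα.conjPairs.nearOne.isHol_limProd
  have hRs := hc.nearOne.isSymm_limProd (isSymm_facMat N c)
  have hRd := hc.nearOne.isHol_limProd
  have hmem : ∀ q ∈ unitBall, slicePt q ∈ Metric.ball (0 : ℂ) 1 := fun q hq => by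
    rw [mem_ball_zero_iff, norm_slicePt]; exact hq
  refine ⟨ofMat H, ofMat fun z => limProd (facMat (2 * M) (conjPairs α)) z * limProd (facMat N c) z,
    isSliceRegular_ofMat hHs hHd, isSliceRegular_ofMat (hLs.mul hRs) (hLd.mul hRd),
    fun q hq => ofMat_ne_zero hHs (hH0 _ (hmem q hq)), ?_, ?_, ?_⟩
  -- The interleaved sequence makes the product of the two Blaschke products a Blaschke product of a
  -- single sequence.
  · obtain ⟨K, a, ha, hK⟩ := exists_merge hα hc
    obtain ⟨h1, h2, h3⟩ := isBlaschkeProductOf_limProd ha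
    refine ⟨K, a, h1, h2, fun S hS hSc => (h3 S hS hSc).congr_right fun q hq => ?_⟩
    exact ofMat_congr (ha.nearOne.isSymm_limProd (isSymm_facMat K a)) (hLs.mul hRs)
      (hK _ (hmem q (hS hq)))
  · intro q hq
    rw [starMul_eq, toMat_ofMat hHs, toMat_ofMat (hLs.mul hRs), hf.1.eq_ofMat hq]
    exact ofMat_congr (isSymm_toMat f) (hHs.mul (hLs.mul hRs)) (hfac _ (hmem q hq))
  · refine ⟨ofMat (limProd (facMat (2 * M) (conjPairs α))), ofMat (limProd (facMat N c)), M, N, α, c,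
      isSliceRegular_ofMat hLs hLd, isSliceRegular_ofMat hRs hRd, fun q _ => ?_,
      isBlaschkeProductOf_limProd hα.conjPairs, isBlaschkeProductOf_limProd hc, him, hmult⟩
    rw [starMul_eq, toMat_ofMat hLs, toMat_ofMat hRs]
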